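/- **Theorem 2.2 (Key Estimate).** Let $(\mathcal M,g)$ be a smooth connected Riemannian $n$-manifold without boundary (not necessarily complete), let $\mathrm{dist}_p(x)$ be the Riemannian distance from $p$ to $x$, $B_p(r)=\{x:\mathrm{dist}_p(x)<r\}$, $\Delta_g$ the Laplace–Beltrami operator ($\Delta_g f=\operatorname{tr}_g\nabla^2 f$) and $\mathrm{Ric}_p$ the Ricci curvature at $p$ (positive on round spheres). Let $K\subset\mathcal M$ be compact (for instance $K=\{p\}$, or $K=\mathcal M$ if $\mathcal M$ is compact). Then there are constants $r_0>0$, $C_1>0$, $C_2>0$, depending only on $\mathcal M$ and $K$, such that for all $p\in K$ and all $0<r<r_0$ the function $\mathrm{dist}_p^2$ is smooth on $B_p(r)$ and the following holds for all $x\in B_p(r)$. If $x\neq p$, there is exactly one unit vector $v\in T_p\mathcal M$ such that the geodesic starting at $p$ with velocity $v$ is at $x$ at time $\mathrm{dist}_p(x)$, that is, $x=\exp_p(\mathrm{dist}_p(x)\,v)$. For this $v$ (and for every unit vector $v$ if $x=p$), $$\Big|\Delta_g(\mathrm{dist}_p^2)(x)-2n+\tfrac23\,\mathrm{Ric}_p(v,v)\,\mathrm{dist}_p(x)^2\Big|\le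 C_1 r^3 .$$ In particular, $$\big|\Delta_g(\mathrm{dist}_p^2)(x)-2n\big|\le C_2 r^2 .$$ -/

import Mathlib

open Bundle
open scoped Manifold ContDiff

noncomputable section

namespace KeyEstimate

/-- The `i`-th partial derivative at `y` of a function on `ℝⁿ`. -/
def partialDeriv {n : ℕ} (i : Fin n) (F : EuclideanSpace ℝ (Fin n) → ℝ)
    (y : EuclideanSpace ℝ (Fin n)) : ℝ :=
  fderiv ℝ F y (EuclideanSpace.single i 1)

section Riemannian

variable {n : ℕ} {M : Type*} [TopologicalSpace M] [ChartedSpace (EuclideanSpace ℝ (Fin n)) M]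

/-- The `i`-th coordinate vector `∂ᵢ` of the preferred chart around `c`, at the point of `M` with
coordinates `y` in that chart. -/
def coordVector (c : M) (y : EuclideanSpace ℝ (Fin n)) (i : Fin n) :
    TangentSpace (𝓡 n) ((extChartAt (𝓡 n) c).symm y) :=
  mfderiv (𝓡 n) (𝓡 n) (extChartAt (𝓡 n) c).symm y
    (EuclideanSpace.single i (1 : ℝ) : EuclideanSpace ℝ (Fin n))

/-- The components `vⁱ` of a tangent vector `v` at `p` in the preferred chart around `p`. -/
def components (p : M) (v : TangentSpace (𝓡 n) p) : EuclideanSpace ℝ (Fin n) :=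
  mfderiv (𝓡 n) (𝓡 n) (extChartAt (𝓡 n) p) p v

variable [RiemannianBundle (fun x : M ↦ TangentSpace (𝓡 n) x)]

/-- The Gram matrix `gᵢⱼ = g(∂ᵢ, ∂ⱼ)` of the Riemannian metric in the preferred chart around `c`,
as a function of the coordinates `y`. -/
def metricMatrix (c : M) (y : EuclideanSpace ℝ (Fin n)) : Matrix (Fin n) (Fin n) ℝ :=
  Matrix.of fun i j ↦ inner ℝ (coordVector c y i) (coordVector c y j)

/-- The Christoffel symbol `Γᵏᵢⱼ` of the Levi-Civita connection in the preferred chart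
around `c`. -/
def christoffel (c : M) (k i j : Fin n) (y : EuclideanSpace ℝ (Fin n)) : ℝ :=
  (1 / 2) * ∑ l, (metricMatrix c y)⁻¹ k l *
    (partialDeriv i (fun z ↦ metricMatrix c z j l) y
      + partialDeriv j (fun z ↦ metricMatrix c z i l) y
      - partialDeriv l (fun z ↦ metricMatrix c z i j) y)

/-- The component `Rᵢⱼ` of the Ricci tensor in the preferred chart around `c`. The sign is the
usual one, for which round spheres have positive Ricci curvature. -/
def ricciCoord (c : M) (i j : Fin n) (y : EuclideanSpace ℝ (Fin n)) : ℝ :=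
  ∑ k, (partialDeriv k (christoffel c k i j) y - partialDeriv j (christoffel c k i k) y)
    + ∑ k, ∑ l, (christoffel c k k l y * christoffel c l i j y
      - christoffel c k j l y * christoffel c l i k y)

/-- The Ricci curvature `Ric_p(v, w)` of two tangent vectors at `p`. -/
def ricci (p : M) (v w : TangentSpace (𝓡 n) p) : ℝ :=
  ∑ i, ∑ j, ricciCoord p i j (extChartAt (𝓡 n) p p) * components p v i * components p w j

/-- The Laplace-Beltrami operator, `Δ_g f = gⁱʲ (∂ᵢ∂ⱼ f - Γᵏᵢⱼ ∂ₖ f)`, evaluated at `x` in the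
preferred chart around `x`. -/
def laplaceBeltrami (f : M → ℝ) (x : M) : ℝ :=
  let u : EuclideanSpace ℝ (Fin n) → ℝ := fun y ↦ f ((extChartAt (𝓡 n) x).symm y)
  let a : EuclideanSpace ℝ (Fin n) := extChartAt (𝓡 n) x x
  ∑ i, ∑ j, (metricMatrix x a)⁻¹ i j *
    (partialDeriv i (partialDeriv j u) a - ∑ k, christoffel x k i j a * partialDeriv k u a)

/-- The curve `γ` is a geodesic on the open set `s` of times: it is smooth there and satisfies the
geodesic equation `γ̈ᵏ + Γᵏᵢⱼ γ̇ⁱ γ̇ʲ = 0` at every time `t ∈ s`, in the preferred chart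
around `γ t`. -/
def IsGeodesicOn (γ : ℝ → M) (s : Set ℝ) : Prop :=
  ContMDiffOn 𝓘(ℝ, ℝ) (𝓡 n) ∞ γ s ∧
    ∀ t ∈ s, ∀ k : Fin n,
      let u : Fin n → ℝ → ℝ := fun i τ ↦ (extChartAt (𝓡 n) (γ t) (γ τ) : EuclideanSpace ℝ (Fin n)) i
      deriv (deriv (u k)) t
        + ∑ i, ∑ j, christoffel (γ t) k i j (extChartAt (𝓡 n) (γ t) (γ t))
            * deriv (u i) t * deriv (u j) t = 0

end Riemannian

/-- The unit tangent vector `v` at `p` is a direction of the geodesic flow from `p` to `x`: the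
geodesic that starts at `p` with velocity `v` is at `x` at time `dist p x`,
i.e. `x = exp_p (dist p x • v)`. -/
def IsDirection {n : ℕ} {M : Type*} [MetricSpace M] [ChartedSpace (EuclideanSpace ℝ (Fin n)) M]
    [RiemannianBundle (fun x : M ↦ TangentSpace (𝓡 n) x)]
    (p x : M) (v : TangentSpace (𝓡 n) p) : Prop :=
  ‖v‖ = 1 ∧ ∃ γ : ℝ → M, ∃ ε > 0,
    IsGeodesicOn (n := n) γ (Set.Ioo (-ε) (dist p x + ε)) ∧
    (⟨γ 0, mfderiv 𝓘(ℝ, ℝ) (𝓡 n) γ 0 (1 : ℝ)⟩ : TangentBundle (𝓡 n) M) = ⟨p, v⟩ ∧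
    γ (dist p x) = x

end KeyEstimate

end

/-! In normal coordinates at p the rays t ↦ t w are geodesics, so Γ_w(w, w) = 0. By the Koszul
formula this is a first order identity for the metric g (the field `radial`), and it integrates to
the Gauss lemma g_w(w, u) = g_0(w, u) (`NormalMetric.gauss`). The Gauss lemma is used twice. With
Cauchy–Schwarz it shows that the radial coordinate grows along a curve no faster than the length;
hence the distance to p is the g_0-norm of w on a small ball (`NormalChart.dist_eq`), and dist² is a
smooth quadratic form there. Differentiated once, it gives the exact formula Δ|w|² = 2n + tr(g_w⁻¹
∂_w g) (`NormalMetric.lap_sqNorm`).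

Along the ray t w the trace is t q(t), with q(0) = 0 because the first derivatives of g vanish at
the origin, and q'(0) = tr(g_0⁻¹ D²g(w, w)). Polarizing D²g(w, w)(w, u) = 0 expresses every second
derivative that enters the Ricci curvature through D²g(w, w), and the result is Ric(w, w) = -(3/2)
tr(g_0⁻¹ D²g(w, w)) (`NormalMetric.ric_zero`). So the second order Taylor term is -(2/3) Ric(w, w),
and the remainder is cubic.

The constants are uniform in p because normal coordinates depend smoothly on their center. The
family e(p, w) of exponential maps comes from the inverse function theorem on E × E × C([0,1], E),
applied to the integral equation of geodesics (`exists_expMap`): the spray is quadratic in the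
velocity, so the linearization at zero velocity is invertible, and homogeneity turns rays into
geodesics. Bounds for t-derivatives of the Laplacian on a compact set then give
`exists_taylor_bound`, and a covering argument passes from neighborhoods of points to K.

The statement is written in the preferred chart at each point. Laplacian, Ricci curvature and
geodesic equation are invariant under isometries of coordinate metrics (`IsometryAt.lap_law`,
`IsometryAt.ric_law`, `IsometryAt.geodesic_law`), and changes of parametrization are such isometries
(`ParamAt.isometryAt`). Uniqueness of the direction holds because a geodesic from p is a ray
(`NormalChart.eqOn_ray`) and the normal parametrization is injective. -/

noncomputable section

namespace KeyEstimate

section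

open Set Filter Topology Metric

/-! ### Smoothness of superposition operators on spaces of continuous maps. -/

section Superposition

variable {K : Type*} [TopologicalSpace K] [CompactSpace K]
  {E F L : Type*} [NormedAddCommGroup E] [NormedSpace ℝ E] [NormedAddCommGroup F] [NormedSpace ℝ F]
  [NormedAddCommGroup L] [NormedSpace ℝ L]

/-- A continuous bilinear map, applied pointwise to continuous maps on a compact space. -/
def pointwiseBilin (K : Type*) [TopologicalSpace K] [CompactSpace K] (b : L →L[ℝ] E →L[ℝ] F) :
    C(K, L) →L[ℝ] C(K, E) →L[ℝ] C(K, F) :=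
  LinearMap.mkContinuous₂
    (LinearMap.mk₂ ℝ (fun (A : C(K, L)) (h : C(K, E)) ↦
        (⟨fun x ↦ b (A x) (h x), by fun_prop⟩ : C(K, F)))
      (fun _ _ _ ↦ by ext; simp) (fun _ _ _ ↦ by ext; simp)
      (fun _ _ _ ↦ by ext; simp) (fun _ _ _ ↦ by ext; simp)) ‖b‖
    (fun A h ↦ by
      refine (ContinuousMap.norm_le _ (by positivity)).2 fun x ↦ ?_
      refine (b.le_opNorm₂ (A x) (h x)).trans ?_
      gcongr
      · exact A.norm_coe_le_norm x
      · exact h.norm_coe_le_norm x)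

@[simp] lemma pointwiseBilin_apply (b : L →L[ℝ] E →L[ℝ] F) (A : C(K, L)) (h : C(K, E)) (x : K) :
    pointwiseBilin K b A h x = b (A x) (h x) := rfl

/-- The pointwise mean value inequality is uniform over K because postcomposition with f' is
continuous for the sup norm. -/
lemma hasFDerivAt_postcomp {f : C(E, F)} {f' : C(E, L)} {b : L →L[ℝ] E →L[ℝ] F}
    (hf : ∀ x, HasFDerivAt f (b (f' x)) x) (φ : C(K, E)) :
    HasFDerivAt (fun φ : C(K, E) ↦ f.comp φ) (pointwiseBilin K b (f'.comp φ)) φ := by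
  rw [hasFDerivAt_iff_isLittleO_nhds_zero, Asymptotics.isLittleO_iff]
  intro ε hε
  have hc : Continuous fun φ : C(K, E) ↦ f'.comp φ := ContinuousMap.continuous_postcomp _
  have hε' : 0 < ε / (‖b‖ + 1) := by positivity
  obtain ⟨δ, hδ, H⟩ := Metric.continuous_iff.1 hc φ _ hε'
  filter_upwards [Metric.ball_mem_nhds (0 : C(K, E)) hδ] with h hh
  rw [mem_ball_zero_iff] at hh
  refine (ContinuousMap.norm_le _ (by positivity)).2 fun x ↦ ?_
  -- Adding the constant z - φ x to φ moves it by less than δ in the sup norm and takes the value z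
  -- at x. Continuity at φ thus controls f' on the whole ball, with δ independent of x.
  have key : ∀ z ∈ ball (φ x) δ, ‖b (f' z) - b (f' (φ x))‖ ≤ ε := by
    intro z hz
    have h1 := H (φ + ContinuousMap.const K (z - φ x)) (by
      rw [dist_eq_norm, add_sub_cancel_left]
      refine (ContinuousMap.norm_lt_iff _ hδ).2 fun y ↦ ?_
      simpa [dist_eq_norm] using hz)
    rw [dist_eq_norm] at h1
    have h2 := (ContinuousMap.norm_coe_le_norm _ x).trans h1.le
    have h3 : ‖f' z - f' (φ x)‖ ≤ ε / (‖b‖ + 1) := by simpa using h2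
    rw [← map_sub]
    calc ‖b (f' z - f' (φ x))‖ ≤ ‖b‖ * (ε / (‖b‖ + 1)) := b.le_opNorm_of_le h3
      _ ≤ (‖b‖ + 1) * (ε / (‖b‖ + 1)) := by gcongr; linarith
      _ = ε := by field_simp
  have hx : ‖h x‖ ≤ ‖h‖ := h.norm_coe_le_norm x
  have := (convex_ball (φ x) δ).norm_image_sub_le_of_norm_hasFDerivWithin_le' (𝕜 := ℝ) (f := f)
    (φ := b (f' (φ x))) (fun z _ ↦ (hf z).hasFDerivWithinAt) key (mem_ball_self hδ)
    (y := φ x + h x) (by simpa [dist_eq_norm] using hx.trans_lt hh)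
  simp only [add_sub_cancel_left] at this
  refine le_trans (le_of_eq ?_) (this.trans (by gcongr))
  simp

lemma contDiff_postcomp_succ {m : ℕ} {f : C(E, F)} {f' : C(E, L)} {b : L →L[ℝ] E →L[ℝ] F}
    (hf : ∀ x, HasFDerivAt f (b (f' x)) x) (hf' : ContDiff ℝ m (fun φ : C(K, E) ↦ f'.comp φ)) :
    ContDiff ℝ (m + 1) (fun φ : C(K, E) ↦ f.comp φ) :=
  contDiff_succ_iff_hasFDerivAt.2 ⟨fun φ ↦ pointwiseBilin K b (f'.comp φ),
    (pointwiseBilin K b).contDiff.comp hf', hasFDerivAt_postcomp hf⟩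

/-- The induction passes from f to its derivative, whose values lie in E →L[ℝ] F, so the spaces are
quantified inside the induction and have to share one universe. -/
theorem contDiff_postcomp_nat (m : ℕ) : ∀ {E F : Type} [NormedAddCommGroup E] [NormedSpace ℝ E]
    [NormedAddCommGroup F] [NormedSpace ℝ F] (f : C(E, F)) (_ : ContDiff ℝ m f),
    ContDiff ℝ m (fun φ : C(K, E) ↦ f.comp φ) := by
  induction m with
  | zero =>
    intro E F _ _ _ _ f hf
    exact contDiff_zero.2 (ContinuousMap.continuous_postcomp _)
  | succ m ih =>
    intro E F _ _ _ _ f hf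
    have hf1 : Differentiable ℝ f := hf.differentiable (by simp)
    have hf2 : ContDiff ℝ m (fderiv ℝ f) := hf.fderiv_right (by simp)
    exact contDiff_postcomp_succ (f' := ⟨fderiv ℝ f, hf2.continuous⟩)
      (b := ContinuousLinearMap.id ℝ (E →L[ℝ] F)) (fun x ↦ (hf1 x).hasFDerivAt) (ih _ hf2)

/-- The superposition operator `φ ↦ f ∘ φ` of a smooth map `f`, on continuous maps on a compact
space, is smooth. -/
theorem contDiff_postcomp {E F : Type} [NormedAddCommGroup E] [NormedSpace ℝ E]
    [NormedAddCommGroup F] [NormedSpace ℝ F] (f : C(E, F)) (hf : ContDiff ℝ ∞ f) :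
    ContDiff ℝ ∞ (fun φ : C(K, E) ↦ f.comp φ) :=
  contDiff_infty.2 fun m ↦ contDiff_postcomp_nat m f (contDiff_infty.1 hf m)

end Superposition

/-! ### The inverse function theorem. -/

section InverseFunction

variable {E F : Type*} [NormedAddCommGroup E] [NormedSpace ℝ E] [CompleteSpace E]
  [NormedAddCommGroup F] [NormedSpace ℝ F]

/-- The inverse function theorem, with an inverse which is smooth on its whole domain. -/
theorem exists_smooth_openPartialHomeomorph {f : E → F} {U : Set E} {a : E} (hU : IsOpen U)
    (ha : a ∈ U) (hf : ContDiffOn ℝ ∞ f U) {f' : E ≃L[ℝ] F}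
    (hf' : HasFDerivAt f (f' : E →L[ℝ] F) a) :
    ∃ e : OpenPartialHomeomorph E F, a ∈ e.source ∧ e.source ⊆ U ∧ (∀ x, e x = f x) ∧
      (∀ x ∈ e.source, ∃ A : E ≃L[ℝ] F, HasFDerivAt f (A : E →L[ℝ] F) x) ∧
      ContDiffOn ℝ ∞ e.symm e.target := by
  have hfa : ∀ x ∈ U, ContDiffAt ℝ ∞ f x := fun x hx ↦ hf.contDiffAt (hU.mem_nhds hx)
  have hstrict : HasStrictFDerivAt f (f' : E →L[ℝ] F) a :=
    (hfa a ha).hasStrictFDerivAt' hf' (by simp)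
  have hcont : ContinuousOn (fderiv ℝ f) U := hf.continuousOn_fderiv_of_isOpen hU (by simp)
  -- Invertibility is an open condition. Restricting to V makes the derivative invertible on the
  -- whole source, hence the inverse smooth on the whole target and not just at f a.
  let V : Set E := U ∩ fderiv ℝ f ⁻¹' (range ((↑) : (E ≃L[ℝ] F) → E →L[ℝ] F))
  have hV : IsOpen V := hcont.isOpen_inter_preimage hU ContinuousLinearEquiv.isOpen
  let e := (hstrict.toOpenPartialHomeomorph f).restrOpen V hV
  have hes : e.source = (hstrict.toOpenPartialHomeomorph f).source ∩ V := rfl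
  have hef : ∀ x, e x = f x := fun x ↦ rfl
  have hA : ∀ x ∈ e.source, ∃ A : E ≃L[ℝ] F, HasFDerivAt f (A : E →L[ℝ] F) x := by
    intro x hx
    rw [hes] at hx
    obtain ⟨A, hA⟩ := hx.2.2
    exact ⟨A, hA ▸ ((hfa x hx.2.1).differentiableAt (by simp)).hasFDerivAt⟩
  refine ⟨e, ?_, ?_, hef, hA, ?_⟩
  · rw [hes]
    exact ⟨hstrict.mem_toOpenPartialHomeomorph_source, ha, f', hf'.fderiv.symm⟩
  · rw [hes]; exact fun x hx ↦ hx.2.1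
  · intro y hy
    obtain ⟨A, hA'⟩ := hA _ (e.map_target hy)
    have hx := e.map_target hy
    rw [hes] at hx
    exact (e.contDiffAt_symm hy hA' (hfa _ hx.2.1)).contDiffWithinAt

end InverseFunction

end

section

open Set Filter Topology Metric unitInterval

/-! ### Curves on [0, 1]: primitives and time rescaling. -/

section Primitive

variable {E : Type*} [NormedAddCommGroup E]

/-- The extension of a curve on `[0, 1]` to the real line, constant on both sides. -/
def extendCurve (ξ : C(I, E)) (t : ℝ) : E := Set.IccExtend zero_le_one ξ t

lemma continuous_extendCurve (ξ : C(I, E)) : Continuous (extendCurve ξ) := by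
  unfold extendCurve
  exact ξ.continuous.Icc_extend'

lemma extendCurve_of_mem (ξ : C(I, E)) {t : ℝ} (ht : t ∈ Icc (0 : ℝ) 1) :
    extendCurve ξ t = ξ ⟨t, ht⟩ := Set.IccExtend_of_mem _ _ ht

lemma norm_extendCurve_le (ξ : C(I, E)) (t : ℝ) : ‖extendCurve ξ t‖ ≤ ‖ξ‖ :=
  ξ.norm_coe_le_norm _

variable [NormedSpace ℝ E]

variable (E) in
/-- Constant curves. -/
def constCurve : E →L[ℝ] C(I, E) :=
  LinearMap.mkContinuous
    { toFun := ContinuousMap.const I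
      map_add' := fun _ _ ↦ rfl
      map_smul' := fun _ _ ↦ rfl } 1
    (fun v ↦ by
      rw [one_mul]
      exact (ContinuousMap.norm_le _ (norm_nonneg _)).2 fun _ ↦ le_rfl)

@[simp] lemma constCurve_apply (v : E) (t : I) : constCurve E v t = v := rfl

variable (E) in
/-- The primitive of a curve on `[0, 1]` that vanishes at `0`. -/
def primitive : C(I, E) →L[ℝ] C(I, E) :=
  LinearMap.mkContinuous
    { toFun := fun ξ ↦ ⟨fun t ↦ ∫ τ in (0 : ℝ)..t, extendCurve ξ τ,
        (intervalIntegral.continuous_primitive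
          (fun a b ↦ (continuous_extendCurve ξ).intervalIntegrable a b) 0).comp
          continuous_subtype_val⟩
      map_add' := fun ξ η ↦ by
        ext t
        exact intervalIntegral.integral_add ((continuous_extendCurve ξ).intervalIntegrable 0 t)
          ((continuous_extendCurve η).intervalIntegrable 0 t)
      map_smul' := fun c ξ ↦ by
        ext t
        exact intervalIntegral.integral_smul c (extendCurve ξ) } 1
    (fun ξ ↦ by
      rw [one_mul]
      refine (ContinuousMap.norm_le _ (norm_nonneg _)).2 fun t ↦ ?_
      have := intervalIntegral.norm_integral_le_of_norm_le_const (a := (0 : ℝ)) (b := t)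
        (f := extendCurve ξ) (C := ‖ξ‖) fun τ _ ↦ norm_extendCurve_le ξ τ
      refine this.trans ?_
      rw [sub_zero, abs_of_nonneg t.2.1]
      exact mul_le_of_le_one_right (norm_nonneg _) t.2.2)

lemma primitive_apply (ξ : C(I, E)) (t : I) :
    primitive E ξ t = ∫ τ in (0 : ℝ)..t, extendCurve ξ τ := rfl

/-- The curve `t ↦ s ξ(s t)`. -/
def rescale (s : I) (ξ : C(I, E)) : C(I, E) :=
  ⟨fun t ↦ (s : ℝ) • ξ (s * t), by fun_prop⟩

lemma extendCurve_rescale (s : I) (ξ : C(I, E)) {t : ℝ} (ht : t ∈ Icc (0 : ℝ) 1) :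
    extendCurve (rescale s ξ) t = (s : ℝ) • extendCurve ξ (s * t) := by
  have h : (s : ℝ) * t ∈ Icc (0 : ℝ) 1 := (s * ⟨t, ht⟩ : I).2
  rw [extendCurve_of_mem _ ht, extendCurve_of_mem _ h]
  rfl

lemma primitive_rescale (s : I) (ξ : C(I, E)) (t : I) :
    primitive E (rescale s ξ) t = primitive E ξ (s * t) := by
  rw [primitive_apply, primitive_apply]
  have : ∫ τ in (0 : ℝ)..t, extendCurve (rescale s ξ) τ =
      ∫ τ in (0 : ℝ)..t, (s : ℝ) • extendCurve ξ (s * τ) := by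
    refine intervalIntegral.integral_congr fun τ hτ ↦ ?_
    rw [uIcc_of_le t.2.1] at hτ
    exact extendCurve_rescale s ξ ⟨hτ.1, hτ.2.trans t.2.2⟩
  rw [this, intervalIntegral.integral_smul, intervalIntegral.smul_integral_comp_mul_left]
  simp

lemma norm_rescale_le (s : I) (ξ : C(I, E)) : ‖rescale s ξ‖ ≤ ‖ξ‖ := by
  refine (ContinuousMap.norm_le _ (norm_nonneg _)).2 fun t ↦ ?_
  change ‖(s : ℝ) • ξ (s * t)‖ ≤ _
  rw [norm_smul, Real.norm_of_nonneg s.2.1]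
  exact (mul_le_of_le_one_left (norm_nonneg _) s.2.2).trans (ξ.norm_coe_le_norm _)

end Primitive

/-! ### The second order equation as a zero set in a Banach space. -/

section Spray

variable {E : Type} [NormedAddCommGroup E] [NormedSpace ℝ E]

/-- The curve of pairs `(p + ∫ ξ, ξ)` in the phase space. -/
def phaseCurve (E : Type) [NormedAddCommGroup E] [NormedSpace ℝ E] :
    E × E × C(I, E) →L[ℝ] C(I, E × E) :=
  (ContinuousLinearMap.compLeftContinuous ℝ I (ContinuousLinearMap.inl ℝ E E)).comp
    ((constCurve E).comp (ContinuousLinearMap.fst ℝ E (E × C(I, E)))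
      + (primitive E).comp ((ContinuousLinearMap.snd ℝ E C(I, E)).comp
          (ContinuousLinearMap.snd ℝ E (E × C(I, E)))))
  + (ContinuousLinearMap.compLeftContinuous ℝ I (ContinuousLinearMap.inr ℝ E E)).comp
      ((ContinuousLinearMap.snd ℝ E C(I, E)).comp (ContinuousLinearMap.snd ℝ E (E × C(I, E))))

lemma phaseCurve_apply (p v : E) (ξ : C(I, E)) (t : I) :
    phaseCurve E (p, v, ξ) t = (p + primitive E ξ t, ξ t) := by
  simp [phaseCurve]

variable (B : E → E →L[ℝ] E →L[ℝ] E)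

/-- The quadratic spray `(y, u) ↦ B y u u`. -/
def spray (z : E × E) : E := B z.1 z.2 z.2

variable {B}

lemma contDiff_spray (hB : ContDiff ℝ ∞ B) : ContDiff ℝ ∞ (spray B) := by
  unfold spray
  fun_prop

-- The spray is quadratic in the velocity, so it vanishes to second order at velocity 0.
set_option synthInstance.maxHeartbeats 200000 in
lemma hasFDerivAt_spray_zero (hB : ContDiff ℝ ∞ B) (y : E) :
    HasFDerivAt (spray B) (0 : E × E →L[ℝ] E) (y, 0) := by
  have h1 : HasFDerivAt (fun z : E × E ↦ B z.1)
      ((fderiv ℝ B y).comp (ContinuousLinearMap.fst ℝ E E)) (y, 0) :=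
    HasFDerivAt.comp (f := Prod.fst) (y, (0 : E))
      ((hB.differentiable (by simp)) y).hasFDerivAt hasFDerivAt_fst
  have h2 : HasFDerivAt (fun z : E × E ↦ z.2) (ContinuousLinearMap.snd ℝ E E) (y, 0) :=
    hasFDerivAt_snd
  refine ((h1.clm_apply h2).clm_apply h2).congr_fderiv ?_
  ext <;> simp

variable (hB : ContDiff ℝ ∞ B)

/-- The superposition operator of the spray. -/
def sprayCurve (ζ : C(I, E × E)) : C(I, E) :=
  (⟨spray B, (contDiff_spray hB).continuous⟩ : C(E × E, E)).comp ζ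

lemma sprayCurve_apply (ζ : C(I, E × E)) (t : I) :
    sprayCurve hB ζ t = B (ζ t).1 (ζ t).2 (ζ t).2 := rfl

lemma contDiff_sprayCurve : ContDiff ℝ ∞ (sprayCurve hB) :=
  contDiff_postcomp (⟨spray B, (contDiff_spray hB).continuous⟩ : C(E × E, E)) (contDiff_spray hB)

lemma hasFDerivAt_sprayCurve (ζ : C(I, E × E)) (hζ : ∀ t, (ζ t).2 = 0) :
    HasFDerivAt (sprayCurve hB) (0 : C(I, E × E) →L[ℝ] C(I, E)) ζ := by
  have hd : ContDiff ℝ ∞ (fderiv ℝ (spray B)) := (contDiff_spray hB).fderiv_right (by simp)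
  have := hasFDerivAt_postcomp (K := I)
    (f := (⟨spray B, (contDiff_spray hB).continuous⟩ : C(E × E, E)))
    (f' := ⟨fderiv ℝ (spray B), hd.continuous⟩)
    (b := ContinuousLinearMap.id ℝ (E × E →L[ℝ] E))
    (fun x ↦ ((contDiff_spray hB).differentiable (by simp) x).hasFDerivAt) ζ
  refine this.congr_fderiv ?_
  ext h t
  have h0 : fderiv ℝ (spray B) (ζ t) = 0 := by
    have : ζ t = ((ζ t).1, 0) := Prod.ext rfl (hζ t)
    rw [this]
    exact (hasFDerivAt_spray_zero hB _).fderiv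
  simp [h0]

/-- The map whose zeros (in the last component) are the velocities `ξ` of the solutions on `[0, 1]`
of the second order equation `γ'' = B γ γ' γ'` with `γ 0 = p` and `γ' 0 = v`. -/
def odeMap (x : E × E × C(I, E)) : E × E × C(I, E) :=
  (x.1, x.2.1, x.2.2 - constCurve E x.2.1 - primitive E (sprayCurve hB (phaseCurve E x)))

lemma contDiff_odeMap : ContDiff ℝ ∞ (odeMap hB) := by
  have := contDiff_sprayCurve hB
  unfold odeMap
  fun_prop

/-- The linearization of `odeMap` at a constant solution. -/
def odeLinear (E : Type) [NormedAddCommGroup E] [NormedSpace ℝ E] :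
    (E × E × C(I, E)) ≃L[ℝ] E × E × C(I, E) :=
  ContinuousLinearEquiv.equivOfInverse
    ((ContinuousLinearMap.fst ℝ E (E × C(I, E))).prod
      (((ContinuousLinearMap.fst ℝ E C(I, E)).prod (ContinuousLinearMap.snd ℝ E C(I, E)
        - (constCurve E).comp (ContinuousLinearMap.fst ℝ E C(I, E)))).comp
          (ContinuousLinearMap.snd ℝ E (E × C(I, E)))))
    ((ContinuousLinearMap.fst ℝ E (E × C(I, E))).prod
      (((ContinuousLinearMap.fst ℝ E C(I, E)).prod (ContinuousLinearMap.snd ℝ E C(I, E)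
        + (constCurve E).comp (ContinuousLinearMap.fst ℝ E C(I, E)))).comp
          (ContinuousLinearMap.snd ℝ E (E × C(I, E)))))
    (fun x ↦ by simp) (fun x ↦ by simp)

/-- At zero velocity the integral term has zero derivative, which leaves (p, v, ξ) ↦ (p, v, ξ - v).
The time interval [0, 1] need not be short; smallness of the velocity replaces it. Keeping p and v
as components makes the inverse function theorem act as an implicit function theorem with
parameters. -/
lemma hasFDerivAt_odeMap (y : E) :
    HasFDerivAt (odeMap hB) (odeLinear E : (E × E × C(I, E)) →L[ℝ] E × E × C(I, E)) (y, 0, 0) := by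
  have h0 : HasFDerivAt (fun x ↦ primitive E (sprayCurve hB (phaseCurve E x)))
      (0 : (E × E × C(I, E)) →L[ℝ] C(I, E)) (y, 0, 0) := by
    have h1 := (hasFDerivAt_sprayCurve hB (phaseCurve E (y, 0, 0))
      (fun t ↦ by rw [phaseCurve_apply]; rfl)).comp (y, 0, 0) (phaseCurve E).hasFDerivAt
    have h2 := (primitive E).hasFDerivAt.comp (y, 0, 0) h1
    refine h2.congr_fderiv ?_
    simp
  have hl : HasFDerivAt (fun x : E × E × C(I, E) ↦ odeLinear E x)
      (odeLinear E : (E × E × C(I, E)) →L[ℝ] E × E × C(I, E)) (y, 0, 0) :=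
    (odeLinear E).hasFDerivAt
  have h3 := hl.sub (HasFDerivAt.prodMk (hasFDerivAt_const (0 : E) (y, (0 : E), (0 : C(I, E))))
    (HasFDerivAt.prodMk (hasFDerivAt_const (0 : E) (y, (0 : E), (0 : C(I, E)))) h0))
  refine (h3.congr_of_eventuallyEq (Eventually.of_forall fun x ↦ ?_)).congr_fderiv ?_
  · simp [odeMap, odeLinear]
  · ext <;> simp

end Spray

end

section

open Set Filter Topology Metric unitInterval

/-! ### The exponential map, jointly smooth in base point and velocity. -/

section Solution

variable {E : Type} [NormedAddCommGroup E] [NormedSpace ℝ E]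
  {B : E → E →L[ℝ] E →L[ℝ] E} (hB : ContDiff ℝ ∞ B)

/-- `ξ` is the velocity on `[0, 1]` of a solution of `γ'' = B γ γ' γ'` with `γ 0 = p`,
`γ' 0 = v`. -/
def IsVelocity (p v : E) (ξ : C(I, E)) : Prop := odeMap hB (p, v, ξ) = (p, v, 0)

variable {hB}

lemma isVelocity_iff {p v : E} {ξ : C(I, E)} :
    IsVelocity hB p v ξ ↔
      ξ = constCurve E v + primitive E (sprayCurve hB (phaseCurve E (p, v, ξ))) := by
  simp only [IsVelocity, odeMap, Prod.mk.injEq, true_and]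
  rw [sub_sub, sub_eq_zero]

/-- Quadratic homogeneity of the spray: t ↦ γ(s t) solves the same equation, with velocity s ξ(s t).
-/
lemma IsVelocity.rescale {p v : E} {ξ : C(I, E)} (h : IsVelocity hB p v ξ) (s : I) :
    IsVelocity hB p ((s : ℝ) • v) (rescale s ξ) := by
  rw [isVelocity_iff] at h ⊢
  have h1 : sprayCurve hB (phaseCurve E (p, (s : ℝ) • v, KeyEstimate.rescale s ξ)) =
      (s : ℝ) • KeyEstimate.rescale s (sprayCurve hB (phaseCurve E (p, v, ξ))) := by
    ext t
    simp only [sprayCurve_apply, phaseCurve_apply, primitive_rescale, ContinuousMap.smul_apply]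
    change B (p + primitive E ξ (s * t)) ((s : ℝ) • ξ (s * t)) ((s : ℝ) • ξ (s * t)) =
      (s : ℝ) • ((s : ℝ) • sprayCurve hB (phaseCurve E (p, v, ξ)) (s * t))
    simp [sprayCurve_apply, phaseCurve_apply]
  rw [h1]
  ext t
  simp only [ContinuousMap.add_apply, constCurve_apply, map_smul, ContinuousMap.smul_apply,
    primitive_rescale]
  change (s : ℝ) • ξ (s * t) = _
  have h2 : ξ (s * t) = v + primitive E (sprayCurve hB (phaseCurve E (p, v, ξ))) (s * t) := by
    conv_lhs => rw [h]
    rfl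
  rw [h2, smul_add]

lemma IsVelocity.extendCurve_eq {p v : E} {ξ : C(I, E)} (h : IsVelocity hB p v ξ) {t : ℝ}
    (ht : t ∈ Icc (0 : ℝ) 1) :
    extendCurve ξ t = v + ∫ τ in (0 : ℝ)..t,
      extendCurve (sprayCurve hB (phaseCurve E (p, v, ξ))) τ := by
  rw [isVelocity_iff] at h
  rw [extendCurve_of_mem _ ht]
  conv_lhs => rw [h]
  rfl

variable [CompleteSpace E]

lemma hasDerivAt_primitive (ξ : C(I, E)) (t : ℝ) :
    HasDerivAt (fun t ↦ ∫ τ in (0 : ℝ)..t, extendCurve ξ τ) (extendCurve ξ t) t :=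
  intervalIntegral.integral_hasDerivAt_right
    ((continuous_extendCurve ξ).intervalIntegrable _ _)
    ((continuous_extendCurve ξ).stronglyMeasurableAtFilter _ _) (continuous_extendCurve ξ).continuousAt

/-- A smooth family of solutions of the second order equation `γ'' = B γ γ' γ'`, with small
initial velocity, near a constant solution. -/
theorem exists_expMap (hB : ContDiff ℝ ∞ B) (y₀ : E) {V : Set E} (hV : V ∈ 𝓝 y₀) :
    ∃ δ > (0 : ℝ), ∃ e : E × E → E, ContDiffOn ℝ ∞ e (ball y₀ δ ×ˢ ball 0 δ) ∧
      ∀ p ∈ ball y₀ δ, e (p, 0) = p ∧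
        fderiv ℝ (fun w ↦ e (p, w)) 0 = ContinuousLinearMap.id ℝ E ∧
        ∀ w ∈ ball (0 : E) δ, e (p, w) ∈ V ∧
          fderiv ℝ (fderiv ℝ (fun w ↦ e (p, w))) w w w =
            B (e (p, w)) (fderiv ℝ (fun w ↦ e (p, w)) w w) (fderiv ℝ (fun w ↦ e (p, w)) w w) := by
  obtain ⟨Φ, hmem, -, hΦ, -, hsymm⟩ := exists_smooth_openPartialHomeomorph isOpen_univ
    (mem_univ (y₀, (0 : E), (0 : C(I, E)))) (contDiff_odeMap hB).contDiffOn
    (hasFDerivAt_odeMap hB y₀)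
  have h00 : odeMap hB (y₀, 0, 0) = (y₀, 0, 0) := by
    refine isVelocity_iff.2 ?_
    ext t
    simp [primitive_apply, extendCurve, IccExtend, sprayCurve_apply,
      phaseCurve_apply]
  -- the velocity of the solution with given initial data
  let S : E × E → C(I, E) := fun x ↦ (Φ.symm (x.1, x.2, 0)).2.2
  let e : E × E → E := fun x ↦ x.1 + primitive E (S x) 1
  let j : E × E → E × E × C(I, E) := fun x ↦ (x.1, x.2, 0)
  have hj : Continuous j := by fun_prop
  have hjs : ContDiff ℝ ∞ j := by fun_prop
  let T : Set (E × E) := j ⁻¹' Φ.target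
  have hT : IsOpen T := Φ.open_target.preimage hj
  have hT0 : (y₀, (0 : E)) ∈ T := by
    change (y₀, (0 : E), (0 : C(I, E))) ∈ Φ.target
    rw [← h00, ← hΦ]
    exact Φ.map_source hmem
  have hSsm : ContDiffOn ℝ ∞ S T :=
    (contDiff_snd.comp contDiff_snd).comp_contDiffOn (hsymm.comp hjs.contDiffOn fun x hx ↦ hx)
  have hev : ContDiff ℝ ∞ (fun ξ : C(I, E) ↦ ξ 1) :=
    (ContinuousMap.evalCLM (M := E) ℝ (1 : I)).contDiff
  have hesm : ContDiffOn ℝ ∞ e T :=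
    contDiffOn_fst.add (hev.comp_contDiffOn ((primitive E).contDiff.comp_contDiffOn hSsm))
  have hS : ∀ x ∈ T, (x.1, x.2, S x) ∈ Φ.source ∧ IsVelocity hB x.1 x.2 (S x) := by
    intro x hx
    have h1 := Φ.map_target hx
    have h2 := Φ.right_inv hx
    rw [hΦ] at h2
    have h3 : Φ.symm (j x) = (x.1, x.2, S x) := by
      have h4 := congrArg Prod.fst h2
      have h5 := congrArg (fun z : E × E × C(I, E) ↦ z.2.1) h2
      exact Prod.ext h4 (Prod.ext h5 rfl)
    rw [h3] at h1 h2
    exact ⟨h1, h2⟩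
  have hS0 : S (y₀, 0) = 0 := by
    change (Φ.symm (y₀, (0 : E), (0 : C(I, E)))).2.2 = 0
    rw [← h00, ← hΦ, Φ.left_inv hmem]
  -- Solutions are unique only inside the source of Φ. The radius ρ ensures that rescaled
  -- velocities, whose norm does not increase, remain there.
  obtain ⟨ρ, hρ, hρΦ⟩ := Metric.isOpen_iff.1 Φ.open_source _ hmem
  have hSc : ContinuousAt S (y₀, 0) := (hSsm.continuousOn).continuousAt (hT.mem_nhds hT0)
  have hec : ContinuousAt e (y₀, 0) := (hesm.continuousOn).continuousAt (hT.mem_nhds hT0)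
  have he0 : e (y₀, 0) = y₀ := by simp [e, hS0]
  have hnhds : ∀ᶠ x in 𝓝 (y₀, (0 : E)), x ∈ T ∧ ‖S x‖ < ρ ∧ e x ∈ V := by
    refine Filter.Eventually.and (hT.mem_nhds hT0) (Filter.Eventually.and ?_ ?_)
    · have := hSc.norm
      refine this.eventually_lt continuousAt_const ?_
      simpa [hS0] using hρ
    · exact hec (by rwa [he0])
  obtain ⟨δ₀, hδ₀, hδ⟩ := Metric.eventually_nhds_iff_ball.1 hnhds
  let δ := min δ₀ ρ
  have hδpos : 0 < δ := lt_min hδ₀ hρ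
  have hball : ∀ p ∈ ball y₀ δ, ∀ w ∈ ball (0 : E) δ,
      (p, w) ∈ T ∧ ‖S (p, w)‖ < ρ ∧ e (p, w) ∈ V := by
    intro p hp w hw
    refine hδ _ ?_
    rw [← ball_prod_same]
    exact ⟨ball_subset_ball (min_le_left _ _) hp, ball_subset_ball (min_le_left _ _) hw⟩
  have hprodT : ball y₀ δ ×ˢ ball (0 : E) δ ⊆ T := fun x hx ↦ (hball x.1 hx.1 x.2 hx.2).1
  -- scaling
  have hsc : ∀ p ∈ ball y₀ δ, ∀ w ∈ ball (0 : E) δ, ∀ s : I,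
      S (p, (s : ℝ) • w) = rescale s (S (p, w)) := by
    intro p hp w hw s
    have hsw : ‖(s : ℝ) • w‖ ≤ ‖w‖ := by
      rw [norm_smul, Real.norm_of_nonneg s.2.1]
      exact mul_le_of_le_one_left (norm_nonneg _) s.2.2
    have hw' : (s : ℝ) • w ∈ ball (0 : E) δ := by
      rw [mem_ball_zero_iff] at hw ⊢
      exact hsw.trans_lt hw
    have h1 := hS _ (hball p hp _ hw').1
    have h2 := (hS _ (hball p hp w hw).1).2.rescale s
    have hmem2 : (p, (s : ℝ) • w, rescale s (S (p, w))) ∈ Φ.source := by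
      refine hρΦ ?_
      rw [← ball_prod_same, ← ball_prod_same]
      refine ⟨ball_subset_ball (min_le_right _ _) hp, ball_subset_ball (min_le_right _ _) hw', ?_⟩
      rw [mem_ball_zero_iff]
      exact (norm_rescale_le _ _).trans_lt (hball p hp w hw).2.1
    -- Both triples lie in the source and `odeMap` sends both to (p, s w, 0).
    have h3 : (p, (s : ℝ) • w, S (p, (s : ℝ) • w)) = (p, (s : ℝ) • w, rescale s (S (p, w))) := by
      refine Φ.injOn h1.1 hmem2 ?_
      rw [hΦ, hΦ]
      exact h1.2.trans h2.symm
    simpa using h3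
  -- The scaling relation says that e(p, s w) is the position at time s of the solution with initial
  -- velocity w.
  have hray : ∀ p ∈ ball y₀ δ, ∀ w ∈ ball (0 : E) δ, ∀ s ∈ Icc (0 : ℝ) 1,
      e (p, s • w) = p + ∫ τ in (0 : ℝ)..s, extendCurve (S (p, w)) τ := by
    intro p hp w hw s hs
    have := hsc p hp w hw ⟨s, hs⟩
    change p + primitive E (S (p, s • w)) 1 = _
    rw [this, primitive_rescale, mul_one, primitive_apply]
  have hdiff : ∀ p ∈ ball y₀ δ, ContDiffOn ℝ ∞ (fun w ↦ e (p, w)) (ball 0 δ) := fun p hp ↦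
    hesm.comp (contDiff_prodMk_right p).contDiffOn fun w hw ↦ hprodT ⟨hp, hw⟩
  have hmemball : ∀ w ∈ ball (0 : E) δ, ∀ s ∈ Icc (0 : ℝ) 1, s • w ∈ ball (0 : E) δ := by
    intro w hw s hs
    rw [mem_ball_zero_iff] at hw ⊢
    rw [norm_smul, Real.norm_of_nonneg hs.1]
    exact (mul_le_of_le_one_left (norm_nonneg _) hs.2).trans_lt hw
  have hline : ∀ (w : E) (s : ℝ), HasDerivAt (fun s : ℝ ↦ s • w) w s := fun w s ↦ by
    simpa using (hasDerivAt_id s).smul_const w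
  -- The ray formula is known only for s in [0, 1], so derivatives are compared within this
  -- interval; both endpoints are needed below.
  have hd1 : ∀ p ∈ ball y₀ δ, ∀ w ∈ ball (0 : E) δ, ∀ s ∈ Icc (0 : ℝ) 1,
      fderiv ℝ (fun w ↦ e (p, w)) (s • w) w = extendCurve (S (p, w)) s := by
    intro p hp w hw s hs
    have h1 : HasFDerivAt (fun w ↦ e (p, w)) (fderiv ℝ (fun w ↦ e (p, w)) (s • w)) (s • w) :=
      (((hdiff p hp).contDiffAt (isOpen_ball.mem_nhds (hmemball w hw s hs))).differentiableAt
        (by simp)).hasFDerivAt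
    have h2 := h1.comp_hasDerivAt s (hline w s)
    have h3 : HasDerivWithinAt (fun s : ℝ ↦ e (p, s • w)) (extendCurve (S (p, w)) s)
        (Icc 0 1) s :=
      ((hasDerivAt_primitive (S (p, w)) s).const_add p).hasDerivWithinAt.congr
        (fun t ht ↦ hray p hp w hw t ht) (hray p hp w hw s hs)
    exact (uniqueDiffOn_Icc zero_lt_one s hs).eq_deriv _ h2.hasDerivWithinAt h3
  refine ⟨δ, hδpos, e, hesm.mono hprodT, fun p hp ↦ ⟨?_, ?_, fun w hw ↦ ⟨(hball p hp w hw).2.2, ?_⟩⟩⟩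
  · have := hray p hp 0 (mem_ball_self hδpos) 0 (by simp)
    simpa using this
  · -- linear maps which agree on a ball
    have hb : ∀ w ∈ ball (0 : E) δ, fderiv ℝ (fun w ↦ e (p, w)) 0 w = w := by
      intro w hw
      have h1 := hd1 p hp w hw 0 (by simp)
      rw [(hS _ (hball p hp w hw).1).2.extendCurve_eq (by simp)] at h1
      simpa using h1
    ext w
    obtain ⟨c, hc0, hc⟩ : ∃ c : ℝ, 0 < c ∧ c • w ∈ ball (0 : E) δ := by
      refine ⟨δ / (2 * (‖w‖ + 1)), by positivity, ?_⟩
      rw [mem_ball_zero_iff, norm_smul, Real.norm_of_nonneg (by positivity)]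
      rw [div_mul_eq_mul_div, div_lt_iff₀ (by positivity)]
      nlinarith [norm_nonneg w]
    have := hb _ hc
    rw [map_smul] at this
    simpa using smul_right_injective E hc0.ne' this
  -- Each w in the ball is the endpoint s = 1 of its own ray, so the equation at s = 1 is enough.
  · have h11 : (1 : ℝ) ∈ Icc (0 : ℝ) 1 := by simp
    have h1 : HasFDerivAt (fderiv ℝ (fun w ↦ e (p, w)))
        (fderiv ℝ (fderiv ℝ (fun w ↦ e (p, w))) ((1 : ℝ) • w)) ((1 : ℝ) • w) := by
      have h2 := (hdiff p hp).contDiffAt (isOpen_ball.mem_nhds (hmemball w hw 1 h11))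
      have h3 : ContDiffAt ℝ ∞ (fderiv ℝ (fun w ↦ e (p, w))) ((1 : ℝ) • w) :=
        h2.fderiv_right (by simp)
      exact (h3.differentiableAt (by simp)).hasFDerivAt
    have h2 : HasDerivAt (fun s : ℝ ↦ fderiv ℝ (fun w ↦ e (p, w)) (s • w) w)
        (fderiv ℝ (fderiv ℝ (fun w ↦ e (p, w))) ((1 : ℝ) • w) w w) 1 := by
      have h2' := (ContinuousLinearMap.apply ℝ E w).hasFDerivAt.comp_hasDerivAt (1 : ℝ)
        (h1.comp_hasDerivAt (1 : ℝ) (hline w 1))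
      exact h2'
    have h3 : HasDerivWithinAt (fun s : ℝ ↦ fderiv ℝ (fun w ↦ e (p, w)) (s • w) w)
        (extendCurve (sprayCurve hB (phaseCurve E (p, w, S (p, w)))) 1) (Icc 0 1) 1 := by
      refine ((hasDerivAt_primitive _ 1).const_add w).hasDerivWithinAt.congr
        (fun t ht ↦ ?_) ?_
      · rw [hd1 p hp w hw t ht]
        exact (hS _ (hball p hp w hw).1).2.extendCurve_eq ht
      · rw [hd1 p hp w hw 1 h11]
        exact (hS _ (hball p hp w hw).1).2.extendCurve_eq h11
    have h4 := (uniqueDiffOn_Icc zero_lt_one 1 h11).eq_deriv _ h2.hasDerivWithinAt h3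
    have h5 := hd1 p hp w hw 1 h11
    rw [one_smul] at h5
    simp only [one_smul] at h4
    rw [h4, h5, extendCurve_of_mem _ h11, extendCurve_of_mem _ h11, sprayCurve_apply,
      phaseCurve_apply]
    rfl

end Solution

end

/-! ### The model space ℝⁿ and its spaces of multilinear maps. -/

section

open Set Filter Topology Metric

/-- The model space `ℝⁿ`. -/
abbrev Euc (n : ℕ) : Type := EuclideanSpace ℝ (Fin n)

/-- Continuous bilinear forms on `ℝⁿ`. -/
abbrev Bilin (n : ℕ) : Type := Euc n →L[ℝ] Euc n →L[ℝ] ℝ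

section Instances

variable (n : ℕ)

instance : AddCommGroup (Euc n →L[ℝ] ℝ) := ContinuousLinearMap.addCommGroup
instance : NormedAddCommGroup (Euc n →L[ℝ] ℝ) := ContinuousLinearMap.toNormedAddCommGroup
instance : NormedSpace ℝ (Euc n →L[ℝ] ℝ) := ContinuousLinearMap.toNormedSpace
instance : AddCommGroup (Euc n →L[ℝ] Euc n →L[ℝ] ℝ) := ContinuousLinearMap.addCommGroup
instance : NormedAddCommGroup (Euc n →L[ℝ] Euc n →L[ℝ] ℝ) := ContinuousLinearMap.toNormedAddCommGroup
instance : NormedSpace ℝ (Euc n →L[ℝ] Euc n →L[ℝ] ℝ) := ContinuousLinearMap.toNormedSpace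
instance : AddCommGroup (Euc n →L[ℝ] Euc n) := ContinuousLinearMap.addCommGroup
instance : NormedAddCommGroup (Euc n →L[ℝ] Euc n) := ContinuousLinearMap.toNormedAddCommGroup
instance : NormedSpace ℝ (Euc n →L[ℝ] Euc n) := ContinuousLinearMap.toNormedSpace
instance : AddCommGroup (Euc n →L[ℝ] Euc n →L[ℝ] Euc n) := ContinuousLinearMap.addCommGroup
instance : NormedAddCommGroup (Euc n →L[ℝ] Euc n →L[ℝ] Euc n) := ContinuousLinearMap.toNormedAddCommGroup
instance : NormedSpace ℝ (Euc n →L[ℝ] Euc n →L[ℝ] Euc n) := ContinuousLinearMap.toNormedSpace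
instance : AddCommGroup (Euc n →L[ℝ] Euc n →L[ℝ] Euc n →L[ℝ] ℝ) := ContinuousLinearMap.addCommGroup
instance : NormedAddCommGroup (Euc n →L[ℝ] Euc n →L[ℝ] Euc n →L[ℝ] ℝ) := ContinuousLinearMap.toNormedAddCommGroup
instance : NormedSpace ℝ (Euc n →L[ℝ] Euc n →L[ℝ] Euc n →L[ℝ] ℝ) := ContinuousLinearMap.toNormedSpace

end Instances

section Basis

variable {n : ℕ}

/-- The standard basis vectors of `ℝⁿ`. -/
def bv (i : Fin n) : Euc n := EuclideanSpace.single i 1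

lemma bv_apply (i j : Fin n) : bv i j = if j = i then 1 else 0 := by
  simp [bv, PiLp.single_apply]

lemma sum_smul_bv (u : Euc n) : ∑ i, u i • bv i = u := by
  ext j
  simp [bv_apply]

lemma euc_induction {P : Euc n → Prop} (h0 : P 0) (hb : ∀ i, P (bv i))
    (ha : ∀ u v, P u → P v → P (u + v)) (hs : ∀ (c : ℝ) u, P u → P (c • u)) (u : Euc n) : P u := by
  rw [← sum_smul_bv u]
  exact Finset.sum_induction _ P ha h0 fun i _ ↦ hs _ _ (hb i)

lemma clm_apply_eq_sum {F : Type*} [NormedAddCommGroup F] [NormedSpace ℝ F] (A : Euc n →L[ℝ] F)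
    (u : Euc n) : A u = ∑ i, u i • A (bv i) := by
  conv_lhs => rw [← sum_smul_bv u]
  simp

end Basis

/-! ### Smooth dependence of inverse matrices. -/

section MatrixInverse

lemma contDiffAt_det {X : Type*} [NormedAddCommGroup X] [NormedSpace ℝ X] {m : ℕ} {k : WithTop ℕ∞}
    {G : X → Matrix (Fin m) (Fin m) ℝ} {a : X} (hG : ∀ i j, ContDiffAt ℝ k (fun y ↦ G y i j) a) :
    ContDiffAt ℝ k (fun y ↦ (G y).det) a := by
  simp only [Matrix.det_apply]
  refine ContDiffAt.sum fun σ _ ↦ ContDiffAt.const_smul _ ?_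
  exact contDiffAt_prod fun i _ ↦ hG _ _

/-- The entries of the inverse of a smooth family of invertible matrices are smooth. -/
lemma contDiffAt_matrix_inv {X : Type*} [NormedAddCommGroup X] [NormedSpace ℝ X] {m : ℕ}
    {k : WithTop ℕ∞} {G : X → Matrix (Fin m) (Fin m) ℝ} {a : X}
    (hG : ∀ i j, ContDiffAt ℝ k (fun y ↦ G y i j) a) (ha : IsUnit (G a).det) (i j : Fin m) :
    ContDiffAt ℝ k (fun y ↦ (G y)⁻¹ i j) a := by
  simp only [Matrix.inv_def, Matrix.smul_apply, Ring.inverse_eq_inv', smul_eq_mul,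
    Matrix.adjugate_apply]
  refine ((contDiffAt_det hG).inv ha.ne_zero).mul (contDiffAt_det fun r s ↦ ?_)
  by_cases h : r = j
  · subst h
    simpa using contDiffAt_const
  · simpa [Matrix.updateRow_apply, h] using hG r s

end MatrixInverse

/-! ### Metrics near a point of ℝⁿ, Christoffel symbols and the Koszul formula. -/

section LocalMetric

variable {n : ℕ}

/-- `g` is a smooth Riemannian metric in a neighborhood of `a`. -/
structure MetricAt (g : Euc n → Bilin n) (a : Euc n) : Prop where
  smooth : ∀ᶠ y in 𝓝 a, ContDiffAt ℝ ∞ g y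
  symm : ∀ᶠ y in 𝓝 a, ∀ u v, g y u v = g y v u
  pos : ∀ᶠ y in 𝓝 a, ∀ u, u ≠ 0 → 0 < g y u u

/-- All conditions are imposed on a neighborhood, so they pass to nearby points; this is what allows
identities derived at one point to be differentiated. -/
lemma MetricAt.eventually {g : Euc n → Bilin n} {a : Euc n} (h : MetricAt g a) :
    ∀ᶠ y in 𝓝 a, MetricAt g y := by
  filter_upwards [h.smooth.eventually_nhds, h.symm.eventually_nhds, h.pos.eventually_nhds]
    with y h1 h2 h3
  exact ⟨h1, h2, h3⟩

/-- The Gram matrix of a field of bilinear forms. -/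
def gram (g : Euc n → Bilin n) (y : Euc n) : Matrix (Fin n) (Fin n) ℝ :=
  Matrix.of fun i j ↦ g y (bv i) (bv j)

lemma gram_apply (g : Euc n → Bilin n) (y : Euc n) (i j : Fin n) :
    gram g y i j = g y (bv i) (bv j) := rfl

/-- The Christoffel symbols of a matrix-valued function. -/
def chr (G : Euc n → Matrix (Fin n) (Fin n) ℝ) (k i j : Fin n) (y : Euc n) : ℝ :=
  (1 / 2) * ∑ l, (G y)⁻¹ k l *
    (partialDeriv i (fun z ↦ G z j l) y + partialDeriv j (fun z ↦ G z i l) y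
      - partialDeriv l (fun z ↦ G z i j) y)

/-- The Christoffel symbols as a field of bilinear maps. -/
def chrMap (g : Euc n → Bilin n) (y : Euc n) : Euc n →L[ℝ] Euc n →L[ℝ] Euc n :=
  ∑ i, ∑ j, ∑ k, chr (gram g) k i j y •
    (EuclideanSpace.proj i : Euc n →L[ℝ] ℝ).smulRight
      ((EuclideanSpace.proj j : Euc n →L[ℝ] ℝ).smulRight (bv k))

lemma chrMap_apply (g : Euc n → Bilin n) (y u v : Euc n) :
    chrMap g y u v = ∑ i, ∑ j, ∑ k, (chr (gram g) k i j y * (u i * v j)) • bv k := by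
  simp [chrMap, smul_smul, mul_assoc]

lemma chrMap_bv (g : Euc n → Bilin n) (y : Euc n) (i j : Fin n) :
    chrMap g y (bv i) (bv j) = ∑ k, chr (gram g) k i j y • bv k := by
  rw [chrMap_apply, Finset.sum_eq_single i, Finset.sum_eq_single j]
  · simp [bv_apply]
  · intro j' _ h
    simp [bv_apply, h]
  · simp
  · intro i' _ h
    simp [bv_apply, h]
  · simp

lemma chrMap_bv_apply (g : Euc n → Bilin n) (y : Euc n) (i j k : Fin n) :
    chrMap g y (bv i) (bv j) k = chr (gram g) k i j y := by
  rw [chrMap_bv]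
  simp [bv_apply]

lemma partialDeriv_gram {g : Euc n → Bilin n} {y : Euc n} (hg : DifferentiableAt ℝ g y)
    (i j l : Fin n) :
    partialDeriv i (fun z ↦ gram g z j l) y = fderiv ℝ g y (bv i) (bv j) (bv l) := by
  have h1 := (ContinuousLinearMap.apply ℝ ℝ (bv l)).hasFDerivAt.comp y
    ((ContinuousLinearMap.apply ℝ (Euc n →L[ℝ] ℝ) (bv j)).hasFDerivAt.comp y hg.hasFDerivAt)
  have h2 : HasFDerivAt (fun z ↦ gram g z j l) _ y := h1
  rw [partialDeriv, h2.fderiv]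
  rfl

namespace MetricAt

variable {g : Euc n → Bilin n} {a : Euc n} (h : MetricAt g a)

include h

lemma contDiffAt : ContDiffAt ℝ ∞ g a := h.smooth.self_of_nhds

lemma differentiableAt : DifferentiableAt ℝ g a := h.contDiffAt.differentiableAt (by simp)

lemma symm_apply (u v : Euc n) : g a u v = g a v u := h.symm.self_of_nhds u v

lemma eq_zero_of_forall {x : Euc n} (hx : ∀ w, g a x w = 0) : x = 0 := by
  by_contra h0
  exact (h.pos.self_of_nhds x h0).ne' (hx x)

lemma fderiv_symm (z u v : Euc n) : fderiv ℝ g a z u v = fderiv ℝ g a z v u := by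
  have h1 : ∀ u v, HasFDerivAt (fun y ↦ g y u v)
      ((ContinuousLinearMap.apply ℝ ℝ v).comp
        ((ContinuousLinearMap.apply ℝ (Euc n →L[ℝ] ℝ) u).comp (fderiv ℝ g a))) a := fun u v ↦
    (ContinuousLinearMap.apply ℝ ℝ v).hasFDerivAt.comp a
    ((ContinuousLinearMap.apply ℝ (Euc n →L[ℝ] ℝ) u).hasFDerivAt.comp a
      h.differentiableAt.hasFDerivAt)
  have h2 := (h1 u v).congr_of_eventuallyEq (f₁ := fun y ↦ g y v u)
    (h.symm.mono fun y hy ↦ hy v u)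
  exact congrArg (fun A : Euc n →L[ℝ] ℝ ↦ A z) (h2.unique (h1 v u))

/-- A vector in the kernel is orthogonal to everything, which positivity excludes. -/
lemma isUnit_gram : IsUnit (gram g a) := by
  rw [← Matrix.mulVec_injective_iff_isUnit]
  refine (injective_iff_map_eq_zero (Matrix.mulVecLin (gram g a))).2 fun x hx ↦ ?_
  let u : Euc n := WithLp.toLp 2 x
  have hu : u = 0 := by
    refine h.eq_zero_of_forall fun w ↦ ?_
    rw [h.symm_apply, clm_apply_eq_sum (g a), sum_apply]
    refine Finset.sum_eq_zero fun i _ ↦ ?_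
    rw [smul_apply, clm_apply_eq_sum (g a (bv i))]
    have := congrFun hx i
    simp only [Matrix.mulVecLin_apply, Matrix.mulVec, dotProduct, gram_apply, Pi.zero_apply]
      at this
    have h3 : ∑ j, u j • (g a (bv i)) (bv j) = 0 := by
      rw [← this]
      exact Finset.sum_congr rfl fun j _ ↦ by simp [u, mul_comm]
    rw [h3, smul_zero]
  ext i
  have := congrArg (fun z : Euc n ↦ z i) hu
  simpa [u] using this

lemma isUnit_det_gram : IsUnit (gram g a).det := (Matrix.isUnit_iff_isUnit_det _).1 h.isUnit_gram

lemma contDiffAt_gram (i j : Fin n) : ContDiffAt ℝ ∞ (fun y ↦ gram g y i j) a :=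
  (h.contDiffAt.clm_apply contDiffAt_const).clm_apply contDiffAt_const

lemma contDiffAt_gram_inv (i j : Fin n) : ContDiffAt ℝ ∞ (fun y ↦ (gram g y)⁻¹ i j) a :=
  contDiffAt_matrix_inv h.contDiffAt_gram h.isUnit_det_gram i j

lemma contDiffAt_chr (k i j : Fin n) : ContDiffAt ℝ ∞ (chr (gram g) k i j) a := by
  have h1 : ∀ i j l, ContDiffAt ℝ ∞ (partialDeriv i (fun z ↦ gram g z j l)) a := fun i j l ↦
    ((h.contDiffAt_gram j l).fderiv_right (by simp)).clm_apply contDiffAt_const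
  exact contDiffAt_const.mul (ContDiffAt.sum fun l _ ↦ (h.contDiffAt_gram_inv k l).mul
    (((h1 i j l).add (h1 j i l)).sub (h1 l i j)))

lemma contDiffAt_chrMap : ContDiffAt ℝ ∞ (chrMap g) a := by
  unfold chrMap
  exact ContDiffAt.sum fun i _ ↦ ContDiffAt.sum fun j _ ↦ ContDiffAt.sum fun k _ ↦
    (h.contDiffAt_chr k i j).smul contDiffAt_const

/-- The Koszul formula. -/
theorem koszul (u v w : Euc n) :
    2 * g a (chrMap g a u v) w =
      fderiv ℝ g a u v w + fderiv ℝ g a v u w - fderiv ℝ g a w u v := by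
  induction u using euc_induction with
  | h0 => simp
  | ha u u' h1 h2 => simp only [map_add, add_apply]; linarith
  | hs c u h1 => simp only [map_smul, smul_apply, smul_eq_mul]; linear_combination c * h1
  | hb i =>
  induction v using euc_induction with
  | h0 => simp
  | ha u u' h1 h2 => simp only [map_add, add_apply]; linarith
  | hs c u h1 => simp only [map_smul, smul_apply, smul_eq_mul]; linear_combination c * h1
  | hb j =>
  induction w using euc_induction with
  | h0 => simp
  | ha u u' h1 h2 => simp only [map_add, add_apply]; linarith
  | hs c u h1 => simp only [map_smul, smul_apply, smul_eq_mul]; linear_combination c * h1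
  | hb l =>
  rw [chrMap_bv, map_sum, sum_apply]
  simp only [map_smul, smul_apply, smul_eq_mul, chr,
    partialDeriv_gram h.differentiableAt]
  set T : Fin n → ℝ := fun m ↦ fderiv ℝ g a (bv i) (bv j) (bv m)
    + fderiv ℝ g a (bv j) (bv i) (bv m) - fderiv ℝ g a (bv m) (bv i) (bv j) with hT
  have h1 : ∀ k, g a (bv k) (bv l) = gram g a l k := fun k ↦ h.symm_apply _ _
  -- The inverse Gram matrix in the Christoffel symbols is undone by lowering the index with the
  -- Gram matrix.
  have h2 : (gram g a).mulVec ((gram g a)⁻¹.mulVec T) l = T l := by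
    rw [Matrix.mulVec_mulVec, Matrix.mul_nonsing_inv _ h.isUnit_det_gram, Matrix.one_mulVec]
  change _ = T l
  rw [← h2, Matrix.mulVec, dotProduct, Finset.mul_sum]
  refine Finset.sum_congr rfl fun k _ ↦ ?_
  rw [h1, Matrix.mulVec, dotProduct]
  ring

lemma chrMap_symm (u v : Euc n) : chrMap g a u v = chrMap g a v u := by
  rw [← sub_eq_zero]
  refine h.eq_zero_of_forall fun w ↦ ?_
  have h1 := h.koszul u v w
  have h2 := h.koszul v u w
  rw [h.fderiv_symm w v u] at h2
  rw [map_sub, sub_apply]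
  linarith

end MetricAt

end LocalMetric

end

section

open Set Filter Topology Metric

lemma two_le_infty : (2 : WithTop ℕ∞) ≤ ∞ := by
  have : ((2 : ℕ∞) : WithTop ℕ∞) ≤ ((⊤ : ℕ∞) : WithTop ℕ∞) := WithTop.coe_le_coe.2 le_top
  exact this

/-! ### Differentiation along lines. -/

section DirectionalDerivative

variable {E F G H : Type*} [NormedAddCommGroup E] [NormedSpace ℝ E]
  [NormedAddCommGroup F] [NormedSpace ℝ F] [NormedAddCommGroup G] [NormedSpace ℝ G]
  [NormedAddCommGroup H] [NormedSpace ℝ H]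

lemma hasDerivAt_line {f : E → F} {a : E} (hf : DifferentiableAt ℝ f a) (z : E) :
    HasDerivAt (fun t : ℝ ↦ f (a + t • z)) (fderiv ℝ f a z) 0 := by
  have h1 : HasDerivAt (fun t : ℝ ↦ a + t • z) z 0 := by
    simpa using ((hasDerivAt_id (0 : ℝ)).smul_const z).const_add a
  have h2 : HasFDerivAt f (fderiv ℝ f a) (a + (0 : ℝ) • z) := by simpa using hf.hasFDerivAt
  exact h2.comp_hasDerivAt 0 h1

lemma tendsto_line (a z : E) : Tendsto (fun t : ℝ ↦ a + t • z) (𝓝 0) (𝓝 a) := by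
  have : Continuous fun t : ℝ ↦ a + t • z := by fun_prop
  simpa using this.tendsto 0

lemma hasDerivAt_bilin {b : ℝ → E →L[ℝ] F →L[ℝ] G} {b' : E →L[ℝ] F →L[ℝ] G} {u : ℝ → E} {u' : E}
    {v : ℝ → F} {v' : F} {t : ℝ} (hb : HasDerivAt b b' t) (hu : HasDerivAt u u' t)
    (hv : HasDerivAt v v' t) :
    HasDerivAt (fun s ↦ b s (u s) (v s)) (b' (u t) (v t) + b t u' (v t) + b t (u t) v') t := by
  have := (hb.clm_apply hu).clm_apply hv
  simpa using this

end DirectionalDerivative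

/-! ### Isometries: invariance of Hessian, Laplacian, geodesics and curvature. -/

section Isometry

variable {n : ℕ}

/-- `g₁` is, near `a`, the pullback of `g₂` by the smooth map `Ψ`. -/
structure IsometryAt (g₁ g₂ : Euc n → Bilin n) (Ψ : Euc n → Euc n) (a : Euc n) : Prop where
  left : MetricAt g₁ a
  right : MetricAt g₂ (Ψ a)
  smooth : ∀ᶠ y in 𝓝 a, ContDiffAt ℝ ∞ Ψ y
  pullback : ∀ᶠ y in 𝓝 a, ∀ u v, g₁ y u v = g₂ (Ψ y) (fderiv ℝ Ψ y u) (fderiv ℝ Ψ y v)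

namespace IsometryAt

variable {g₁ g₂ : Euc n → Bilin n} {Ψ : Euc n → Euc n} {a : Euc n} (h : IsometryAt g₁ g₂ Ψ a)

include h

lemma contDiffAt : ContDiffAt ℝ ∞ Ψ a := h.smooth.self_of_nhds

lemma eventually : ∀ᶠ y in 𝓝 a, IsometryAt g₁ g₂ Ψ y := by
  filter_upwards [h.left.eventually, h.contDiffAt.continuousAt.eventually h.right.eventually,
    h.smooth.eventually_nhds, h.pullback.eventually_nhds] with y h1 h2 h3 h4
  exact ⟨h1, h2, h3, h4⟩

lemma differentiableAt : DifferentiableAt ℝ Ψ a := h.contDiffAt.differentiableAt (by simp)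

lemma contDiffAt_fderiv : ContDiffAt ℝ ∞ (fderiv ℝ Ψ) a := h.contDiffAt.fderiv_right (by simp)

lemma differentiableAt_fderiv : DifferentiableAt ℝ (fderiv ℝ Ψ) a :=
  h.contDiffAt_fderiv.differentiableAt (by simp)

lemma snd_symm (u v : Euc n) :
    fderiv ℝ (fderiv ℝ Ψ) a u v = fderiv ℝ (fderiv ℝ Ψ) a v u :=
  (h.contDiffAt.isSymmSndFDerivAt (by simpa using two_le_infty)).eq u v

/-- A vector killed by DΨ would be orthogonal to everything for the pullback g₁, which is positive
definite. -/
lemma fderiv_injective : Function.Injective (fderiv ℝ Ψ a) := by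
  refine (injective_iff_map_eq_zero _).2 fun u hu ↦ h.left.eq_zero_of_forall fun w ↦ ?_
  rw [h.pullback.self_of_nhds, hu, map_zero, zero_apply]

/-- The derivative of an isometry, as a linear equivalence. -/
lemma exists_equiv : ∃ A : Euc n ≃ₗ[ℝ] Euc n, ∀ u, A u = fderiv ℝ Ψ a u :=
  ⟨LinearEquiv.ofInjectiveEndo (fderiv ℝ Ψ a).toLinearMap h.fderiv_injective, fun _ ↦ rfl⟩

lemma fderiv_surjective : Function.Surjective (fderiv ℝ Ψ a) := by
  obtain ⟨A, hA⟩ := h.exists_equiv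
  exact fun y ↦ ⟨A.symm y, by rw [← hA]; simp⟩

/-- `y ↦ DΨ y u` along a line. -/
lemma hasDerivAt_fderiv (z u : Euc n) :
    HasDerivAt (fun t : ℝ ↦ fderiv ℝ Ψ (a + t • z) u) (fderiv ℝ (fderiv ℝ Ψ) a z u) 0 := by
  have := (hasDerivAt_line h.differentiableAt_fderiv z).clm_apply (hasDerivAt_const (0 : ℝ) u)
  simpa using this

lemma hasDerivAt_comp {F : Type*} [NormedAddCommGroup F] [NormedSpace ℝ F] {f : Euc n → F}
    (hf : DifferentiableAt ℝ f (Ψ a)) (z : Euc n) :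
    HasDerivAt (fun t : ℝ ↦ f (Ψ (a + t • z))) (fderiv ℝ f (Ψ a) (fderiv ℝ Ψ a z)) 0 := by
  have h1 := hasDerivAt_line h.differentiableAt z
  have h2 : HasFDerivAt f (fderiv ℝ f (Ψ a)) (Ψ (a + (0 : ℝ) • z)) := by simpa using hf.hasFDerivAt
  exact h2.comp_hasDerivAt 0 h1

/-- The product rule applied to the pullback identity along a line in direction z. -/
lemma fderiv_metric (z u v : Euc n) :
    fderiv ℝ g₁ a z u v =
      fderiv ℝ g₂ (Ψ a) (fderiv ℝ Ψ a z) (fderiv ℝ Ψ a u) (fderiv ℝ Ψ a v)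
        + g₂ (Ψ a) (fderiv ℝ (fderiv ℝ Ψ) a z u) (fderiv ℝ Ψ a v)
        + g₂ (Ψ a) (fderiv ℝ Ψ a u) (fderiv ℝ (fderiv ℝ Ψ) a z v) := by
  have h1 := hasDerivAt_bilin (h.hasDerivAt_comp h.right.differentiableAt z)
    (h.hasDerivAt_fderiv z u) (h.hasDerivAt_fderiv z v)
  have h2 := hasDerivAt_bilin (hasDerivAt_line h.left.differentiableAt z)
    (hasDerivAt_const (0 : ℝ) u) (hasDerivAt_const (0 : ℝ) v)
  have h3 := h2.congr_of_eventuallyEq (((tendsto_line a z).eventually h.pullback).mono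
    fun t ht ↦ (ht u v).symm)
  simpa using h3.unique h1

/-- The transformation law of the Christoffel symbols. -/
theorem chrMap_law (u v : Euc n) :
    fderiv ℝ Ψ a (chrMap g₁ a u v) =
      chrMap g₂ (Ψ a) (fderiv ℝ Ψ a u) (fderiv ℝ Ψ a v) + fderiv ℝ (fderiv ℝ Ψ) a u v := by
  rw [← sub_eq_zero]
  refine h.right.eq_zero_of_forall fun w' ↦ ?_
  -- Testing against vectors DΨ w suffices, and for these the Koszul formulas of g₁ and g₂ can be
  -- compared.
  obtain ⟨w, rfl⟩ := h.fderiv_surjective w'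
  have h1 := h.left.koszul u v w
  have h2 := h.right.koszul (fderiv ℝ Ψ a u) (fderiv ℝ Ψ a v) (fderiv ℝ Ψ a w)
  rw [h.pullback.self_of_nhds, h.fderiv_metric, h.fderiv_metric, h.fderiv_metric] at h1
  simp only [map_sub, map_add, sub_apply, add_apply]
  -- By symmetry of D²Ψ, all its contributions cancel except 2 g₂(D²Ψ(u, v), DΨ w).
  have s1 := h.snd_symm u w
  have s2 := h.snd_symm v w
  have s3 := h.snd_symm v u
  have s4 := h.right.symm_apply (fderiv ℝ Ψ a v) (fderiv ℝ (fderiv ℝ Ψ) a w u)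
  rw [s1, s2, s3, s4] at h1
  linarith

/-- The Hessian of `f` at `a` with respect to `g`. -/
def _root_.KeyEstimate.hess (g : Euc n → Bilin n) (f : Euc n → ℝ) (a v w : Euc n) : ℝ :=
  fderiv ℝ (fderiv ℝ f) a v w - fderiv ℝ f a (chrMap g a v w)

/-- The chain rule produces the extra term Df(D²Ψ(v, w)), which is exactly the correction in the
transformation law of the Christoffel symbols. -/
theorem hess_law {f : Euc n → ℝ} (hf : ContDiffAt ℝ 2 f (Ψ a)) (v w : Euc n) :
    hess g₁ (f ∘ Ψ) a v w = hess g₂ f (Ψ a) (fderiv ℝ Ψ a v) (fderiv ℝ Ψ a w) := by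
  have hfe : ∀ᶠ y in 𝓝 (Ψ a), ContDiffAt ℝ 2 f y := hf.eventually (by simp)
  have hd : ∀ᶠ y in 𝓝 a, fderiv ℝ (f ∘ Ψ) y = (fderiv ℝ f (Ψ y)).comp (fderiv ℝ Ψ y) := by
    filter_upwards [h.contDiffAt.continuousAt.eventually hfe, h.smooth] with y h1 h2
    exact fderiv_comp y (h1.differentiableAt (by simp)) (h2.differentiableAt (by simp))
  have hcomp : ContDiffAt ℝ 2 (f ∘ Ψ) a := hf.comp a (h.contDiffAt.of_le two_le_infty)
  have hd1 : DifferentiableAt ℝ (fderiv ℝ (f ∘ Ψ)) a :=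
    (hcomp.fderiv_right (m := 1) (by norm_num)).differentiableAt (by simp)
  have hd2 : DifferentiableAt ℝ (fderiv ℝ f) (Ψ a) :=
    (hf.fderiv_right (m := 1) (by norm_num)).differentiableAt (by simp)
  have h1 := (hasDerivAt_line hd1 v).clm_apply (hasDerivAt_const (0 : ℝ) w)
  have h2 := (h.hasDerivAt_comp hd2 v).clm_apply (h.hasDerivAt_fderiv v w)
  have h3 := h1.congr_of_eventuallyEq (((tendsto_line a v).eventually hd).mono
    fun t ht ↦ (by simp only [ht]; rfl :
      fderiv ℝ f (Ψ (a + t • v)) (fderiv ℝ Ψ (a + t • v) w) = fderiv ℝ (f ∘ Ψ) (a + t • v) w))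
  have h4 := h3.unique h2
  simp only [zero_smul, add_zero, map_zero] at h4
  rw [hess, hess, h4, hd.self_of_nhds, ContinuousLinearMap.comp_apply, h.chrMap_law, map_add]
  ring

/-- The Laplacian of `f` at `a` with respect to `g`. -/
def _root_.KeyEstimate.lap (g : Euc n → Bilin n) (f : Euc n → ℝ) (a : Euc n) : ℝ :=
  ∑ i, ∑ j, (gram g a)⁻¹ i j * hess g f a (bv i) (bv j)

-- The sums are traces of G⁻¹ Bᵀ, and a simultaneous congruence of G and B by P conjugates this
-- product by P. Invertibility of P is inherited from G₁.
omit h in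
lemma _root_.KeyEstimate.sum_gram_inv_eq {G₁ G₂ B₁ B₂ P : Matrix (Fin n) (Fin n) ℝ}
    (hG : G₁ = P.transpose * G₂ * P) (hB : B₁ = P.transpose * B₂ * P) (hG₁ : IsUnit G₁.det) :
    ∑ i, ∑ j, G₁⁻¹ i j * B₁ i j = ∑ i, ∑ j, G₂⁻¹ i j * B₂ i j := by
  have hs : ∀ A B : Matrix (Fin n) (Fin n) ℝ,
      ∑ i, ∑ j, A i j * B i j = Matrix.trace (A * B.transpose) := by
    intro A B
    simp [Matrix.trace, Matrix.mul_apply]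
  have hP : IsUnit P.det := by
    rw [hG, Matrix.det_mul] at hG₁
    exact isUnit_of_mul_isUnit_right hG₁
  have hPt : IsUnit P.transpose.det := by rwa [Matrix.det_transpose]
  rw [hs, hs, hG, hB, Matrix.mul_inv_rev, Matrix.mul_inv_rev]
  simp only [Matrix.transpose_mul, Matrix.transpose_transpose]
  calc (P⁻¹ * (G₂⁻¹ * P.transpose⁻¹) * (P.transpose * (B₂.transpose * P))).trace
      = (P⁻¹ * (G₂⁻¹ * ((P.transpose⁻¹ * P.transpose) * (B₂.transpose * P)))).trace := by
        simp only [Matrix.mul_assoc]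
    _ = (P⁻¹ * (G₂⁻¹ * (B₂.transpose * P))).trace := by
        rw [Matrix.nonsing_inv_mul _ hPt, Matrix.one_mul]
    _ = (G₂⁻¹ * B₂.transpose * (P * P⁻¹)).trace := by
        rw [Matrix.trace_mul_comm]; simp only [Matrix.mul_assoc]
    _ = (G₂⁻¹ * B₂.transpose).trace := by rw [Matrix.mul_nonsing_inv _ hP, Matrix.mul_one]

omit h in
lemma _root_.KeyEstimate.bilin_matrix_pullback (b : Bilin n) (A : Euc n →L[ℝ] Euc n) :
    (Matrix.of fun i j ↦ b (A (bv i)) (A (bv j))) =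
      (Matrix.of fun i j ↦ A (bv j) i).transpose * (Matrix.of fun i j ↦ b (bv i) (bv j)) *
        (Matrix.of fun i j ↦ A (bv j) i : Matrix (Fin n) (Fin n) ℝ) := by
  ext i j
  simp only [Matrix.of_apply, Matrix.mul_apply, Matrix.transpose_apply]
  rw [clm_apply_eq_sum b, sum_apply]
  simp only [smul_apply]
  simp_rw [fun k ↦ clm_apply_eq_sum (b (bv k)) (A (bv j))]
  simp only [smul_eq_mul, Finset.mul_sum, Finset.sum_mul]
  rw [Finset.sum_comm]
  exact Finset.sum_congr rfl fun l _ ↦ Finset.sum_congr rfl fun k _ ↦ by ring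

/-- The Laplacian is invariant under isometries. -/
theorem lap_law {f : Euc n → ℝ} (hf : ContDiffAt ℝ 2 f (Ψ a)) :
    lap g₁ (f ∘ Ψ) a = lap g₂ f (Ψ a) := by
  -- The Hessian of f as a bilinear form, so that its matrix transforms by the same congruence as
  -- the Gram matrix.
  let b : Bilin n := fderiv ℝ (fderiv ℝ f) (Ψ a) - (ContinuousLinearMap.compL ℝ (Euc n) (Euc n) ℝ
    (fderiv ℝ f (Ψ a))).comp (chrMap g₂ (Ψ a))
  have hb : ∀ v w, b v w = hess g₂ f (Ψ a) v w := fun v w ↦ rfl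
  refine sum_gram_inv_eq (G₁ := gram g₁ a) (G₂ := gram g₂ (Ψ a))
    (B₁ := Matrix.of fun i j ↦ hess g₁ (f ∘ Ψ) a (bv i) (bv j))
    (B₂ := Matrix.of fun i j ↦ hess g₂ f (Ψ a) (bv i) (bv j))
    (P := Matrix.of fun i j ↦ fderiv ℝ Ψ a (bv j) i) ?_ ?_ h.left.isUnit_det_gram
  · have := bilin_matrix_pullback (g₂ (Ψ a)) (fderiv ℝ Ψ a)
    refine Eq.trans ?_ this
    ext i j
    simp only [gram_apply, Matrix.of_apply]
    exact h.pullback.self_of_nhds _ _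
  · have := bilin_matrix_pullback b (fderiv ℝ Ψ a)
    simp only [hb] at this
    refine Eq.trans ?_ this
    ext i j
    simp only [Matrix.of_apply]
    exact h.hess_law hf _ _

/-- The transformation of the geodesic equation. -/
theorem geodesic_law {c : ℝ → Euc n} {t : ℝ} (hc : ContDiffAt ℝ 2 c t) (hca : c t = a) :
    deriv (deriv (Ψ ∘ c)) t + chrMap g₂ (Ψ a) (deriv (Ψ ∘ c) t) (deriv (Ψ ∘ c) t) =
      fderiv ℝ Ψ a (deriv (deriv c) t + chrMap g₁ a (deriv c t) (deriv c t)) := by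
  subst hca
  have hce : ∀ᶠ s in 𝓝 t, ContDiffAt ℝ 2 c s := hc.eventually (by simp)
  have hd : ∀ᶠ s in 𝓝 t, deriv (Ψ ∘ c) s = fderiv ℝ Ψ (c s) (deriv c s) := by
    filter_upwards [hce, hc.continuousAt.eventually h.smooth] with s h1 h2
    exact fderiv_comp_deriv s (h2.differentiableAt (by simp)) (h1.differentiableAt (by simp))
  have hd2 : DifferentiableAt ℝ (deriv c) t := by
    have h1 : DifferentiableAt ℝ (fderiv ℝ c) t :=
      (hc.fderiv_right (m := 1) (by norm_num)).differentiableAt (by simp)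
    exact h1.clm_apply (differentiableAt_const (1 : ℝ))
  have h1 := h.differentiableAt_fderiv.hasFDerivAt.comp_hasDerivAt t
    (hc.differentiableAt (by simp)).hasDerivAt
  have h2 := (h1.clm_apply hd2.hasDerivAt).congr_of_eventuallyEq hd
  rw [h2.deriv, hd.self_of_nhds, map_add, h.chrMap_law]
  simp only [Function.comp_apply]
  abel

/-- Differentiating the transformation law of the Christoffel symbols. -/
lemma fderiv_chrMap_law (z u v : Euc n) :
    fderiv ℝ (fderiv ℝ Ψ) a z (chrMap g₁ a u v) + fderiv ℝ Ψ a (fderiv ℝ (chrMap g₁) a z u v) =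
      fderiv ℝ (chrMap g₂) (Ψ a) (fderiv ℝ Ψ a z) (fderiv ℝ Ψ a u) (fderiv ℝ Ψ a v)
      + chrMap g₂ (Ψ a) (fderiv ℝ (fderiv ℝ Ψ) a z u) (fderiv ℝ Ψ a v)
      + chrMap g₂ (Ψ a) (fderiv ℝ Ψ a u) (fderiv ℝ (fderiv ℝ Ψ) a z v)
      + fderiv ℝ (fderiv ℝ (fderiv ℝ Ψ)) a z u v := by
  have hΓ₁ : DifferentiableAt ℝ (chrMap g₁) a := h.left.contDiffAt_chrMap.differentiableAt (by simp)
  have hΓ₂ : DifferentiableAt ℝ (chrMap g₂) (Ψ a) :=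
    h.right.contDiffAt_chrMap.differentiableAt (by simp)
  have hD2 : DifferentiableAt ℝ (fderiv ℝ (fderiv ℝ Ψ)) a :=
    (h.contDiffAt_fderiv.fderiv_right (m := ∞) (by simp)).differentiableAt (by simp)
  have h1 := (hasDerivAt_line h.differentiableAt_fderiv z).clm_apply
    (hasDerivAt_bilin (hasDerivAt_line hΓ₁ z) (hasDerivAt_const (0 : ℝ) u)
      (hasDerivAt_const (0 : ℝ) v))
  have h2 := (hasDerivAt_bilin (h.hasDerivAt_comp hΓ₂ z) (h.hasDerivAt_fderiv z u)
    (h.hasDerivAt_fderiv z v)).add (hasDerivAt_bilin (hasDerivAt_line hD2 z)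
      (hasDerivAt_const (0 : ℝ) u) (hasDerivAt_const (0 : ℝ) v))
  have h3 := h2.congr_of_eventuallyEq (((tendsto_line a z).eventually h.eventually).mono
    fun t ht ↦ ht.chrMap_law u v)
  simpa using h1.unique h3

/-- The first two slots commute by symmetry of the second derivative of DΨ, the last two by
differentiating the symmetry of D²Ψ; three such swaps exchange the outer slots. -/
lemma thd_symm (z u v : Euc n) : fderiv ℝ (fderiv ℝ (fderiv ℝ Ψ)) a z u v =
    fderiv ℝ (fderiv ℝ (fderiv ℝ Ψ)) a v u z := by
  have hD2 : DifferentiableAt ℝ (fderiv ℝ (fderiv ℝ Ψ)) a :=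
    (h.contDiffAt_fderiv.fderiv_right (m := ∞) (by simp)).differentiableAt (by simp)
  have h23 : ∀ z u v, fderiv ℝ (fderiv ℝ (fderiv ℝ Ψ)) a z u v =
      fderiv ℝ (fderiv ℝ (fderiv ℝ Ψ)) a z v u := by
    intro z u v
    have h1 : ∀ u v, HasDerivAt (fun t : ℝ ↦ fderiv ℝ (fderiv ℝ Ψ) (a + t • z) u v)
        (fderiv ℝ (fderiv ℝ (fderiv ℝ Ψ)) a z u v) 0 := fun u v ↦ by
      simpa using hasDerivAt_bilin (hasDerivAt_line hD2 z)
        (hasDerivAt_const (0 : ℝ) u) (hasDerivAt_const (0 : ℝ) v)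
    exact (h1 u v).unique ((h1 v u).congr_of_eventuallyEq
      (((tendsto_line a z).eventually h.eventually).mono fun t ht ↦ ht.snd_symm u v))
  have h12 : ∀ z u v, fderiv ℝ (fderiv ℝ (fderiv ℝ Ψ)) a z u v =
      fderiv ℝ (fderiv ℝ (fderiv ℝ Ψ)) a u z v := fun z u v ↦
    congrArg (fun A : Euc n →L[ℝ] Euc n ↦ A v)
      ((h.contDiffAt_fderiv.isSymmSndFDerivAt (by simpa using two_le_infty)).eq z u)
  rw [h12 z u v, h23 u z v, h12 u v z]

/-- The curvature `R(z, w) v` of the metric `g` at `a`. -/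
def _root_.KeyEstimate.curv (g : Euc n → Bilin n) (a v w z : Euc n) : Euc n :=
  fderiv ℝ (chrMap g) a z v w - fderiv ℝ (chrMap g) a w v z
    + chrMap g a z (chrMap g a v w) - chrMap g a w (chrMap g a v z)

/-- The D³Ψ terms cancel in the antisymmetrization over z and w; the remaining D²Ψ terms cancel by
symmetry of D²Ψ and of the Christoffel symbols. -/
theorem curv_law (v w z : Euc n) :
    fderiv ℝ Ψ a (curv g₁ a v w z) =
      curv g₂ (Ψ a) (fderiv ℝ Ψ a v) (fderiv ℝ Ψ a w) (fderiv ℝ Ψ a z) := by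
  have h1 := h.fderiv_chrMap_law z v w
  have h2 := h.fderiv_chrMap_law w v z
  have h3 := h.chrMap_law z (chrMap g₁ a v w)
  have h4 := h.chrMap_law w (chrMap g₁ a v z)
  rw [h.chrMap_law v w, map_add] at h3
  rw [h.chrMap_law v z, map_add] at h4
  simp only [curv, map_add, map_sub]
  rw [h3, h4, eq_sub_of_add_eq' h1, eq_sub_of_add_eq' h2, h.thd_symm z v w, h.snd_symm z w,
    h.snd_symm z v, h.snd_symm w v,
    h.right.chrMap_symm (fderiv ℝ (fderiv ℝ Ψ) a v z) (fderiv ℝ Ψ a w),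
    h.right.chrMap_symm (fderiv ℝ (fderiv ℝ Ψ) a v w) (fderiv ℝ Ψ a z)]
  abel

/-- The curvature `z ↦ R(z, w) v` as a linear map. -/
def _root_.KeyEstimate.curvMap (g : Euc n → Bilin n) (a v w : Euc n) : Euc n →ₗ[ℝ] Euc n where
  toFun := curv g a v w
  map_add' x y := by simp only [curv, map_add, add_apply]; abel
  map_smul' c x := by
    simp only [curv, map_smul, smul_apply, RingHom.id_apply, smul_add, smul_sub]

/-- The Ricci curvature of the metric `g` at `a`. -/
def _root_.KeyEstimate.ric (g : Euc n → Bilin n) (a v w : Euc n) : ℝ :=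
  LinearMap.trace ℝ (Euc n) (curvMap g a v w)

omit h in
lemma _root_.KeyEstimate.trace_eq_sum (A : Euc n →ₗ[ℝ] Euc n) :
    LinearMap.trace ℝ (Euc n) A = ∑ k, A (bv k) k := by
  rw [LinearMap.trace_eq_matrix_trace ℝ (EuclideanSpace.basisFun (Fin n) ℝ).toBasis, Matrix.trace]
  refine Finset.sum_congr rfl fun k _ ↦ ?_
  rw [Matrix.diag_apply, LinearMap.toMatrix_apply]
  simp [bv]

/-- The Ricci curvature is invariant under isometries. -/
theorem ric_law (v w : Euc n) :
    ric g₁ a v w = ric g₂ (Ψ a) (fderiv ℝ Ψ a v) (fderiv ℝ Ψ a w) := by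
  obtain ⟨A, hA⟩ := h.exists_equiv
  rw [ric, ric, ← LinearMap.trace_conj' (curvMap g₁ a v w) A]
  congr 1
  ext1 z
  rw [LinearEquiv.conj_apply]
  simp only [LinearMap.comp_apply, LinearEquiv.coe_coe, hA]
  change fderiv ℝ Ψ a (curv g₁ a v w (A.symm z)) = curv g₂ (Ψ a) _ _ z
  rw [h.curv_law, ← hA (A.symm z), A.apply_symm_apply]

end IsometryAt

end Isometry

end

section

open Set Filter Topology Metric

/-! ### Normal coordinates: Gauss lemma, Hessian of the squared distance, Ricci curvature at the
origin. -/

section Normal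

variable {n : ℕ}

lemma smul_mem_ball {w : Euc n} {δ t : ℝ} (hw : w ∈ ball (0 : Euc n) δ) (ht : t ∈ Icc (0 : ℝ) 1) :
    t • w ∈ ball (0 : Euc n) δ := by
  rw [mem_ball_zero_iff] at hw ⊢
  rw [norm_smul, Real.norm_of_nonneg ht.1]
  exact (mul_le_of_le_one_left (norm_nonneg _) ht.2).trans_lt hw

/-- A metric on a ball for which the rays from the origin are geodesics. -/
structure NormalMetric (g : Euc n → Bilin n) (δ : ℝ) : Prop where
  pos : 0 < δ
  metricAt : ∀ w ∈ ball (0 : Euc n) δ, MetricAt g w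
  radial : ∀ w ∈ ball (0 : Euc n) δ, ∀ u, 2 * fderiv ℝ g w w w u = fderiv ℝ g w u w w

namespace NormalMetric

variable {g : Euc n → Bilin n} {δ : ℝ} (h : NormalMetric g δ)

include h

lemma metricAt_zero : MetricAt g 0 := h.metricAt 0 (mem_ball_self h.pos)

lemma hasDerivAt_ray {w : Euc n} {t : ℝ} (ht : t • w ∈ ball (0 : Euc n) δ) :
    HasDerivAt (fun s : ℝ ↦ g (s • w)) (fderiv ℝ g (t • w) w) t := by
  have h1 : HasDerivAt (fun s : ℝ ↦ s • w) w t := by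
    simpa using (hasDerivAt_id t).smul_const w
  exact (h.metricAt _ ht).differentiableAt.hasFDerivAt.comp_hasDerivAt t h1

lemma hasDerivAt_ray_apply {w : Euc n} {t : ℝ} (ht : t • w ∈ ball (0 : Euc n) δ) (u v : Euc n) :
    HasDerivAt (fun s : ℝ ↦ g (s • w) u v) (fderiv ℝ g (t • w) w u v) t := by
  simpa using hasDerivAt_bilin (h.hasDerivAt_ray ht) (hasDerivAt_const t u) (hasDerivAt_const t v)

lemma radial_ray {w : Euc n} {t : ℝ} (ht : t • w ∈ ball (0 : Euc n) δ) (ht0 : t ≠ 0) (u : Euc n) :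
    2 * fderiv ℝ g (t • w) w w u = fderiv ℝ g (t • w) u w w := by
  have := h.radial _ ht u
  simp only [map_smul, smul_apply, smul_eq_mul] at this
  have h2 : t ^ 2 * (2 * fderiv ℝ g (t • w) w w u) = t ^ 2 * fderiv ℝ g (t • w) u w w := by
    linear_combination this
  exact mul_left_cancel₀ (pow_ne_zero 2 ht0) h2

/-- For u = w the radial identity reads 2x = x, so the squared length of w is constant along its
ray. -/
lemma gauss_self {w : Euc n} (hw : w ∈ ball (0 : Euc n) δ) : g w w w = g 0 w w := by
  have hd : ∀ t ∈ Icc (0 : ℝ) 1, HasDerivAt (fun s : ℝ ↦ g (s • w) w w)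
      (fderiv ℝ g (t • w) w w w) t := fun t ht ↦ h.hasDerivAt_ray_apply (smul_mem_ball hw ht) w w
  obtain ⟨c, hc, hc'⟩ := exists_hasDerivAt_eq_slope (fun s : ℝ ↦ g (s • w) w w)
    (fun t ↦ fderiv ℝ g (t • w) w w w) zero_lt_one
    (fun t ht ↦ (hd t ht).continuousAt.continuousWithinAt)
    (fun t ht ↦ hd t (Ioo_subset_Icc_self ht))
  have h1 := h.radial_ray (smul_mem_ball hw (Ioo_subset_Icc_self hc)) hc.1.ne' w
  simp only [one_smul, zero_smul] at hc'
  linarith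

/-- The derivative in the direction `u` of the identity `g w w w = g 0 w w`. -/
lemma fderiv_gauss_self {w : Euc n} (hw : w ∈ ball (0 : Euc n) δ) (u : Euc n) :
    fderiv ℝ g w u w w + 2 * g w w u = 2 * g 0 w u := by
  have hm := h.metricAt w hw
  have hl : HasDerivAt (fun t : ℝ ↦ w + t • u) u 0 := by
    simpa using ((hasDerivAt_id (0 : ℝ)).smul_const u).const_add w
  have h1 := hasDerivAt_bilin (hasDerivAt_line hm.differentiableAt u) hl hl
  have h2 := hasDerivAt_bilin (hasDerivAt_const (0 : ℝ) (g 0)) hl hl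
  have h3 := h2.congr_of_eventuallyEq (((tendsto_line w u).eventually
    (isOpen_ball.mem_nhds hw)).mono fun t ht ↦ h.gauss_self ht)
  have h4 := h1.unique h3
  simp only [zero_smul, add_zero, zero_apply, zero_add] at h4
  rw [hm.symm_apply u w, h.metricAt_zero.symm_apply u w] at h4
  linarith

/-- The Gauss lemma. -/
theorem gauss {w : Euc n} (hw : w ∈ ball (0 : Euc n) δ) (u : Euc n) : g w w u = g 0 w u := by
  -- The factor s is an integrating factor: the radial identity and `fderiv_gauss_self` together say
  -- that this product has zero derivative for 0 < s < 1. It vanishes at s = 0, and its value at s =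
  -- 1 is the claim.
  have hd : ∀ t ∈ Icc (0 : ℝ) 1, HasDerivAt (fun s : ℝ ↦ s * (g (s • w) w u - g 0 w u))
      (1 * (g (t • w) w u - g 0 w u) + t * fderiv ℝ g (t • w) w w u) t := fun t ht ↦
    (hasDerivAt_id t).mul ((h.hasDerivAt_ray_apply (smul_mem_ball hw ht) w u).sub_const _)
  obtain ⟨c, hc, hc'⟩ := exists_hasDerivAt_eq_slope _ _ zero_lt_one
    (fun t ht ↦ (hd t ht).continuousAt.continuousWithinAt)
    (fun t ht ↦ hd t (Ioo_subset_Icc_self ht))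
  have hcb := smul_mem_ball hw (Ioo_subset_Icc_self hc)
  have h1 := h.radial_ray hcb hc.1.ne' u
  have h2 := h.fderiv_gauss_self hcb u
  simp only [map_smul, smul_apply, smul_eq_mul] at h2
  have h3 : c * (c * fderiv ℝ g (c • w) w w u + g (c • w) w u - g 0 w u) = c * 0 := by
    linear_combination h2 / 2 + c ^ 2 / 2 * h1
  have h4 := mul_left_cancel₀ hc.1.ne' h3
  simp only [one_smul, zero_smul] at hc'
  linarith

/-- Differentiating g_w(w, u) = g_0(w, u) in direction v also hits the argument w, whence the term
g_w(v, u). -/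
lemma fderiv_gauss {w : Euc n} (hw : w ∈ ball (0 : Euc n) δ) (v u : Euc n) :
    fderiv ℝ g w v w u = g 0 v u - g w v u := by
  have hm := h.metricAt w hw
  have hl : HasDerivAt (fun t : ℝ ↦ w + t • v) v 0 := by
    simpa using ((hasDerivAt_id (0 : ℝ)).smul_const v).const_add w
  have h1 := hasDerivAt_bilin (hasDerivAt_line hm.differentiableAt v) hl (hasDerivAt_const (0 : ℝ) u)
  have h2 := hasDerivAt_bilin (hasDerivAt_const (0 : ℝ) (g 0)) hl (hasDerivAt_const (0 : ℝ) u)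
  have h3 := h2.congr_of_eventuallyEq (((tendsto_line w v).eventually
    (isOpen_ball.mem_nhds hw)).mono fun t ht ↦ h.gauss ht u)
  have h4 := h1.unique h3
  simp only [zero_smul, add_zero, zero_apply, zero_add, map_zero] at h4
  linarith

/-- The squared distance to the origin. -/
def _root_.KeyEstimate.sqNorm (b : Bilin n) (w : Euc n) : ℝ := b w w

omit h in
lemma _root_.KeyEstimate.hasFDerivAt_sqNorm (b : Bilin n) (w : Euc n) :
    HasFDerivAt (sqNorm b) (b w + b.flip w) w := by
  have := (b.hasFDerivAt (x := w)).clm_apply (hasFDerivAt_id w)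
  refine this.congr_fderiv ?_
  ext u
  simp

omit h in
lemma _root_.KeyEstimate.contDiff_sqNorm (b : Bilin n) : ContDiff ℝ ∞ (sqNorm b) :=
  b.contDiff.clm_apply contDiff_id

/-- The Christoffel term is 2 g_0(w, Γ(u, v)) = 2 g_w(w, Γ(u, v)) by the Gauss lemma. The Koszul
formula evaluates it, and the derivatives of the Gauss lemma reduce it to 2 g_0(u, v) - 2 g_w(u, v)
- ∂_w g(u, v). -/
lemma hess_sqNorm {w : Euc n} (hw : w ∈ ball (0 : Euc n) δ) (u v : Euc n) :
    hess g (sqNorm (g 0)) w u v = 2 * g w u v + fderiv ℝ g w w u v := by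
  have hm := h.metricAt w hw
  have hf : fderiv ℝ (sqNorm (g 0)) = fun y ↦ (g 0 + (g 0).flip) y := by
    ext1 y
    exact (hasFDerivAt_sqNorm (g 0) y).fderiv
  have hf2 : fderiv ℝ (fderiv ℝ (sqNorm (g 0))) w = g 0 + (g 0).flip := by
    rw [hf]
    exact (g 0 + (g 0).flip).hasFDerivAt.fderiv
  have s0 := h.metricAt_zero.symm_apply
  rw [hess, hf2, hf]
  simp only [add_apply, ContinuousLinearMap.flip_apply]
  have h1 := hm.koszul u v w
  rw [s0 v u, s0 (chrMap g w u v) w, ← h.gauss hw, hm.symm_apply w]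
  rw [hm.fderiv_symm u v w, hm.fderiv_symm v u w, h.fderiv_gauss hw, h.fderiv_gauss hw,
    s0 v u, hm.symm_apply v u] at h1
  linarith

/-- The Laplacian at `w` of the squared distance to the origin, in normal coordinates. -/
def _root_.KeyEstimate.normalLap (g : Euc n → Bilin n) (w : Euc n) : ℝ :=
  2 * n + ∑ i, ∑ j, (gram g w)⁻¹ i j * fderiv ℝ g w w (bv i) (bv j)

theorem lap_sqNorm {w : Euc n} (hw : w ∈ ball (0 : Euc n) δ) :
    lap g (sqNorm (g 0)) w = normalLap g w := by
  have hm := h.metricAt w hw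
  have h1 : ∑ i, ∑ j, (gram g w)⁻¹ i j * gram g w i j = n := by
    have h2 : ((gram g w)⁻¹ * gram g w).trace = n := by
      rw [Matrix.nonsing_inv_mul _ hm.isUnit_det_gram, Matrix.trace_one, Fintype.card_fin]
    rw [← h2]
    simp only [Matrix.trace, Matrix.diag, Matrix.mul_apply]
    refine Finset.sum_congr rfl fun i _ ↦ Finset.sum_congr rfl fun j _ ↦ ?_
    rw [gram_apply, gram_apply, hm.symm_apply]
  rw [lap, normalLap, ← h1]
  simp only [h.hess_sqNorm hw, gram_apply, mul_add, Finset.sum_add_distrib, Finset.mul_sum]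
  congr 1
  exact Finset.sum_congr rfl fun i _ ↦ Finset.sum_congr rfl fun j _ ↦ by ring

lemma eventually_smul_mem (w : Euc n) : ∀ᶠ t in 𝓝 (0 : ℝ), t • w ∈ ball (0 : Euc n) δ := by
  have : Continuous fun t : ℝ ↦ t • w := by fun_prop
  refine this.continuousAt.eventually ?_
  simp only [zero_smul]
  exact ball_mem_nhds (0 : Euc n) h.pos

lemma gauss_ray {w : Euc n} {t : ℝ} (ht : t • w ∈ ball (0 : Euc n) δ) (u : Euc n) :
    g (t • w) w u = g 0 w u := by
  rcases eq_or_ne t 0 with rfl | h0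
  · simp
  · have := h.gauss ht u
    simp only [map_smul, smul_apply, smul_eq_mul] at this
    exact mul_left_cancel₀ h0 this

lemma fderiv_gauss_ray {w : Euc n} {t : ℝ} (ht : t • w ∈ ball (0 : Euc n) δ) (u : Euc n) :
    fderiv ℝ g (t • w) w w u = 0 := by
  have hc : ContinuousAt (fun s : ℝ ↦ s • w) t := by fun_prop
  refine ((h.hasDerivAt_ray_apply ht w u).congr_of_eventuallyEq ?_).unique
    (hasDerivAt_const t (g 0 w u))
  filter_upwards [hc.eventually (isOpen_ball.mem_nhds ht)] with s hs using (h.gauss_ray hs u).symm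

/-- Polarizing ∂_w g(w, u) = 0 makes the trilinear form Dg skew in its first two slots. It is
symmetric in the last two, and such a form vanishes. -/
lemma fderiv_zero : fderiv ℝ g 0 = 0 := by
  have h0 : ∀ w u, fderiv ℝ g 0 w w u = 0 := fun w u ↦ by
    simpa using h.fderiv_gauss_ray (w := w) (t := 0) (by simpa using h.pos) u
  have h1 : ∀ w z u, fderiv ℝ g 0 w z u = - fderiv ℝ g 0 z w u := fun w z u ↦ by
    have := h0 (w + z) u
    simp only [map_add, add_apply, h0] at this
    linarith
  have hs := h.metricAt_zero.fderiv_symm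
  ext a b c
  have e1 := h1 a b c
  have e2 := h1 b c a
  have e3 := h1 c a b
  rw [hs b a c] at e1
  rw [hs c b a] at e2
  rw [hs a c b] at e3
  simp only [zero_apply]
  linarith

lemma chrMap_zero : chrMap g 0 = 0 := by
  ext1 u
  ext1 v
  refine h.metricAt_zero.eq_zero_of_forall fun w ↦ ?_
  have := h.metricAt_zero.koszul u v w
  simp only [h.fderiv_zero, zero_apply] at this
  linarith

lemma differentiableAt_fderiv_zero : DifferentiableAt ℝ (fderiv ℝ g) 0 :=
  (h.metricAt_zero.contDiffAt.fderiv_right (m := ∞) (by simp)).differentiableAt (by simp)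

lemma hasDerivAt_fderiv_line (z u v x : Euc n) :
    HasDerivAt (fun t : ℝ ↦ fderiv ℝ g (0 + t • z) u v x)
      (fderiv ℝ (fderiv ℝ g) 0 z u v x) 0 := by
  have h1 := (hasDerivAt_line h.differentiableAt_fderiv_zero z).clm_apply
    (hasDerivAt_const (0 : ℝ) u)
  have := (h1.clm_apply (hasDerivAt_const (0 : ℝ) v)).clm_apply (hasDerivAt_const (0 : ℝ) x)
  simpa using this

lemma snd_symm_left (z u v x : Euc n) :
    fderiv ℝ (fderiv ℝ g) 0 z u v x = fderiv ℝ (fderiv ℝ g) 0 u z v x :=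
  congrArg (fun b : Bilin n ↦ b v x)
    ((h.metricAt_zero.contDiffAt.isSymmSndFDerivAt (by simpa using two_le_infty)).eq z u)

lemma snd_symm_right (z u v x : Euc n) :
    fderiv ℝ (fderiv ℝ g) 0 z u v x = fderiv ℝ (fderiv ℝ g) 0 z u x v :=
  (h.hasDerivAt_fderiv_line z u v x).unique
    ((h.hasDerivAt_fderiv_line z u x v).congr_of_eventuallyEq
      (((tendsto_line 0 z).eventually h.metricAt_zero.eventually).mono
        fun _ ht ↦ ht.fderiv_symm u v x))

lemma snd_radial (w u : Euc n) : fderiv ℝ (fderiv ℝ g) 0 w w w u = 0 := by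
  refine (h.hasDerivAt_fderiv_line w w w u).unique
    ((hasDerivAt_const (0 : ℝ) (0 : ℝ)).congr_of_eventuallyEq ?_)
  filter_upwards [h.eventually_smul_mem w] with _ ht
  rw [zero_add]
  exact h.fderiv_gauss_ray ht u

lemma snd_cyclic (w z u : Euc n) :
    fderiv ℝ (fderiv ℝ g) 0 w w z u = - 2 * fderiv ℝ (fderiv ℝ g) 0 z w w u := by
  have h1 := h.snd_radial (w + z) u
  have h2 := h.snd_radial (w - z) u
  have h3 := h.snd_radial z u
  have h5 := h.snd_radial w u
  have h4 := h.snd_symm_left w z w u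
  simp only [map_add, map_sub, add_apply, sub_apply, h3, h5] at h1 h2
  linarith

lemma snd_pair (w k l : Euc n) :
    fderiv ℝ (fderiv ℝ g) 0 k l w w =
      - (fderiv ℝ (fderiv ℝ g) 0 w k l w + fderiv ℝ (fderiv ℝ g) 0 w l k w) := by
  have h1 := h.snd_cyclic (k + l) w w
  have h2 := h.snd_cyclic k w w
  have h3 := h.snd_cyclic l w w
  have h4 := h.snd_symm_left l k w w
  simp only [map_add, add_apply] at h1
  linarith

/-- The derivative of the Christoffel symbols at the origin. -/
lemma fderiv_chrMap_zero (z u v x : Euc n) :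
    2 * g 0 (fderiv ℝ (chrMap g) 0 z u v) x =
      fderiv ℝ (fderiv ℝ g) 0 z u v x + fderiv ℝ (fderiv ℝ g) 0 z v u x
        - fderiv ℝ (fderiv ℝ g) 0 z x u v := by
  have hm := h.metricAt_zero
  have hΓ : DifferentiableAt ℝ (chrMap g) 0 := hm.contDiffAt_chrMap.differentiableAt (by simp)
  have h1 := hasDerivAt_bilin (hasDerivAt_line hΓ z) (hasDerivAt_const (0 : ℝ) u)
    (hasDerivAt_const (0 : ℝ) v)
  have h2 := (hasDerivAt_bilin (hasDerivAt_line hm.differentiableAt z) h1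
    (hasDerivAt_const (0 : ℝ) x)).const_mul 2
  have h3 := ((h.hasDerivAt_fderiv_line z u v x).add (h.hasDerivAt_fderiv_line z v u x)).sub
    (h.hasDerivAt_fderiv_line z x u v)
  have h4 := h3.congr_of_eventuallyEq (((tendsto_line 0 z).eventually hm.eventually).mono
    fun _ ht ↦ ht.koszul u v x)
  simpa [h.fderiv_zero] using h2.unique h4

/-- The Ricci curvature at the origin in terms of the second derivatives of the metric. -/
theorem ric_zero (w : Euc n) :
    ric g 0 w w = - (3 / 2) * ∑ k, ∑ l, (gram g 0)⁻¹ k l *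
      fderiv ℝ (fderiv ℝ g) 0 w w (bv k) (bv l) := by
  have hm := h.metricAt_zero
  rw [ric, trace_eq_sum, Finset.mul_sum]
  refine Finset.sum_congr rfl fun k _ ↦ ?_
  set X : Euc n := curvMap g 0 w w (bv k) with hX
  have hXe : X = fderiv ℝ (chrMap g) 0 (bv k) w w - fderiv ℝ (chrMap g) 0 w w (bv k) := by
    change curv g 0 w w (bv k) = _
    simp [curv, h.chrMap_zero]
  have h1 : X k = ∑ l, (gram g 0)⁻¹ k l * g 0 X (bv l) := by
    have h2 : (gram g 0)⁻¹.mulVec ((gram g 0).mulVec (fun i ↦ X i)) k = X k := by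
      rw [Matrix.mulVec_mulVec, Matrix.nonsing_inv_mul _ hm.isUnit_det_gram, Matrix.one_mulVec]
    rw [← h2, Matrix.mulVec, dotProduct]
    refine Finset.sum_congr rfl fun l _ ↦ ?_
    rw [hm.symm_apply X, clm_apply_eq_sum (g 0 (bv l)), Matrix.mulVec, dotProduct]
    simp [gram_apply, mul_comm]
  rw [h1, Finset.mul_sum]
  refine Finset.sum_congr rfl fun l _ ↦ ?_
  have e1 := h.fderiv_chrMap_zero (bv k) w w (bv l)
  have e2 := h.fderiv_chrMap_zero w w (bv k) (bv l)
  have e3 : g 0 X (bv l) = g 0 (fderiv ℝ (chrMap g) 0 (bv k) w w) (bv l)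
      - g 0 (fderiv ℝ (chrMap g) 0 w w (bv k)) (bv l) := by
    rw [hXe, map_sub, sub_apply]
  have c1 := h.snd_cyclic w (bv k) (bv l)
  have c2 := h.snd_cyclic w (bv l) (bv k)
  have c3 := h.snd_pair w (bv k) (bv l)
  have s1 := h.snd_symm_right w w (bv k) (bv l)
  have s2 := h.snd_symm_left w (bv k) w (bv l)
  have s3 := h.snd_symm_left w (bv l) w (bv k)
  have s4 := h.snd_symm_right w (bv k) (bv l) w
  have s5 := h.snd_symm_right w (bv l) (bv k) w
  rw [e3]
  have : g 0 (fderiv ℝ (chrMap g) 0 (bv k) w w) (bv l)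
      - g 0 (fderiv ℝ (chrMap g) 0 w w (bv k)) (bv l) =
      - (3 / 2) * fderiv ℝ (fderiv ℝ g) 0 w w (bv k) (bv l) := by linarith
  rw [this]
  ring

end NormalMetric

end Normal

end

section

open Set Filter Topology Metric

section Expansion

variable {n : ℕ}

namespace NormalMetric

variable {g : Euc n → Bilin n} {δ : ℝ} (h : NormalMetric g δ)

include h

/-- The second order Taylor expansion along rays of the Laplacian of the squared distance. -/
theorem deriv_normalLap_ray (w : Euc n) :
    normalLap g 0 = 2 * n ∧ deriv (fun t : ℝ ↦ normalLap g (t • w)) 0 = 0 ∧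
      deriv (deriv fun t : ℝ ↦ normalLap g (t • w)) 0 = - (4 / 3) * ric g 0 w w := by
  let q : ℝ → ℝ := fun t ↦ ∑ i, ∑ j, (gram g (t • w))⁻¹ i j *
    fderiv ℝ g (t • w) w (bv i) (bv j)
  have hf : (fun t : ℝ ↦ normalLap g (t • w)) = fun t ↦ 2 * n + t * q t := by
    ext t
    simp only [normalLap, q, map_smul, smul_apply, smul_eq_mul, Finset.mul_sum]
    congr 1
    exact Finset.sum_congr rfl fun i _ ↦ Finset.sum_congr rfl fun j _ ↦ by ring
  have hm := h.metricAt_zero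
  have hline : ContDiffAt ℝ ∞ (fun t : ℝ ↦ t • w) 0 := contDiffAt_id.smul contDiffAt_const
  have hG : ∀ i j, ContDiffAt ℝ ∞ (fun t : ℝ ↦ (gram g (t • w))⁻¹ i j) 0 := fun i j ↦
    ContDiffAt.comp (g := fun y ↦ (gram g y)⁻¹ i j) (0 : ℝ)
      (by rw [zero_smul]; exact hm.contDiffAt_gram_inv i j) hline
  have hD : ContDiffAt ℝ ∞ (fun t : ℝ ↦ fderiv ℝ g (t • w)) 0 :=
    ContDiffAt.comp (g := fderiv ℝ g) (0 : ℝ)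
      (by rw [zero_smul]; exact hm.contDiffAt.fderiv_right (by simp)) hline
  have hq : ContDiffAt ℝ ∞ q 0 := ContDiffAt.sum fun i _ ↦ ContDiffAt.sum fun j _ ↦
    (hG i j).mul (((hD.clm_apply contDiffAt_const).clm_apply contDiffAt_const).clm_apply
      contDiffAt_const)
  have hq0 : q 0 = 0 := by simp [q, h.fderiv_zero]
  have hq1 : HasDerivAt q (∑ i, ∑ j, (gram g 0)⁻¹ i j *
      fderiv ℝ (fderiv ℝ g) 0 w w (bv i) (bv j)) 0 := by
    refine HasDerivAt.fun_sum fun i _ ↦ HasDerivAt.fun_sum fun j _ ↦ ?_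
    have h1 := ((hG i j).differentiableAt (by simp)).hasDerivAt
    have h2 := h.hasDerivAt_fderiv_line w w (bv i) (bv j)
    simp only [zero_add] at h2
    refine (h1.fun_mul h2).congr_deriv ?_
    simp [h.fderiv_zero]
  have hdq : DifferentiableAt ℝ (deriv q) 0 := by
    have h1 : DifferentiableAt ℝ (fderiv ℝ q) 0 :=
      (hq.fderiv_right (m := ∞) (by simp)).differentiableAt (by simp)
    exact h1.clm_apply (differentiableAt_const (1 : ℝ))
  have hqe : ∀ᶠ t in 𝓝 (0 : ℝ), DifferentiableAt ℝ q t :=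
    ((hq.of_le (m := 1) (by simp)).eventually (by simp)).mono fun t ht ↦
      ht.differentiableAt (by simp)
  have hd1 : ∀ t, DifferentiableAt ℝ q t →
      HasDerivAt (fun t ↦ 2 * n + t * q t) (q t + t * deriv q t) t := fun t ht ↦ by
    simpa using ((hasDerivAt_id t).mul ht.hasDerivAt).const_add (2 * (n : ℝ))
  refine ⟨by simp [normalLap], ?_, ?_⟩
  · rw [hf, (hd1 0 hqe.self_of_nhds).deriv, hq0]
    simp
  · have h1 : deriv (fun t ↦ 2 * n + t * q t) =ᶠ[𝓝 0] fun t ↦ q t + t * deriv q t :=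
      hqe.mono fun t ht ↦ (hd1 t ht).deriv
    have h2 : HasDerivAt (fun t ↦ q t + t * deriv q t)
        (deriv q 0 + (1 * deriv q 0 + 0 * deriv (deriv q) 0)) 0 :=
      hqe.self_of_nhds.hasDerivAt.add ((hasDerivAt_id (0 : ℝ)).mul hdq.hasDerivAt)
    rw [hf, h1.deriv_eq, h2.deriv, hq1.deriv, h.ric_zero w]
    ring

end NormalMetric

/-- Taylor's inequality at order three on an interval. -/
lemma abs_sub_taylor_two_le {f f1 f2 f3 : ℝ → ℝ} {s C : ℝ} (hs : 0 ≤ s)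
    (h0 : ∀ t ∈ Icc 0 s, HasDerivAt f (f1 t) t) (h1 : ∀ t ∈ Icc 0 s, HasDerivAt f1 (f2 t) t)
    (h2 : ∀ t ∈ Icc 0 s, HasDerivAt f2 (f3 t) t) (hC : ∀ t ∈ Icc 0 s, |f3 t| ≤ C) :
    |f s - f 0 - f1 0 * s - f2 0 / 2 * s ^ 2| ≤ C * s ^ 3 := by
  have hC0 : 0 ≤ C := (abs_nonneg _).trans (hC 0 ⟨le_rfl, hs⟩)
  have z : (0 : ℝ) ∈ Icc 0 s := ⟨le_rfl, hs⟩
  have e2 : ∀ t ∈ Icc 0 s, |f2 t - f2 0| ≤ C * s := by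
    intro t ht
    have := (convex_Icc 0 s).norm_image_sub_le_of_norm_hasDerivWithin_le
      (fun x hx ↦ (h2 x hx).hasDerivWithinAt) hC z ht
    rw [Real.norm_eq_abs, Real.norm_eq_abs, sub_zero, abs_of_nonneg ht.1] at this
    exact this.trans (by gcongr; exact ht.2)
  have e1 : ∀ t ∈ Icc 0 s, |f1 t - f1 0 - f2 0 * t| ≤ C * s * s := by
    intro t ht
    have := (convex_Icc 0 s).norm_image_sub_le_of_norm_hasDerivWithin_le
      (f := fun t ↦ f1 t - f2 0 * t) (f' := fun t ↦ f2 t - f2 0)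
      (fun x hx ↦ ((h1 x hx).sub (by simpa using (hasDerivAt_id x).const_mul (f2 0))).hasDerivWithinAt)
      e2 z ht
    rw [Real.norm_eq_abs, Real.norm_eq_abs, sub_zero, abs_of_nonneg ht.1] at this
    refine le_trans (le_of_eq ?_) (this.trans (by gcongr; exact ht.2))
    congr 1
    ring
  have := (convex_Icc 0 s).norm_image_sub_le_of_norm_hasDerivWithin_le
      (f := fun t ↦ f t - f1 0 * t - f2 0 / 2 * t ^ 2) (f' := fun t ↦ f1 t - f1 0 - f2 0 * t)
      (fun x hx ↦ (((h0 x hx).sub (by simpa using (hasDerivAt_id x).const_mul (f1 0))).sub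
        (((hasDerivAt_pow 2 x).const_mul (f2 0 / 2)).congr_deriv
          (by push_cast; ring))).hasDerivWithinAt)
      e1 z ⟨hs, le_rfl⟩
  rw [Real.norm_eq_abs, Real.norm_eq_abs, sub_zero, abs_of_nonneg hs] at this
  refine le_trans (le_of_eq ?_) (this.trans (le_of_eq (by ring)))
  congr 1
  ring

/-- A uniform third order Taylor estimate for a smooth function of two variables along rays in the
second variable. -/
theorem exists_taylor_bound {X Y : Type*} [NormedAddCommGroup X] [NormedSpace ℝ X]
    [FiniteDimensional ℝ X] [NormedAddCommGroup Y] [NormedSpace ℝ Y] [FiniteDimensional ℝ Y]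
    {F : X × Y → ℝ} {y₀ : X} {δ : ℝ} (hδ : 0 < δ)
    (hF : ContDiffOn ℝ ∞ F (ball y₀ δ ×ˢ ball 0 δ)) :
    ∃ C > 0, ∀ p ∈ closedBall y₀ (δ / 2), ∀ w ∈ closedBall (0 : Y) (δ / 2),
      deriv (fun t : ℝ ↦ F (p, t • w)) 0 = 0 →
      |F (p, w) - F (p, 0) - deriv (deriv fun t : ℝ ↦ F (p, t • w)) 0 / 2| ≤ C * ‖w‖ ^ 3 ∧
      |F (p, w) - F (p, 0)| ≤ C * ‖w‖ ^ 2 := by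
  let O : Set (X × Y × ℝ) := {x | x.1 ∈ ball y₀ δ ∧ x.2.2 • x.2.1 ∈ ball (0 : Y) δ}
  have hO : IsOpen O := by
    refine (isOpen_ball.preimage continuous_fst).inter (isOpen_ball.preimage ?_)
    fun_prop
  let D : (X × Y × ℝ → ℝ) → X × Y × ℝ → ℝ := fun f x ↦ fderiv ℝ f x (0, 0, 1)
  have hD : ∀ f, ContDiffOn ℝ ∞ f O → ContDiffOn ℝ ∞ (D f) O := fun f hf ↦
    (hf.fderiv_of_isOpen hO (by simp)).clm_apply contDiffOn_const
  have hDd : ∀ f, ContDiffOn ℝ ∞ f O → ∀ p w t, (p, w, t) ∈ O →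
      HasDerivAt (fun s : ℝ ↦ f (p, w, s)) (D f (p, w, t)) t := by
    intro f hf p w t hx
    have h1 : HasFDerivAt f (fderiv ℝ f (p, w, t)) (p, w, t) :=
      ((hf.contDiffAt (hO.mem_nhds hx)).differentiableAt (by simp)).hasFDerivAt
    have h2 : HasDerivAt (fun s : ℝ ↦ (p, w, s)) ((0 : X), (0 : Y), (1 : ℝ)) t :=
      (hasDerivAt_const t p).prodMk ((hasDerivAt_const t w).prodMk (hasDerivAt_id t))
    exact h1.comp_hasDerivAt t h2
  let f0 : X × Y × ℝ → ℝ := fun x ↦ F (x.1, x.2.2 • x.2.1)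
  have hf0 : ContDiffOn ℝ ∞ f0 O :=
    hF.comp (ContDiff.contDiffOn (by fun_prop)) fun x hx ↦ hx
  have hf1 := hD _ hf0
  have hf2 := hD _ hf1
  have hf3 := hD _ hf2
  let K : Set (X × Y × ℝ) := closedBall y₀ (δ / 2) ×ˢ closedBall (0 : Y) (δ / 2) ×ˢ Icc (0 : ℝ) 1
  have hK : IsCompact K :=
    (isCompact_closedBall _ _).prod ((isCompact_closedBall _ _).prod isCompact_Icc)
  have hKO : K ⊆ O := by
    rintro ⟨p, w, t⟩ ⟨hp, hw, ht⟩
    have hw' : ‖w‖ ≤ δ / 2 := by simpa using hw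
    refine ⟨closedBall_subset_ball (by linarith) hp, ?_⟩
    rw [mem_ball_zero_iff, norm_smul, Real.norm_of_nonneg ht.1]
    have := mul_le_of_le_one_left (norm_nonneg w) ht.2
    linarith
  obtain ⟨C2, hC2⟩ := hK.exists_bound_of_continuousOn (hf2.continuousOn.mono hKO)
  obtain ⟨C3, hC3⟩ := hK.exists_bound_of_continuousOn (hf3.continuousOn.mono hKO)
  let C := max C2 0 + max C3 0
  have hC2' : ∀ x ∈ K, |D (D f0) x| ≤ C := fun x hx ↦ (hC2 x hx).trans
    ((le_max_left _ _).trans (le_add_of_nonneg_right (le_max_right _ _)))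
  have hC3' : ∀ x ∈ K, |D (D (D f0)) x| ≤ C := fun x hx ↦ (hC3 x hx).trans
    ((le_max_left _ _).trans (le_add_of_nonneg_left (le_max_right _ _)))
  have hC0 : 0 ≤ C := by positivity
  set ρ := δ / 2 with hρ
  have hρ0 : 0 < ρ := by positivity
  refine ⟨2 * C * (ρ⁻¹ ^ 3 + ρ⁻¹ ^ 2) + 1, by positivity, fun p hp w hw hder ↦ ?_⟩
  rcases eq_or_ne w 0 with rfl | hw0
  · simp
  have hwn : 0 < ‖w‖ := norm_pos_iff.2 hw0
  have hw' : ‖w‖ ≤ ρ := by simpa using hw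
  set s := ‖w‖ * ρ⁻¹ with hs
  have hs0 : 0 < s := by positivity
  have hs1 : s ≤ 1 := by
    rw [hs, ← div_eq_mul_inv]
    exact div_le_one_of_le₀ hw' hρ0.le
  let v : Y := s⁻¹ • w
  have hsv : s • v = w := smul_inv_smul₀ hs0.ne' w
  have hv : v ∈ closedBall (0 : Y) ρ := by
    rw [mem_closedBall_zero_iff, norm_smul, Real.norm_of_nonneg (by positivity), hs]
    apply le_of_eq
    field_simp
  have hmem : ∀ t ∈ Icc (0 : ℝ) s, (p, v, t) ∈ K := fun t ht ↦
    ⟨hp, hv, ht.1, ht.2.trans hs1⟩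
  have hT := abs_sub_taylor_two_le (f := fun t ↦ f0 (p, v, t)) (f1 := fun t ↦ D f0 (p, v, t))
    (f2 := fun t ↦ D (D f0) (p, v, t)) (f3 := fun t ↦ D (D (D f0)) (p, v, t)) hs0.le
    (fun t ht ↦ hDd _ hf0 _ _ _ (hKO (hmem t ht))) (fun t ht ↦ hDd _ hf1 _ _ _ (hKO (hmem t ht)))
    (fun t ht ↦ hDd _ hf2 _ _ _ (hKO (hmem t ht))) (fun t ht ↦ hC3' _ (hmem t ht))
  have e0 : f0 (p, v, s) = F (p, w) := by simp only [f0, hsv]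
  have e1 : f0 (p, v, 0) = F (p, 0) := by simp [f0]
  have hz : (p, v, (0 : ℝ)) ∈ O := hKO (hmem 0 ⟨le_rfl, hs0.le⟩)
  have hfe : (fun t : ℝ ↦ F (p, t • w)) = fun t ↦ f0 (p, v, s * t) := by
    ext t
    simp only [f0]
    rw [mul_comm, mul_smul, hsv]
  have hmul : ∀ t : ℝ, HasDerivAt (fun t : ℝ ↦ s * t) s t := fun t ↦ by
    simpa using (hasDerivAt_id t).const_mul s
  have hev : ∀ᶠ t in 𝓝 (0 : ℝ), (p, v, s * t) ∈ O := by
    have hc : Continuous fun t : ℝ ↦ (p, v, s * t) := by fun_prop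
    exact hc.continuousAt.eventually (hO.mem_nhds (by simpa using hz))
  have hd1 : ∀ᶠ t in 𝓝 (0 : ℝ),
      deriv (fun t : ℝ ↦ F (p, t • w)) t = D f0 (p, v, s * t) * s := by
    filter_upwards [hev] with t ht
    rw [hfe]
    exact ((hDd _ hf0 p v (s * t) ht).comp t (hmul t)).deriv
  have hd2 : deriv (deriv fun t : ℝ ↦ F (p, t • w)) 0 = D (D f0) (p, v, 0) * s * s := by
    have h1 : HasDerivAt (fun t : ℝ ↦ D f0 (p, v, s * t) * s) (D (D f0) (p, v, s * 0) * s * s) 0 :=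
      ((hDd _ hf1 p v (s * 0) (by simpa using hz)).comp (0 : ℝ) (hmul 0)).mul_const s
    rw [EventuallyEq.deriv_eq hd1, h1.deriv, mul_zero]
  have hd10 : D f0 (p, v, 0) = 0 := by
    have h1 := hd1.self_of_nhds
    rw [hder, mul_zero] at h1
    simpa [hs0.ne'] using h1.symm
  have hb2 : |D (D f0) (p, v, 0)| ≤ C := hC2' _ (hmem 0 ⟨le_rfl, hs0.le⟩)
  simp only [e0, e1, hd10] at hT
  have hs3 : s ^ 3 = ‖w‖ ^ 3 * ρ⁻¹ ^ 3 := by rw [hs]; ring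
  have hs2 : s ^ 2 = ‖w‖ ^ 2 * ρ⁻¹ ^ 2 := by rw [hs]; ring
  have hpos3 : 0 ≤ C * (‖w‖ ^ 3 * ρ⁻¹ ^ 3) := by positivity
  have hpos2 : 0 ≤ C * (‖w‖ ^ 3 * ρ⁻¹ ^ 2) := by positivity
  have hpos3' : 0 ≤ C * (‖w‖ ^ 2 * ρ⁻¹ ^ 3) := by positivity
  have hpos2' : 0 ≤ C * (‖w‖ ^ 2 * ρ⁻¹ ^ 2) := by positivity
  have hw3 : 0 ≤ ‖w‖ ^ 3 := by positivity
  have hw2 : 0 ≤ ‖w‖ ^ 2 := by positivity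
  constructor
  · rw [hd2]
    have h1 : F (p, w) - F (p, 0) - D (D f0) (p, v, 0) * s * s / 2 =
        F (p, w) - F (p, 0) - 0 * s - D (D f0) (p, v, 0) / 2 * s ^ 2 := by ring
    rw [h1]
    rw [hs3] at hT
    refine hT.trans ?_
    linarith
  · have h1 : |F (p, w) - F (p, 0)| ≤ C * s ^ 3 + |D (D f0) (p, v, 0)| / 2 * s ^ 2 := by
      have h2 : F (p, w) - F (p, 0) = (F (p, w) - F (p, 0) - 0 * s
          - D (D f0) (p, v, 0) / 2 * s ^ 2) + D (D f0) (p, v, 0) / 2 * s ^ 2 := by ring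
      rw [h2]
      refine (abs_add_le _ _).trans (add_le_add hT (le_of_eq ?_))
      rw [abs_mul, abs_div, abs_of_nonneg (sq_nonneg s), abs_of_pos (zero_lt_two' ℝ)]
    have h3 : s ^ 3 ≤ s ^ 2 := pow_le_pow_of_le_one hs0.le hs1 (by norm_num)
    have h4 : C * s ^ 3 ≤ C * s ^ 2 := by gcongr
    have h5 : |D (D f0) (p, v, 0)| / 2 * s ^ 2 ≤ C / 2 * s ^ 2 := by gcongr
    rw [hs2] at h4 h5
    rw [hs2] at h1
    linarith

end Expansion

end

section

open Set Filter Topology Metric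

section Extension

/-- A function which is smooth near a point agrees near that point with a globally smooth
function. -/
lemma exists_contDiff_eventuallyEq {n : ℕ} {F : Type*} [NormedAddCommGroup F] [NormedSpace ℝ F]
    {f : Euc n → F} {a : Euc n} (hf : ∀ᶠ y in 𝓝 a, ContDiffAt ℝ ∞ f y) :
    ∃ f' : Euc n → F, ContDiff ℝ ∞ f' ∧ f' =ᶠ[𝓝 a] f := by
  obtain ⟨R, hR, hball⟩ := Metric.eventually_nhds_iff_ball.1 hf
  let χ : ContDiffBump a := ⟨R / 3, R / 2, by positivity, by linarith⟩
  refine ⟨fun y ↦ χ y • f y, contDiff_iff_contDiffAt.2 fun y ↦ ?_, ?_⟩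
  · by_cases hy : y ∈ ball a R
    · exact χ.contDiffAt.smul (hball y hy)
    · have hy' : y ∉ tsupport χ := by
        rw [χ.tsupport_eq]
        exact fun h ↦ hy (closedBall_subset_ball (by change R / 2 < R; linarith) h)
      refine (contDiffAt_const (c := (0 : F))).congr_of_eventuallyEq ?_
      filter_upwards [notMem_tsupport_iff_eventuallyEq.1 hy'] with z hz
      simp [hz]
  · filter_upwards [χ.eventuallyEq_one] with z hz
    simp [hz]

end Extension

section Fiber

variable {E : Type*} [NormedAddCommGroup E] [NormedSpace ℝ E]
  {y₀ : E} {δ₀ : ℝ} {e : E × E → E}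

lemma differentiableAt_of_ball_prod (hsm : ContDiffOn ℝ ∞ e (ball y₀ δ₀ ×ˢ ball 0 δ₀))
    {p w : E} (hp : p ∈ ball y₀ δ₀) (hw : w ∈ ball (0 : E) δ₀) :
    DifferentiableAt ℝ e (p, w) :=
  (hsm.contDiffAt ((isOpen_ball.prod isOpen_ball).mem_nhds ⟨hp, hw⟩)).differentiableAt (by simp)

lemma hasFDerivAt_fiber {X Y F : Type*} [NormedAddCommGroup X] [NormedSpace ℝ X]
    [NormedAddCommGroup Y] [NormedSpace ℝ Y] [NormedAddCommGroup F] [NormedSpace ℝ F]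
    {G : X × Y → F} {p : X} {w : Y} (hG : DifferentiableAt ℝ G (p, w)) :
    HasFDerivAt (fun w ↦ G (p, w))
      ((fderiv ℝ G (p, w)).comp (ContinuousLinearMap.inr ℝ X Y)) w :=
  hG.hasFDerivAt.comp w (hasFDerivAt_prodMk_right p w)

lemma contDiffOn_fderiv_fiber {X Y F : Type*} [NormedAddCommGroup X] [NormedSpace ℝ X]
    [NormedAddCommGroup Y] [NormedSpace ℝ Y] [NormedAddCommGroup F] [NormedSpace ℝ F]
    {G : X × Y → F} {U : Set (X × Y)} (hU : IsOpen U) (hG : ContDiffOn ℝ ∞ G U) :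
    ContDiffOn ℝ ∞ (fun x ↦ fderiv ℝ (fun w ↦ G (x.1, w)) x.2) U := by
  have h1 : ContDiffOn ℝ ∞ (fderiv ℝ G) U := hG.fderiv_of_isOpen hU (by simp)
  refine (h1.clm_comp (contDiffOn_const (c := ContinuousLinearMap.inr ℝ X Y))).congr fun x hx ↦ ?_
  exact (hasFDerivAt_fiber
    ((hG.contDiffAt (hU.mem_nhds hx)).differentiableAt (by simp))).fderiv

lemma fderiv_fiber {p w : E} (he : DifferentiableAt ℝ e (p, w)) (b : E) :
    fderiv ℝ (fun w ↦ e (p, w)) w b = fderiv ℝ e (p, w) (0, b) := by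
  rw [(hasFDerivAt_fiber he).fderiv]
  simp

/-- The linear automorphism `(a, b) ↦ (a, a + b)`. -/
def shearEquiv (E : Type*) [NormedAddCommGroup E] [NormedSpace ℝ E] : (E × E) ≃L[ℝ] E × E :=
  ContinuousLinearEquiv.equivOfInverse
    ((ContinuousLinearMap.fst ℝ _ _).prod
      (ContinuousLinearMap.fst ℝ _ _ + ContinuousLinearMap.snd ℝ _ _))
    ((ContinuousLinearMap.fst ℝ _ _).prod
      (ContinuousLinearMap.snd ℝ _ _ - ContinuousLinearMap.fst ℝ _ _))
    (fun x ↦ by simp) (fun x ↦ by simp)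

lemma hasFDerivAt_prodMk_fst (hδ₀ : 0 < δ₀)
    (hsm : ContDiffOn ℝ ∞ e (ball y₀ δ₀ ×ˢ ball 0 δ₀))
    (hz : ∀ p ∈ ball y₀ δ₀, e (p, 0) = p)
    (hd : fderiv ℝ (fun w ↦ e (y₀, w)) 0 = ContinuousLinearMap.id ℝ (E)) :
    HasFDerivAt (fun x : E × E ↦ (x.1, e x))
      (shearEquiv E : (E × E) →L[ℝ] E × E) (y₀, 0) := by
  have hed : DifferentiableAt ℝ e (y₀, 0) :=
    differentiableAt_of_ball_prod hsm (mem_ball_self hδ₀) (mem_ball_self hδ₀)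
  refine (hasFDerivAt_fst.prodMk hed.hasFDerivAt).congr_fderiv ?_
  have h1 : ∀ a, fderiv ℝ e (y₀, 0) (a, 0) = a := by
    intro a
    have h3 : HasFDerivAt (fun p ↦ e (p, 0)) _ y₀ :=
      hed.hasFDerivAt.comp y₀ (hasFDerivAt_prodMk_left y₀ (0 : E))
    have h4 : HasFDerivAt (fun p ↦ e (p, 0)) (ContinuousLinearMap.id ℝ (E)) y₀ :=
      (hasFDerivAt_id y₀).congr_of_eventuallyEq (by
        filter_upwards [isOpen_ball.mem_nhds (mem_ball_self hδ₀)] with p hp using hz p hp)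
    have h5 := congrArg (fun L : E →L[ℝ] E ↦ L a) (h3.unique h4)
    simpa using h5
  have h2 : ∀ b, fderiv ℝ e (y₀, 0) (0, b) = b := by
    intro b
    rw [← fderiv_fiber hed, hd]
    rfl
  refine ContinuousLinearMap.ext fun x ↦ ?_
  have h3 : fderiv ℝ e (y₀, 0) x = x.1 + x.2 := by
    obtain ⟨a, b⟩ := x
    have : ((a, b) : E × E) = (a, 0) + (0, b) := by simp
    rw [this, map_add, h1, h2]
    simp
  exact Prod.ext rfl h3

lemma injective_fderiv_fiber {p w : E} (he : DifferentiableAt ℝ e (p, w))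
    {L : (E × E) ≃L[ℝ] E × E}
    (hL : HasFDerivAt (fun x : E × E ↦ (x.1, e x))
      (L : (E × E) →L[ℝ] E × E) (p, w)) :
    Function.Injective (fderiv ℝ (fun w ↦ e (p, w)) w) := by
  refine (injective_iff_map_eq_zero _).2 fun b hb ↦ ?_
  rw [fderiv_fiber he] at hb
  have h1 := hL.unique (hasFDerivAt_fst.prodMk he.hasFDerivAt)
  have h2 : L (0, b) = 0 := by
    have := congrArg (fun T : (E × E) →L[ℝ] E × E ↦ T (0, b)) h1
    exact this.trans (Prod.ext rfl hb)
  have h3 : ((0 : E), b) = 0 := L.injective (h2.trans (map_zero L).symm)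
  exact congrArg Prod.snd h3

lemma exists_injOn_fiber [CompleteSpace E] (hδ₀ : 0 < δ₀)
    (hsm : ContDiffOn ℝ ∞ e (ball y₀ δ₀ ×ˢ ball 0 δ₀))
    (hz : ∀ p ∈ ball y₀ δ₀, e (p, 0) = p)
    (hd : fderiv ℝ (fun w ↦ e (y₀, w)) 0 = ContinuousLinearMap.id ℝ (E)) :
    ∃ δ > 0, δ ≤ δ₀ ∧ ∀ p ∈ ball y₀ δ, InjOn (fun w ↦ e (p, w)) (ball 0 δ) ∧
      ∀ w ∈ ball (0 : E) δ, Function.Injective (fderiv ℝ (fun w ↦ e (p, w)) w) := by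
  have hopen : IsOpen (ball y₀ δ₀ ×ˢ ball (0 : E) δ₀) := isOpen_ball.prod isOpen_ball
  have hmem : (y₀, (0 : E)) ∈ ball y₀ δ₀ ×ˢ ball (0 : E) δ₀ :=
    ⟨mem_ball_self hδ₀, mem_ball_self hδ₀⟩
  obtain ⟨Φ, hΦm, hΦs, hΦ, hΦd, -⟩ := exists_smooth_openPartialHomeomorph hopen hmem
    (contDiffOn_fst.prodMk hsm) (hasFDerivAt_prodMk_fst hδ₀ hsm hz hd)
  obtain ⟨δ, hδ, hδΦ⟩ := Metric.isOpen_iff.1 Φ.open_source _ hΦm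
  rw [← ball_prod_same] at hδΦ
  refine ⟨min δ δ₀, lt_min hδ hδ₀, min_le_right _ _, fun p hp ↦ ⟨?_, fun w hw ↦ ?_⟩⟩
  · intro w hw w' hw' heq
    have hp' := ball_subset_ball (min_le_left δ δ₀) hp
    have h1 : (p, w) ∈ Φ.source := hδΦ ⟨hp', ball_subset_ball (min_le_left δ δ₀) hw⟩
    have h2 : (p, w') ∈ Φ.source := hδΦ ⟨hp', ball_subset_ball (min_le_left δ δ₀) hw'⟩
    have := Φ.injOn h1 h2 (by
      rw [hΦ, hΦ]
      exact Prod.ext rfl heq)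
    exact congrArg Prod.snd this
  · have h1 : (p, w) ∈ Φ.source := hδΦ ⟨ball_subset_ball (min_le_left δ δ₀) hp,
      ball_subset_ball (min_le_left δ δ₀) hw⟩
    obtain ⟨L, hL⟩ := hΦd _ h1
    exact injective_fderiv_fiber (differentiableAt_of_ball_prod hsm
      (ball_subset_ball (min_le_right δ δ₀) hp) (ball_subset_ball (min_le_right δ δ₀) hw)) hL

end Fiber

section Pullback

variable {n : ℕ}

/-- The pullback of a bilinear form by a linear map. -/
def pullForm (b : Bilin n) (A : Euc n →L[ℝ] Euc n) : Bilin n :=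
  ((ContinuousLinearMap.compL ℝ (Euc n) (Euc n) ℝ).flip A).comp (b.comp A)

@[simp] lemma pullForm_apply (b : Bilin n) (A : Euc n →L[ℝ] Euc n) (u v : Euc n) :
    pullForm b A u v = b (A u) (A v) := rfl

lemma contDiffAt_pullForm {X : Type*} [NormedAddCommGroup X] [NormedSpace ℝ X] {k : WithTop ℕ∞}
    {b : X → Bilin n} {A : X → Euc n →L[ℝ] Euc n} {x : X} (hb : ContDiffAt ℝ k b x)
    (hA : ContDiffAt ℝ k A x) : ContDiffAt ℝ k (fun y ↦ pullForm (b y) (A y)) x := by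
  have h1 : ContDiffAt ℝ k (fun y ↦ (ContinuousLinearMap.compL ℝ (Euc n) (Euc n) ℝ).flip (A y)) x :=
    (ContinuousLinearMap.contDiff (𝕜 := ℝ)
      (ContinuousLinearMap.compL ℝ (Euc n) (Euc n) ℝ).flip).contDiffAt.comp x hA
  exact h1.clm_comp (hb.clm_comp hA)

/-- The pullback of a metric by a map. -/
def pullMetric (g : Euc n → Bilin n) (φ : Euc n → Euc n) (w : Euc n) : Bilin n :=
  pullForm (g (φ w)) (fderiv ℝ φ w)

lemma isometryAt_pullMetric {g : Euc n → Bilin n} {φ : Euc n → Euc n} {w : Euc n}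
    (hg : MetricAt g (φ w)) (hφ : ∀ᶠ y in 𝓝 w, ContDiffAt ℝ ∞ φ y)
    (hinj : ∀ᶠ y in 𝓝 w, Function.Injective (fderiv ℝ φ y)) :
    IsometryAt (pullMetric g φ) g φ w := by
  have hg' : ∀ᶠ y in 𝓝 w, MetricAt g (φ y) :=
    hφ.self_of_nhds.continuousAt.eventually hg.eventually
  refine ⟨⟨?_, ?_, ?_⟩, hg, hφ, Eventually.of_forall fun y u v ↦ rfl⟩
  · filter_upwards [hg', hφ] with y h1 h2
    exact contDiffAt_pullForm (h1.contDiffAt.comp y h2) (h2.fderiv_right (by simp))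
  · filter_upwards [hg'] with y h1 u v
    exact h1.symm_apply _ _
  · filter_upwards [hg', hinj] with y h1 h2 u hu
    refine h1.pos.self_of_nhds _ fun h0 ↦ hu (h2 ?_)
    exact (h0 : fderiv ℝ φ y u = 0).trans (map_zero _).symm

/-- A smooth family `p ↦ e (p, ·)` of normal coordinates centered at the points `p` of a ball. -/
structure NormalFamily (g : Euc n → Bilin n) (y₀ : Euc n) (δ : ℝ) (e : Euc n × Euc n → Euc n) :
    Prop where
  pos : 0 < δ
  smooth : ContDiffOn ℝ ∞ e (ball y₀ δ ×ˢ ball 0 δ)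
  zero : ∀ p ∈ ball y₀ δ, e (p, 0) = p
  fderiv_zero : ∀ p ∈ ball y₀ δ, fderiv ℝ (fun w ↦ e (p, w)) 0 = ContinuousLinearMap.id ℝ (Euc n)
  injOn : ∀ p ∈ ball y₀ δ, InjOn (fun w ↦ e (p, w)) (ball 0 δ)
  isometryAt : ∀ p ∈ ball y₀ δ, ∀ w ∈ ball (0 : Euc n) δ,
    IsometryAt (pullMetric g fun w ↦ e (p, w)) g (fun w ↦ e (p, w)) w
  normal : ∀ p ∈ ball y₀ δ, NormalMetric (pullMetric g fun w ↦ e (p, w)) δ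

/-- A map along which straight lines through the origin are geodesics pulls the metric back to
a form with the radial identity. -/
lemma IsometryAt.radial {g' g : Euc n → Bilin n} {φ : Euc n → Euc n} {w : Euc n}
    (hI : IsometryAt g' g φ w)
    (hode : fderiv ℝ (fderiv ℝ φ) w w w
      = - chrMap g (φ w) (fderiv ℝ φ w w) (fderiv ℝ φ w w)) (u : Euc n) :
    2 * fderiv ℝ g' w w w u = fderiv ℝ g' w u w w := by
  have hm := hI.right
  have hk := hm.koszul (fderiv ℝ φ w w) (fderiv ℝ φ w w) (fderiv ℝ φ w u)
  rw [hI.fderiv_metric, hI.fderiv_metric, hode, hI.snd_symm u w]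
  simp only [neg_apply, map_neg]
  rw [hm.symm_apply (fderiv ℝ (fderiv ℝ φ) w w u)]
  linarith

theorem exists_normalFamily {g : Euc n → Bilin n} {y₀ : Euc n} (hg : MetricAt g y₀)
    {V : Set (Euc n)} (hV : V ∈ 𝓝 y₀) :
    ∃ δ e, NormalFamily g y₀ δ e ∧ ∀ p ∈ ball y₀ δ, ∀ w ∈ ball (0 : Euc n) δ, e (p, w) ∈ V := by
  obtain ⟨B, hB, hBeq⟩ := exists_contDiff_eventuallyEq (f := fun y ↦ - chrMap g y) (a := y₀)
    (hg.eventually.mono fun y hy ↦ hy.contDiffAt_chrMap.neg)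
  have hW : V ∩ {y | MetricAt g y ∧ B y = - chrMap g y} ∈ 𝓝 y₀ :=
    inter_mem hV (hg.eventually.and hBeq)
  obtain ⟨δ₀, hδ₀, e, hsm, he⟩ := exists_expMap hB y₀ hW
  have hsmp : ∀ p ∈ ball y₀ δ₀, ContDiffOn ℝ ∞ (fun w ↦ e (p, w)) (ball 0 δ₀) := fun p hp ↦
    hsm.comp (contDiff_prodMk_right p).contDiffOn fun w hw ↦ ⟨hp, hw⟩
  obtain ⟨δ, hδ, hle, hinj⟩ := exists_injOn_fiber hδ₀ hsm (fun p hp ↦ (he p hp).1)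
    (he y₀ (mem_ball_self hδ₀)).2.1
  have hp₀ : ∀ p ∈ ball y₀ δ, p ∈ ball y₀ δ₀ := fun p hp ↦ ball_subset_ball hle hp
  have hw₀ : ∀ w ∈ ball (0 : Euc n) δ, w ∈ ball (0 : Euc n) δ₀ :=
    fun w hw ↦ ball_subset_ball hle hw
  have hiso : ∀ p ∈ ball y₀ δ, ∀ w ∈ ball (0 : Euc n) δ,
      IsometryAt (pullMetric g fun w ↦ e (p, w)) g (fun w ↦ e (p, w)) w := by
    intro p hp w hw
    refine isometryAt_pullMetric ((he p (hp₀ p hp)).2.2 w (hw₀ w hw)).1.2.1 ?_ ?_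
    · filter_upwards [isOpen_ball.mem_nhds hw] with y hy
      exact (hsmp p (hp₀ p hp)).contDiffAt (isOpen_ball.mem_nhds (hw₀ y hy))
    · filter_upwards [isOpen_ball.mem_nhds hw] with y hy
      exact (hinj p hp).2 y hy
  refine ⟨δ, e, ⟨hδ, hsm.mono fun x hx ↦ ⟨hp₀ _ hx.1, hw₀ _ hx.2⟩,
    fun p hp ↦ (he p (hp₀ p hp)).1, fun p hp ↦ (he p (hp₀ p hp)).2.1, fun p hp ↦ (hinj p hp).1,
    hiso, fun p hp ↦
    ⟨hδ, fun w hw ↦ (hiso p hp w hw).left, fun w hw u ↦ ?_⟩⟩, fun p hp w hw ↦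
    ((he p (hp₀ p hp)).2.2 w (hw₀ w hw)).1.1⟩
  obtain ⟨⟨-, -, hBy⟩, hode⟩ := (he p (hp₀ p hp)).2.2 w (hw₀ w hw)
  refine (hiso p hp w hw).radial ?_ u
  rw [hode, hBy]
  rfl

end Pullback

end

section

open Set Filter Topology Metric

variable {n : ℕ}

lemma NormalMetric.mono {g : Euc n → Bilin n} {δ δ' : ℝ} (h : NormalMetric g δ) (h0 : 0 < δ')
    (hle : δ' ≤ δ) : NormalMetric g δ' :=
  ⟨h0, fun w hw ↦ h.metricAt w (ball_subset_ball hle hw),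
    fun w hw ↦ h.radial w (ball_subset_ball hle hw)⟩

/-- The Christoffel symbols of normal coordinates vanish on radial vectors. -/
lemma NormalMetric.chrMap_ray {g : Euc n → Bilin n} {δ : ℝ} (h : NormalMetric g δ) {w : Euc n}
    {t : ℝ} (ht : t • w ∈ ball (0 : Euc n) δ) : chrMap g (t • w) w w = 0 := by
  rcases eq_or_ne t 0 with rfl | h0
  · simp [h.chrMap_zero]
  · have hm := h.metricAt _ ht
    refine hm.eq_zero_of_forall fun u ↦ ?_
    have h1 := hm.koszul w w u
    have h2 := h.radial_ray ht h0 u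
    linarith

/-- A continuous field of positive definite forms is locally uniformly positive definite. -/
lemma MetricAt.exists_lower_bound {g : Euc n → Bilin n} {a : Euc n} (h : MetricAt g a) :
    ∃ m > 0, ∀ᶠ y in 𝓝 a, ∀ u, m * ‖u‖ ^ 2 ≤ g y u u := by
  obtain ⟨m, hm, hma⟩ : ∃ m > 0, ∀ u ∈ sphere (0 : Euc n) 1, m ≤ g a u u := by
    rcases (sphere (0 : Euc n) 1).eq_empty_or_nonempty with he | hne
    · exact ⟨1, one_pos, by simp [he]⟩
    · obtain ⟨u₀, hu₀, hmin⟩ := (isCompact_sphere (0 : Euc n) 1).exists_isMinOn hne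
        (f := fun u ↦ g a u u) (by fun_prop)
      refine ⟨g a u₀ u₀, h.pos.self_of_nhds u₀ ?_, fun u hu ↦ hmin hu⟩
      rintro rfl
      simp at hu₀
  refine ⟨m / 2, by positivity, ?_⟩
  have hc : ∀ᶠ y in 𝓝 a, ‖g y - g a‖ < m / 2 := by
    have := h.contDiffAt.continuousAt.sub (continuousAt_const (y := g a))
    have h2 := this.norm
    have h3 : Tendsto (fun y ↦ ‖g y - g a‖) (𝓝 a) (𝓝 0) := by simpa [ContinuousAt] using h2
    exact h3.eventually_lt_const (by positivity)
  filter_upwards [hc] with y hy u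
  rcases eq_or_ne u 0 with rfl | hu
  · simp
  have hu' : 0 < ‖u‖ := norm_pos_iff.2 hu
  have h1 := hma (‖u‖⁻¹ • u) (by simp [norm_smul, hu'.ne'])
  simp only [map_smul, smul_apply, smul_eq_mul] at h1
  have h1' : m * ‖u‖ ^ 2 ≤ g a u u := by
    have := mul_le_mul_of_nonneg_right h1 (sq_nonneg ‖u‖)
    calc _ ≤ _ := this
      _ = _ := by field_simp
  have h2 : |(g y - g a) u u| ≤ m / 2 * ‖u‖ ^ 2 := by
    calc |(g y - g a) u u| ≤ ‖g y - g a‖ * ‖u‖ * ‖u‖ := (g y - g a).le_opNorm₂ u u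
      _ ≤ m / 2 * ‖u‖ * ‖u‖ := by gcongr
      _ = _ := by ring
  have h3 := (abs_le.1 h2).1
  simp only [sub_apply] at h3
  linarith

lemma contDiffOn_normalLap_family {X : Type*} [NormedAddCommGroup X] [NormedSpace ℝ X]
    {G : X × Euc n → Bilin n} {U : Set (X × Euc n)} (hU : IsOpen U) (hG : ContDiffOn ℝ ∞ G U)
    (hu : ∀ x ∈ U, IsUnit (gram (fun w ↦ G (x.1, w)) x.2).det) :
    ContDiffOn ℝ ∞ (fun x ↦ normalLap (fun w ↦ G (x.1, w)) x.2) U := by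
  intro x hx
  refine ContDiffAt.contDiffWithinAt ?_
  have hf := (contDiffOn_fderiv_fiber hU hG).contDiffAt (hU.mem_nhds hx)
  have hG' := hG.contDiffAt (hU.mem_nhds hx)
  refine contDiffAt_const.add (ContDiffAt.sum fun i _ ↦ ContDiffAt.sum fun j _ ↦
    ContDiffAt.mul (contDiffAt_matrix_inv (G := fun x : X × Euc n ↦ gram (fun w ↦ G (x.1, w)) x.2)
      (fun i j ↦ ?_) (hu x hx) i j)
      (((hf.clm_apply contDiffAt_snd).clm_apply contDiffAt_const).clm_apply contDiffAt_const))
  exact (hG'.clm_apply contDiffAt_const).clm_apply contDiffAt_const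

namespace NormalFamily

variable {g : Euc n → Bilin n} {y₀ : Euc n} {δ : ℝ} {e : Euc n × Euc n → Euc n}

lemma mono (h : NormalFamily g y₀ δ e) {δ' : ℝ} (h0 : 0 < δ') (hle : δ' ≤ δ) :
    NormalFamily g y₀ δ' e where
  pos := h0
  smooth := h.smooth.mono (prod_mono (ball_subset_ball hle) (ball_subset_ball hle))
  zero p hp := h.zero p (ball_subset_ball hle hp)
  fderiv_zero p hp := h.fderiv_zero p (ball_subset_ball hle hp)
  injOn p hp := (h.injOn p (ball_subset_ball hle hp)).mono (ball_subset_ball hle)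
  isometryAt p hp w hw := h.isometryAt p (ball_subset_ball hle hp) w (ball_subset_ball hle hw)
  normal p hp := (h.normal p (ball_subset_ball hle hp)).mono h0 hle

lemma isOpen_prod (_ : NormalFamily g y₀ δ e) : IsOpen (ball y₀ δ ×ˢ ball (0 : Euc n) δ) :=
  isOpen_ball.prod isOpen_ball

lemma pullMetric_zero (h : NormalFamily g y₀ δ e) {p : Euc n} (hp : p ∈ ball y₀ δ) :
    pullMetric g (fun w ↦ e (p, w)) 0 = g p := by
  ext u v
  simp [pullMetric, h.zero p hp, h.fderiv_zero p hp]

lemma contDiffOn_pullMetric (h : NormalFamily g y₀ δ e) :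
    ContDiffOn ℝ ∞ (fun x : Euc n × Euc n ↦ pullMetric g (fun w ↦ e (x.1, w)) x.2)
      (ball y₀ δ ×ˢ ball 0 δ) := by
  intro x hx
  refine ContDiffAt.contDiffWithinAt ?_
  have hU := h.isOpen_prod.mem_nhds hx
  have h1 : ContDiffAt ℝ ∞ e x := h.smooth.contDiffAt hU
  have h2 := (contDiffOn_fderiv_fiber h.isOpen_prod h.smooth).contDiffAt hU
  have h3 : ContDiffAt ℝ ∞ g (e x) := (h.isometryAt x.1 hx.1 x.2 hx.2).right.contDiffAt
  exact contDiffAt_pullForm (h3.comp x h1) h2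

lemma contDiffOn_normalLap (h : NormalFamily g y₀ δ e) :
    ContDiffOn ℝ ∞ (fun x : Euc n × Euc n ↦ normalLap (pullMetric g (fun w ↦ e (x.1, w))) x.2)
      (ball y₀ δ ×ˢ ball 0 δ) :=
  contDiffOn_normalLap_family
    (G := fun x : Euc n × Euc n ↦ pullMetric g (fun w ↦ e (x.1, w)) x.2) h.isOpen_prod
    h.contDiffOn_pullMetric fun x hx ↦ (h.isometryAt x.1 hx.1 x.2 hx.2).left.isUnit_det_gram

end NormalFamily

/-- Normal coordinates centered at the points near `y₀`, with uniform constants. -/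
structure GoodFamily (g : Euc n → Bilin n) (y₀ : Euc n) (δ : ℝ) (e : Euc n × Euc n → Euc n)
    (m C : ℝ) : Prop extends NormalFamily g y₀ δ e where
  m_pos : 0 < m
  C_pos : 0 < C
  lower : ∀ p ∈ ball y₀ δ, ∀ u, m * ‖u‖ ^ 2 ≤ g p u u
  cubic : ∀ p ∈ ball y₀ δ, ∀ w ∈ ball (0 : Euc n) δ,
    |normalLap (pullMetric g fun w ↦ e (p, w)) w - 2 * n
      + 2 / 3 * ric (pullMetric g fun w ↦ e (p, w)) 0 w w| ≤ C * ‖w‖ ^ 3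
  quadratic : ∀ p ∈ ball y₀ δ, ∀ w ∈ ball (0 : Euc n) δ,
    |normalLap (pullMetric g fun w ↦ e (p, w)) w - 2 * n| ≤ C * ‖w‖ ^ 2

theorem exists_goodFamily {g : Euc n → Bilin n} {y₀ : Euc n} (hg : MetricAt g y₀)
    {V : Set (Euc n)} (hV : V ∈ 𝓝 y₀) :
    ∃ δ e m C, GoodFamily g y₀ δ e m C ∧
      ∀ p ∈ ball y₀ δ, ∀ w ∈ ball (0 : Euc n) δ, e (p, w) ∈ V := by
  obtain ⟨δ, e, h, he⟩ := exists_normalFamily hg hV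
  obtain ⟨m, hm, hlow⟩ := hg.exists_lower_bound
  obtain ⟨R, hR, hlow⟩ := Metric.eventually_nhds_iff_ball.1 hlow
  obtain ⟨C, hC, hT⟩ := exists_taylor_bound h.pos h.contDiffOn_normalLap
  have hδ := h.pos
  have hle : min (δ / 2) R ≤ δ / 2 := min_le_left _ _
  have h' : min (δ / 2) R ≤ δ := by linarith
  have hT' : ∀ p ∈ ball y₀ (min (δ / 2) R), ∀ w ∈ ball (0 : Euc n) (min (δ / 2) R), _ :=
    fun p hp w hw ↦ hT p (ball_subset_closedBall (ball_subset_ball hle hp)) w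
      (ball_subset_closedBall (ball_subset_ball hle hw))
      ((h.normal p (ball_subset_ball h' hp)).deriv_normalLap_ray w).2.1
  refine ⟨min (δ / 2) R, e, m, C, ⟨h.mono (lt_min (by linarith) hR) h', hm, hC,
    fun p hp ↦ hlow p (ball_subset_ball (min_le_right _ _) hp), fun p hp w hw ↦ ?_,
    fun p hp w hw ↦ ?_⟩,
    fun p hp w hw ↦ he p (ball_subset_ball h' hp) w (ball_subset_ball h' hw)⟩
  · have h1 := (hT' p hp w hw).1
    obtain ⟨h2, -, h3⟩ := (h.normal p (ball_subset_ball h' hp)).deriv_normalLap_ray w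
    simp only [h2, h3] at h1
    convert h1 using 2
    ring
  · have h1 := (hT' p hp w hw).2
    obtain ⟨h2, -, h3⟩ := (h.normal p (ball_subset_ball h' hp)).deriv_normalLap_ray w
    simpa only [h2] using h1

end

section

open Set Filter Topology Metric

variable {n : ℕ} {M : Type*} [TopologicalSpace M] [ChartedSpace (Euc n) M]
  [RiemannianBundle (fun x : M ↦ TangentSpace (𝓡 n) x)]

/-- The scalar product of two vectors of the model space, seen as tangent vectors at `x`. -/
def ip (x : M) (u v : Euc n) : ℝ :=
  inner ℝ (show TangentSpace (𝓡 n) x from u) (show TangentSpace (𝓡 n) x from v)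

lemma norm_sq_eq_ip (x : M) (u : TangentSpace (𝓡 n) x) : ‖u‖ ^ 2 = ip x u u :=
  (real_inner_self_eq_norm_sq u).symm

lemma ip_comm (x : M) (u v : Euc n) : ip x u v = ip x v u :=
  real_inner_comm (F := TangentSpace (𝓡 n) x) _ _

lemma ip_add_left (x : M) (u u' v : Euc n) : ip x (u + u') v = ip x u v + ip x u' v :=
  inner_add_left (E := TangentSpace (𝓡 n) x) _ _ _

lemma ip_smul_left (x : M) (c : ℝ) (u v : Euc n) : ip x (c • u) v = c * ip x u v :=
  real_inner_smul_left (F := TangentSpace (𝓡 n) x) _ _ _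

lemma ip_add_right (x : M) (u v v' : Euc n) : ip x u (v + v') = ip x u v + ip x u v' :=
  inner_add_right (E := TangentSpace (𝓡 n) x) _ _ _

lemma ip_smul_right (x : M) (c : ℝ) (u v : Euc n) : ip x u (c • v) = c * ip x u v :=
  real_inner_smul_right (F := TangentSpace (𝓡 n) x) _ _ _

lemma ip_self_pos (x : M) {u : Euc n} (hu : u ≠ 0) : 0 < ip x u u :=
  (real_inner_self_pos (F := TangentSpace (𝓡 n) x)).2 hu

/-- The derivative of a parametrization of the manifold, with values in the model space. -/
def dparam (φ : Euc n → M) (w : Euc n) : Euc n →L[ℝ] Euc n :=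
  mfderiv (𝓡 n) (𝓡 n) φ w

/-- The Riemannian metric in a parametrization of the manifold. -/
def paramMetric (φ : Euc n → M) (w : Euc n) : Bilin n :=
  ∑ i, ∑ j, ip (φ w) (dparam φ w (bv i)) (dparam φ w (bv j)) •
    (EuclideanSpace.proj i : Euc n →L[ℝ] ℝ).smulRight (EuclideanSpace.proj j : Euc n →L[ℝ] ℝ)

lemma paramMetric_apply (φ : Euc n → M) (w u v : Euc n) :
    paramMetric φ w u v = ip (φ w) (dparam φ w u) (dparam φ w v) := by
  have h0 : ∀ x : Euc n, ip (φ w) 0 x = 0 := fun x ↦ by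
    simpa using ip_smul_left (φ w) 0 0 x
  have h1 : ∀ x : Euc n, ip (φ w) x 0 = 0 := fun x ↦ by
    simpa using ip_smul_right (φ w) 0 x 0
  refine euc_induction (P := fun u ↦ paramMetric φ w u v = ip (φ w) (dparam φ w u) (dparam φ w v))
    ?_ (fun i ↦ ?_) (fun u u' hu hu' ↦ ?_) (fun c u hu ↦ ?_) u
  · simp [h0]
  · refine euc_induction
      (P := fun v ↦ paramMetric φ w (bv i) v = ip (φ w) (dparam φ w (bv i)) (dparam φ w v))
      ?_ (fun j ↦ ?_) (fun u u' hu hu' ↦ ?_) (fun c u hu ↦ ?_) v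
    · simp [h1]
    · simp [paramMetric, bv_apply]
    · simp only [map_add, ip_add_right, hu, hu']
    · simp only [map_smul, ip_smul_right, hu, smul_eq_mul]
  · simp only [map_add, add_apply, ip_add_left, hu, hu']
  · simp only [map_smul, smul_apply, ip_smul_left, hu, smul_eq_mul]

omit [RiemannianBundle (fun x : M ↦ TangentSpace (𝓡 n) x)] in
lemma dparam_congr {φ ψ : Euc n → M} {w : Euc n} (h : φ =ᶠ[𝓝 w] ψ) : dparam φ w = dparam ψ w :=
  h.mfderiv_eq

lemma paramMetric_congr {φ ψ : Euc n → M} {w : Euc n} (h : φ =ᶠ[𝓝 w] ψ) :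
    paramMetric φ w = paramMetric ψ w := by
  rw [paramMetric, paramMetric, dparam_congr h, h.self_of_nhds]

omit [RiemannianBundle (fun x : M ↦ TangentSpace (𝓡 n) x)] in
lemma dparam_comp {φ : Euc n → M} {ψ : Euc n → Euc n} {w : Euc n}
    (hφ : MDifferentiableAt (𝓡 n) (𝓡 n) φ (ψ w)) (hψ : DifferentiableAt ℝ ψ w) :
    dparam (φ ∘ ψ) w = (dparam φ (ψ w)).comp (fderiv ℝ ψ w) := by
  have := mfderiv_comp w hφ hψ.mdifferentiableAt
  rw [mfderiv_eq_fderiv] at this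
  exact this

lemma paramMetric_comp {φ : Euc n → M} {ψ : Euc n → Euc n} {w : Euc n}
    (hφ : MDifferentiableAt (𝓡 n) (𝓡 n) φ (ψ w)) (hψ : DifferentiableAt ℝ ψ w) :
    paramMetric (φ ∘ ψ) w = pullMetric (paramMetric φ) ψ w := by
  ext u v
  rw [paramMetric_apply, dparam_comp hφ hψ, pullMetric, pullForm_apply, paramMetric_apply]
  rfl

lemma gram_paramMetric (c : M) :
    gram (paramMetric (extChartAt (𝓡 n) c).symm) = metricMatrix c := by
  ext y i j
  rw [gram_apply, paramMetric_apply]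
  rfl

section Smooth

variable [IsManifold (𝓡 n) ∞ M]

omit [RiemannianBundle (fun x : M ↦ TangentSpace (𝓡 n) x)] in
lemma contMDiffAt_velocity {φ : Euc n → M} {w : Euc n}
    (hφ : ∀ᶠ y in 𝓝 w, ContMDiffAt (𝓡 n) (𝓡 n) ∞ φ y) (u : Euc n) :
    ContMDiffAt (𝓡 n) ((𝓡 n).prod 𝓘(ℝ, Euc n)) ∞
      (fun y ↦ (⟨φ y, mfderiv (𝓡 n) (𝓡 n) φ y u⟩ : TangentBundle (𝓡 n) M)) w := by
  obtain ⟨s, hs, hso, hws⟩ := _root_.eventually_nhds_iff.1 hφ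
  have h1 : ContMDiffOn (𝓡 n) (𝓡 n) ∞ φ s := fun y hy ↦ (hs y hy).contMDiffWithinAt
  have h2 := h1.contMDiffOn_tangentMapWithin (m := ∞) (by simp) hso.uniqueMDiffOn
  have h3 : ContMDiff (𝓡 n) ((𝓡 n).prod 𝓘(ℝ, Euc n)) ∞
      (fun y : Euc n ↦ (⟨y, u⟩ : TangentBundle (𝓡 n) (Euc n))) :=
    contMDiff_vectorSpace_iff_contDiff.2 (contDiff_const (c := u))
  have h4 := h2.comp h3.contMDiffOn (s := s) (fun y hy ↦ hy)
  refine (h4.contMDiffAt (hso.mem_nhds hws)).congr_of_eventuallyEq ?_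
  filter_upwards [hso.mem_nhds hws] with y hy
  simp [tangentMapWithin, mfderivWithin_of_isOpen hso hy]

variable [IsContMDiffRiemannianBundle (𝓡 n) ∞ (Euc n) (fun x : M ↦ TangentSpace (𝓡 n) x)]

lemma contDiffAt_paramMetric {φ : Euc n → M} {w : Euc n}
    (hφ : ∀ᶠ y in 𝓝 w, ContMDiffAt (𝓡 n) (𝓡 n) ∞ φ y) : ContDiffAt ℝ ∞ (paramMetric φ) w := by
  have h : ∀ i j, ContDiffAt ℝ ∞
      (fun y ↦ ip (φ y) (dparam φ y (bv i)) (dparam φ y (bv j))) w := fun i j ↦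
    ((contMDiffAt_velocity hφ (bv i)).inner_bundle (contMDiffAt_velocity hφ (bv j))).contDiffAt
  exact ContDiffAt.sum fun i _ ↦ ContDiffAt.sum fun j _ ↦ (h i j).smul contDiffAt_const

lemma metricAt_paramMetric {φ : Euc n → M} {w : Euc n}
    (hφ : ∀ᶠ y in 𝓝 w, ContMDiffAt (𝓡 n) (𝓡 n) ∞ φ y)
    (hinj : ∀ᶠ y in 𝓝 w, Function.Injective (dparam φ y)) : MetricAt (paramMetric φ) w := by
  refine ⟨?_, Eventually.of_forall fun y u v ↦ ?_, ?_⟩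
  · filter_upwards [hφ.eventually_nhds] with y hy using contDiffAt_paramMetric hy
  · rw [paramMetric_apply, paramMetric_apply, ip_comm]
  · filter_upwards [hinj] with y hy u hu
    rw [paramMetric_apply]
    exact ip_self_pos _ ((map_ne_zero_iff _ hy).2 hu)

end Smooth

end

section

open Set Filter Topology Metric

section Coordinates

variable {n : ℕ}

lemma partialDeriv_chr {g : Euc n → Bilin n} {y : Euc n} (hg : MetricAt g y) (k i j l : Fin n) :
    partialDeriv l (chr (gram g) k i j) y = fderiv ℝ (chrMap g) y (bv l) (bv i) (bv j) k := by
  have hd : DifferentiableAt ℝ (chrMap g) y := hg.contDiffAt_chrMap.differentiableAt (by simp)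
  have h1 : HasFDerivAt (chr (gram g) k i j) _ y :=
    ((EuclideanSpace.proj k : Euc n →L[ℝ] ℝ).hasFDerivAt.comp y
      ((hd.hasFDerivAt.clm_apply (hasFDerivAt_const (bv i) y)).clm_apply
        (hasFDerivAt_const (bv j) y))).congr_of_eventuallyEq
      (Eventually.of_forall fun z ↦ (chrMap_bv_apply g z i j k).symm)
  change fderiv ℝ _ y (bv l) = _
  rw [h1.fderiv]
  simp

lemma ric_bv {g : Euc n → Bilin n} {y : Euc n} (hg : MetricAt g y) (i j : Fin n) :
    ric g y (bv i) (bv j) =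
      ∑ k, (partialDeriv k (chr (gram g) k i j) y - partialDeriv j (chr (gram g) k i k) y)
        + ∑ k, ∑ l, (chr (gram g) k k l y * chr (gram g) l i j y
          - chr (gram g) k j l y * chr (gram g) l i k y) := by
  have h1 : ∀ (k m : Fin n) (u : Euc n),
      chrMap g y (bv m) u k = ∑ l, chr (gram g) k m l y * u l := fun k m u ↦ by
    rw [clm_apply_eq_sum (chrMap g y (bv m)) u]
    simp [chrMap_bv_apply, mul_comm]
  rw [ric, trace_eq_sum, ← Finset.sum_add_distrib]
  refine Finset.sum_congr rfl fun k _ ↦ ?_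
  rw [partialDeriv_chr hg, partialDeriv_chr hg, Finset.sum_sub_distrib]
  change curv g y (bv i) (bv j) (bv k) k = _
  simp only [curv, PiLp.add_apply, PiLp.sub_apply]
  rw [h1 k k, h1 k j]
  simp only [chrMap_bv_apply]
  ring

lemma ric_eq_sum (g : Euc n → Bilin n) (y v w : Euc n) :
    ric g y v w = ∑ i, ∑ j, ric g y (bv i) (bv j) * v i * w j := by
  have hadd : ∀ v v' w w' : Euc n, ric g y (v + v') w = ric g y v w + ric g y v' w ∧
      ric g y v (w + w') = ric g y v w + ric g y v w' := by
    intro v v' w w'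
    rw [ric, ric, ric, ric, ric, ← map_add, ← map_add]
    constructor <;> congr 1 <;> ext1 z
    · change curv g y (v + v') w z = curv g y v w z + curv g y v' w z
      simp only [curv, map_add, add_apply]
      abel
    · change curv g y v (w + w') z = curv g y v w z + curv g y v w' z
      simp only [curv, map_add, add_apply]
      abel
  have hsmul : ∀ (c : ℝ) (v w : Euc n), ric g y (c • v) w = c * ric g y v w ∧
      ric g y v (c • w) = c * ric g y v w := by
    intro c v w
    rw [ric, ric, ric, ← smul_eq_mul, ← map_smul]
    constructor <;> congr 1 <;> ext1 z
    · change curv g y (c • v) w z = c • curv g y v w z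
      simp only [curv, map_smul, smul_apply, smul_add, smul_sub]
    · change curv g y v (c • w) z = c • curv g y v w z
      simp only [curv, map_smul, smul_apply, smul_add, smul_sub]
  let L : Euc n →ₗ[ℝ] Euc n →ₗ[ℝ] ℝ := LinearMap.mk₂ ℝ (ric g y)
    (fun v v' w ↦ (hadd v v' w 0).1) (fun c v w ↦ (hsmul c v w).1)
    (fun v w w' ↦ (hadd v 0 w w').2) (fun c v w ↦ (hsmul c v w).2)
  change L v w = ∑ i, ∑ j, L (bv i) (bv j) * v i * w j
  conv_lhs => rw [← sum_smul_bv v, ← sum_smul_bv w]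
  simp only [map_sum, map_smul, LinearMap.sum_apply, LinearMap.smul_apply, smul_eq_mul,
    Finset.mul_sum]
  rw [Finset.sum_comm]
  exact Finset.sum_congr rfl fun i _ ↦ Finset.sum_congr rfl fun j _ ↦ by ring

lemma ric_smul_smul (g : Euc n → Bilin n) (y w : Euc n) (c : ℝ) :
    ric g y (c • w) (c • w) = ric g y w w * c ^ 2 := by
  rw [ric_eq_sum, ric_eq_sum g y w w, Finset.sum_mul]
  refine Finset.sum_congr rfl fun i _ ↦ ?_
  rw [Finset.sum_mul]
  refine Finset.sum_congr rfl fun j _ ↦ ?_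
  simp only [PiLp.smul_apply, smul_eq_mul]
  ring

lemma lap_eq_sum_partialDeriv {g : Euc n → Bilin n} {f : Euc n → ℝ} {a : Euc n}
    (hf : ContDiffAt ℝ 2 f a) :
    lap g f a = ∑ i, ∑ j, (gram g a)⁻¹ i j * (partialDeriv i (partialDeriv j f) a
      - ∑ k, chr (gram g) k i j a * partialDeriv k f a) := by
  have hd : DifferentiableAt ℝ (fderiv ℝ f) a :=
    (hf.fderiv_right (m := 1) (by norm_num [one_add_one_eq_two])).differentiableAt (by simp)
  refine Finset.sum_congr rfl fun i _ ↦ Finset.sum_congr rfl fun j _ ↦ ?_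
  congr 1
  have h1 : HasFDerivAt (partialDeriv j f) _ a :=
    hd.hasFDerivAt.clm_apply (hasFDerivAt_const (EuclideanSpace.single j (1 : ℝ)) a)
  have h2 : partialDeriv i (partialDeriv j f) a = fderiv ℝ (fderiv ℝ f) a (bv i) (bv j) := by
    change fderiv ℝ (partialDeriv j f) a (bv i) = _
    rw [h1.fderiv]
    simp [bv]
  rw [hess, h2, chrMap_bv]
  simp only [map_sum, map_smul, smul_eq_mul]
  rfl

end Coordinates

section Charts

variable {n : ℕ} {M : Type*} [TopologicalSpace M] [ChartedSpace (Euc n) M] [IsManifold (𝓡 n) ∞ M]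

lemma eventually_contMDiffAt_symm {c : M} {y : Euc n} (hy : y ∈ (extChartAt (𝓡 n) c).target) :
    ∀ᶠ z in 𝓝 y, ContMDiffAt (𝓡 n) (𝓡 n) ∞ (extChartAt (𝓡 n) c).symm z := by
  have ho := isOpen_extChartAt_target (I := 𝓡 n) c
  filter_upwards [ho.mem_nhds hy] with z hz
  exact (contMDiffOn_extChartAt_symm c).contMDiffAt (ho.mem_nhds hz)

lemma injective_dparam_symm {c : M} {y : Euc n} (hy : y ∈ (extChartAt (𝓡 n) c).target) :
    Function.Injective (dparam (extChartAt (𝓡 n) c).symm y) := by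
  have h := isInvertible_mfderivWithin_extChartAt_symm hy
  rw [ModelWithCorners.range_eq_univ, mfderivWithin_univ] at h
  exact h.injective

lemma eventually_injective_dparam_symm {c : M} {y : Euc n}
    (hy : y ∈ (extChartAt (𝓡 n) c).target) :
    ∀ᶠ z in 𝓝 y, Function.Injective (dparam (extChartAt (𝓡 n) c).symm z) := by
  filter_upwards [(isOpen_extChartAt_target (I := 𝓡 n) c).mem_nhds hy] with z hz
  exact injective_dparam_symm hz

/-- The coordinate expression of a smooth parametrization is smooth. -/
lemma eventually_contDiffAt_coord {φ : Euc n → M} {w : Euc n} {c : M}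
    (hφ : ∀ᶠ y in 𝓝 w, ContMDiffAt (𝓡 n) (𝓡 n) ∞ φ y) (hc : φ w ∈ (chartAt (Euc n) c).source) :
    ∀ᶠ y in 𝓝 w, ContDiffAt ℝ ∞ (extChartAt (𝓡 n) c ∘ φ) y := by
  have h1 : ∀ᶠ y in 𝓝 w, φ y ∈ (chartAt (Euc n) c).source :=
    hφ.self_of_nhds.continuousAt.eventually ((chartAt (Euc n) c).open_source.mem_nhds hc)
  filter_upwards [hφ, h1] with y hy hy'
  exact ((contMDiffAt_extChartAt' hy').comp y hy).contDiffAt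

omit [IsManifold (𝓡 n) ∞ M] in
lemma eventuallyEq_symm_comp {X : Type*} [TopologicalSpace X] {φ : X → M} {w : X} {c : M}
    (hφ : ContinuousAt φ w) (hc : φ w ∈ (chartAt (Euc n) c).source) :
    (extChartAt (𝓡 n) c).symm ∘ (extChartAt (𝓡 n) c ∘ φ) =ᶠ[𝓝 w] φ := by
  have h1 : ∀ᶠ y in 𝓝 w, φ y ∈ (chartAt (Euc n) c).source :=
    hφ.eventually ((chartAt (Euc n) c).open_source.mem_nhds hc)
  filter_upwards [h1] with y hy
  exact (extChartAt (𝓡 n) c).left_inv (by rwa [extChartAt_source])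

variable [RiemannianBundle (fun x : M ↦ TangentSpace (𝓡 n) x)]
  [IsContMDiffRiemannianBundle (𝓡 n) ∞ (Euc n) (fun x : M ↦ TangentSpace (𝓡 n) x)]

/-- The metric in the preferred chart around `c`. -/
abbrev chartMetric (c : M) : Euc n → Bilin n := paramMetric (extChartAt (𝓡 n) c).symm

lemma metricAt_chartMetric {c : M} {y : Euc n} (hy : y ∈ (extChartAt (𝓡 n) c).target) :
    MetricAt (chartMetric c) y :=
  metricAt_paramMetric (eventually_contMDiffAt_symm hy) (eventually_injective_dparam_symm hy)

omit [IsManifold (𝓡 n) ∞ M]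
  [IsContMDiffRiemannianBundle (𝓡 n) ∞ (Euc n) (fun x : M ↦ TangentSpace (𝓡 n) x)] in
lemma christoffel_eq (c : M) (k i j : Fin n) :
    christoffel c k i j = chr (gram (chartMetric c)) k i j := by
  rw [gram_paramMetric]
  rfl

/-- `φ` is a smooth immersion near `w`. -/
structure ParamAt (φ : Euc n → M) (w : Euc n) : Prop where
  smooth : ∀ᶠ y in 𝓝 w, ContMDiffAt (𝓡 n) (𝓡 n) ∞ φ y
  injective : ∀ᶠ y in 𝓝 w, Function.Injective (dparam φ y)

/-- The change of coordinates between a parametrization and a chart is an isometry. -/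
theorem ParamAt.isometryAt {φ : Euc n → M} {w : Euc n} (h : ParamAt φ w) {c : M}
    (hc : φ w ∈ (chartAt (Euc n) c).source) :
    IsometryAt (paramMetric φ) (chartMetric c) (extChartAt (𝓡 n) c ∘ φ) w := by
  have hc' : φ w ∈ (extChartAt (𝓡 n) c).source := by rwa [extChartAt_source]
  have ht : (extChartAt (𝓡 n) c ∘ φ) w ∈ (extChartAt (𝓡 n) c).target :=
    (extChartAt (𝓡 n) c).map_source hc'
  have hsm := eventually_contDiffAt_coord h.smooth hc
  refine ⟨metricAt_paramMetric h.smooth h.injective, metricAt_chartMetric ht, hsm, ?_⟩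
  have h1 := (eventuallyEq_symm_comp h.smooth.self_of_nhds.continuousAt hc).eventually_nhds
  have h2 := hsm.self_of_nhds.continuousAt.eventually (eventually_contMDiffAt_symm ht)
  filter_upwards [h1, h2, hsm] with y hy1 hy2 hy3 u v
  rw [← paramMetric_congr hy1, paramMetric_comp (hy2.mdifferentiableAt (by simp))
    (hy3.differentiableAt (by simp))]
  rfl

/-- The Laplacian can be computed in any parametrization. -/
theorem ParamAt.laplaceBeltrami_eq {φ : Euc n → M} {w : Euc n} (h : ParamAt φ w) {f : M → ℝ}
    (hf : ContMDiffAt (𝓡 n) 𝓘(ℝ, ℝ) ∞ f (φ w)) :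
    laplaceBeltrami (n := n) f (φ w) = lap (paramMetric φ) (f ∘ φ) w := by
  have hc : φ w ∈ (chartAt (Euc n) (φ w)).source := mem_chart_source _ _
  have hI := h.isometryAt hc
  have ha : extChartAt (𝓡 n) (φ w) (φ w) ∈ (extChartAt (𝓡 n) (φ w)).target :=
    mem_extChartAt_target _
  have hf' : ContDiffAt ℝ ∞ (f ∘ (extChartAt (𝓡 n) (φ w)).symm) (extChartAt (𝓡 n) (φ w) (φ w)) := by
    refine ContMDiffAt.contDiffAt (ContMDiffAt.comp _ ?_
      (eventually_contMDiffAt_symm ha).self_of_nhds)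
    rwa [extChartAt_to_inv]
  have hf2 := hf'.of_le two_le_infty
  have h1 := hI.lap_law (f := f ∘ (extChartAt (𝓡 n) (φ w)).symm) hf2
  have h2 : (f ∘ (extChartAt (𝓡 n) (φ w)).symm) ∘ extChartAt (𝓡 n) (φ w) ∘ φ =ᶠ[𝓝 w] f ∘ φ :=
    (eventuallyEq_symm_comp h.smooth.self_of_nhds.continuousAt hc).fun_comp f
  have h3 : lap (paramMetric φ) (f ∘ φ) w = lap (paramMetric φ)
      ((f ∘ (extChartAt (𝓡 n) (φ w)).symm) ∘ extChartAt (𝓡 n) (φ w) ∘ φ) w := by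
    simp only [lap, hess, h2.fderiv_eq, h2.fderiv.fderiv_eq]
  rw [h3, h1, Function.comp_apply, lap_eq_sum_partialDeriv hf2, gram_paramMetric]
  rfl

omit [IsManifold (𝓡 n) ∞ M]
  [IsContMDiffRiemannianBundle (𝓡 n) ∞ (Euc n) (fun x : M ↦ TangentSpace (𝓡 n) x)] in
lemma ricci_eq_ric {p : M} (hg : MetricAt (chartMetric p) (extChartAt (𝓡 n) p p))
    (v w : TangentSpace (𝓡 n) p) :
    ricci p v w = ric (chartMetric p) (extChartAt (𝓡 n) p p) (components p v) (components p w) := by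
  rw [ric_eq_sum]
  refine Finset.sum_congr rfl fun i _ ↦ Finset.sum_congr rfl fun j _ ↦ ?_
  rw [ric_bv hg]
  simp only [← christoffel_eq]
  rfl

/-- The Ricci curvature can be computed in any parametrization. -/
theorem ParamAt.ricci_eq {φ : Euc n → M} {w : Euc n} (h : ParamAt φ w) (u v : Euc n) :
    ricci (φ w) (mfderiv (𝓡 n) (𝓡 n) φ w u) (mfderiv (𝓡 n) (𝓡 n) φ w v) =
      ric (paramMetric φ) w u v := by
  have hI := h.isometryAt (mem_chart_source (Euc n) (φ w))
  have h1 : ∀ u : Euc n, components (φ w) (mfderiv (𝓡 n) (𝓡 n) φ w u) =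
      fderiv ℝ (extChartAt (𝓡 n) (φ w) ∘ φ) w u := fun u ↦ by
    have h2 := mfderiv_comp w (contMDiffAt_extChartAt (I := 𝓡 n) (n := ∞)
      (x := φ w)|>.mdifferentiableAt (by simp)) (h.smooth.self_of_nhds.mdifferentiableAt (by simp))
    rw [mfderiv_eq_fderiv] at h2
    rw [h2]
    rfl
  rw [hI.ric_law, ricci_eq_ric hI.right, h1, h1]
  rfl

/-- The geodesic equation can be written in any parametrization. -/
theorem ParamAt.geodesic_iff {φ : Euc n → M} {c : ℝ → Euc n} {t : ℝ} (h : ParamAt φ (c t))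
    {γ : ℝ → M} (hc : ContDiffAt ℝ 2 c t) (hγ : γ =ᶠ[𝓝 t] φ ∘ c) :
    (∀ k : Fin n,
      let u : Fin n → ℝ → ℝ := fun i τ ↦ (extChartAt (𝓡 n) (γ t) (γ τ) : Euc n) i
      deriv (deriv (u k)) t
        + ∑ i, ∑ j, christoffel (γ t) k i j (extChartAt (𝓡 n) (γ t) (γ t))
            * deriv (u i) t * deriv (u j) t = 0) ↔
      deriv (deriv c) t + chrMap (paramMetric φ) (c t) (deriv c t) (deriv c t) = 0 := by
  have hγt : γ t = φ (c t) := hγ.self_of_nhds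
  have hI := h.isometryAt (mem_chart_source (Euc n) (φ (c t)))
  have hlaw := hI.geodesic_law hc rfl
  set Ψ : Euc n → Euc n := extChartAt (𝓡 n) (φ (c t)) ∘ φ with hΨ
  have hC : ContDiffAt ℝ 2 (Ψ ∘ c) t :=
    (hI.smooth.self_of_nhds.of_le two_le_infty).comp t hc
  have hu : ∀ i, (fun τ ↦ (extChartAt (𝓡 n) (γ t) (γ τ) : Euc n) i) =ᶠ[𝓝 t]
      fun τ ↦ (Ψ ∘ c) τ i := fun i ↦ by
    filter_upwards [hγ] with τ hτ
    rw [hγt, hτ]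
    rfl
  have hproj : ∀ (f : ℝ → Euc n) (s : ℝ) (i : Fin n), DifferentiableAt ℝ f s →
      deriv (fun τ ↦ f τ i) s = deriv f s i := fun f s i hf ↦
    ((EuclideanSpace.proj i : Euc n →L[ℝ] ℝ).hasFDerivAt.comp_hasDerivAt s hf.hasDerivAt).deriv
  have hd1 : ∀ i, deriv (fun τ ↦ (extChartAt (𝓡 n) (γ t) (γ τ) : Euc n) i) =ᶠ[𝓝 t]
      fun τ ↦ deriv (Ψ ∘ c) τ i := fun i ↦ by
    filter_upwards [(hu i).eventually_nhds, hC.eventually (by simp)] with τ h1 h2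
    rw [Filter.EventuallyEq.deriv_eq h1, hproj _ _ _ (h2.differentiableAt (by simp))]
  have hd2 : ∀ i, deriv (deriv fun τ ↦ (extChartAt (𝓡 n) (γ t) (γ τ) : Euc n) i) t =
      deriv (deriv (Ψ ∘ c)) t i := fun i ↦ by
    rw [(hd1 i).deriv_eq, hproj]
    have h3 : ContDiffAt ℝ 1 (deriv (Ψ ∘ c)) t := by
      have := (hC.fderiv_right (m := 1) (by norm_num [one_add_one_eq_two])).clm_apply
        (contDiffAt_const (c := (1 : ℝ)))
      simpa using this
    exact h3.differentiableAt (by simp)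
  have hsum : ∀ k, deriv (deriv fun τ ↦ (extChartAt (𝓡 n) (γ t) (γ τ) : Euc n) k) t
        + ∑ i, ∑ j, christoffel (γ t) k i j (extChartAt (𝓡 n) (γ t) (γ t))
            * deriv (fun τ ↦ (extChartAt (𝓡 n) (γ t) (γ τ) : Euc n) i) t
            * deriv (fun τ ↦ (extChartAt (𝓡 n) (γ t) (γ τ) : Euc n) j) t =
      (deriv (deriv (Ψ ∘ c)) t + chrMap (chartMetric (φ (c t))) (Ψ (c t)) (deriv (Ψ ∘ c) t)
        (deriv (Ψ ∘ c) t)) k := fun k ↦ by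
    rw [PiLp.add_apply, hd2 k, chrMap_apply]
    congr 1
    simp only [hγt, WithLp.ofLp_sum, Finset.sum_apply, PiLp.smul_apply, bv_apply, smul_eq_mul,
      mul_ite, mul_one, mul_zero, Finset.sum_ite_eq, Finset.mem_univ, if_true]
    refine Finset.sum_congr rfl fun i _ ↦ Finset.sum_congr rfl fun j _ ↦ ?_
    have e1 := (hd1 i).self_of_nhds
    have e2 := (hd1 j).self_of_nhds
    simp only [hγt] at e1 e2
    rw [e1, e2, christoffel_eq, hΨ, mul_assoc]
    rfl
  have hinj := hI.fderiv_injective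
  rw [← map_eq_zero_iff _ hinj, ← hlaw]
  constructor
  · intro H
    ext k
    rw [← hsum k]
    exact H k
  · intro H k
    exact (hsum k).trans (by rw [H]; rfl)

end Charts

end

section

open Set Filter Topology Metric

section Inverse

variable {n : ℕ} {M : Type*} [TopologicalSpace M] [ChartedSpace (Euc n) M] [IsManifold (𝓡 n) ∞ M]
  [RiemannianBundle (fun x : M ↦ TangentSpace (𝓡 n) x)]
  [IsContMDiffRiemannianBundle (𝓡 n) ∞ (Euc n) (fun x : M ↦ TangentSpace (𝓡 n) x)]

/-- A parametrization has a smooth local inverse. -/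
theorem ParamAt.exists_inverse {φ : Euc n → M} {w : Euc n} (h : ParamAt φ w) :
    ∃ ψ : M → Euc n, ψ (φ w) = w ∧ ContMDiffAt (𝓡 n) (𝓡 n) ∞ ψ (φ w) ∧
      ∀ᶠ y in 𝓝 (φ w), φ (ψ y) = y := by
  have hc : φ w ∈ (chartAt (Euc n) (φ w)).source := mem_chart_source _ _
  have hI := h.isometryAt hc
  set E := extChartAt (𝓡 n) (φ w) with hE
  obtain ⟨U, hU, hUo, hwU⟩ := _root_.eventually_nhds_iff.1 hI.smooth
  let A : Euc n ≃L[ℝ] Euc n :=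
    (LinearEquiv.ofInjectiveEndo (fderiv ℝ (E ∘ φ) w).toLinearMap
      hI.fderiv_injective).toContinuousLinearEquiv
  have hA : HasFDerivAt (E ∘ φ) (A : Euc n →L[ℝ] Euc n) w :=
    hI.differentiableAt.hasFDerivAt.congr_fderiv (by ext1 u; rfl)
  obtain ⟨e, hwe, -, hev, -, hsymm⟩ := exists_smooth_openPartialHomeomorph hUo hwU
    (fun y hy ↦ (hU y hy).contDiffWithinAt) hA
  have hEw : E (φ w) ∈ e.target := by
    have := e.map_source hwe
    rwa [hev] at this
  have hψw : e.symm (E (φ w)) = w := by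
    have := e.left_inv hwe
    rwa [hev] at this
  have hψ : ContMDiffAt (𝓡 n) (𝓡 n) ∞ (e.symm ∘ E) (φ w) :=
    ContMDiffAt.comp _ (hsymm.contDiffAt (e.open_target.mem_nhds hEw)).contMDiffAt
      contMDiffAt_extChartAt
  refine ⟨e.symm ∘ E, hψw, hψ, ?_⟩
  have h1 : ∀ᶠ y in 𝓝 (φ w), E y ∈ e.target :=
    (continuousAt_extChartAt (φ w)).eventually (e.open_target.mem_nhds hEw)
  have h2 : ∀ᶠ y in 𝓝 (φ w), y ∈ E.source := extChartAt_source_mem_nhds (I := 𝓡 n) (φ w)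
  have h3 : ∀ᶠ y in 𝓝 (φ w), φ ((e.symm ∘ E) y) ∈ E.source := by
    have hφc : ContinuousAt φ ((e.symm ∘ E) (φ w)) := by
      rw [Function.comp_apply, hψw]
      exact h.smooth.self_of_nhds.continuousAt
    have : ContinuousAt (fun y ↦ φ ((e.symm ∘ E) y)) (φ w) := hφc.comp hψ.continuousAt
    refine this.eventually ?_
    simp only [Function.comp_apply, hψw]
    exact extChartAt_source_mem_nhds (I := 𝓡 n) (φ w)
  filter_upwards [h1, h2, h3] with y hy1 hy2 hy3
  refine E.injOn hy3 hy2 ?_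
  have := e.right_inv hy1
  rwa [hev] at this

end Inverse

section Velocity

variable {n : ℕ} {M : Type*} [TopologicalSpace M] [ChartedSpace (Euc n) M]
  [RiemannianBundle (fun x : M ↦ TangentSpace (𝓡 n) x)]

omit [RiemannianBundle (fun x : M ↦ TangentSpace (𝓡 n) x)] in
/-- The velocity of a curve in terms of its expression in a parametrization. -/
lemma velocity_eq {φ : Euc n → M} {c : ℝ → Euc n} {γ : ℝ → M} {t : ℝ}
    (hφ : MDifferentiableAt (𝓡 n) (𝓡 n) φ (c t)) (hc : DifferentiableAt ℝ c t)
    (hγ : γ =ᶠ[𝓝 t] φ ∘ c) :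
    (mfderiv 𝓘(ℝ, ℝ) (𝓡 n) γ t (1 : ℝ) : Euc n) = dparam φ (c t) (deriv c t) := by
  have h1 : (mfderiv 𝓘(ℝ, ℝ) (𝓡 n) γ t : ℝ →L[ℝ] Euc n) =
      (mfderiv 𝓘(ℝ, ℝ) (𝓡 n) (φ ∘ c) t : ℝ →L[ℝ] Euc n) := hγ.mfderiv_eq
  have h2 := mfderiv_comp t hφ hc.mdifferentiableAt
  rw [mfderiv_eq_fderiv] at h2
  exact congrArg (fun L : ℝ →L[ℝ] Euc n ↦ L 1) (h1.trans h2)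

lemma norm_velocity_sq {φ : Euc n → M} {c : ℝ → Euc n} {γ : ℝ → M} {t : ℝ}
    (hφ : MDifferentiableAt (𝓡 n) (𝓡 n) φ (c t)) (hc : DifferentiableAt ℝ c t)
    (hγ : γ =ᶠ[𝓝 t] φ ∘ c) :
    ‖mfderiv 𝓘(ℝ, ℝ) (𝓡 n) γ t (1 : ℝ)‖ ^ 2 =
      paramMetric φ (c t) (deriv c t) (deriv c t) := by
  have h0 : γ t = φ (c t) := hγ.self_of_nhds
  rw [norm_sq_eq_ip, paramMetric_apply, ← velocity_eq hφ hc hγ, ← h0]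

lemma paramMetric_cauchy_schwarz (φ : Euc n → M) (w u v : Euc n) :
    paramMetric φ w u v ^ 2 ≤ paramMetric φ w u u * paramMetric φ w v v := by
  simp only [paramMetric_apply, sq]
  have := real_inner_mul_inner_self_le (F := TangentSpace (𝓡 n) (φ w)) (dparam φ w u)
    (dparam φ w v)
  exact this

end Velocity

end

section

open Set Filter Topology Metric

variable {n : ℕ} {M : Type*} [MetricSpace M] [ChartedSpace (Euc n) M]
  [RiemannianBundle (fun x : M ↦ TangentSpace (𝓡 n) x)]

/-- `φ` is a normal parametrization around `p`, on a ball which contains the closed ball of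
radius `a` of the metric at `p`. -/
structure NormalChart (p : M) (φ : Euc n → M) (δ a : ℝ) : Prop where
  a_pos : 0 < a
  zero : φ 0 = p
  param : ∀ w ∈ ball (0 : Euc n) δ, ParamAt φ w
  injOn : InjOn φ (ball 0 δ)
  normal : NormalMetric (paramMetric φ) δ
  mem_ball : ∀ w, paramMetric φ 0 w w ≤ a ^ 2 → w ∈ ball (0 : Euc n) δ

/-- The square of the radial coordinate in a normal chart, extended by a constant. -/
def radialSq (φ : Euc n → M) (a : ℝ) (y : M) : ℝ :=
  open scoped Classical in
  if y ∈ φ '' {w | paramMetric φ 0 w w < a ^ 2} then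
    sqNorm (paramMetric φ 0) (Function.invFunOn φ {w | paramMetric φ 0 w w < a ^ 2} y)
  else a ^ 2

lemma paramMetric_self_nonneg (φ : Euc n → M) (w u : Euc n) : 0 ≤ paramMetric φ w u u := by
  rw [paramMetric_apply]
  exact real_inner_self_nonneg (F := TangentSpace (𝓡 n) (φ w))

lemma radialSq_nonneg (φ : Euc n → M) (a : ℝ) (y : M) : 0 ≤ radialSq φ a y := by
  rw [radialSq]
  split_ifs
  · exact paramMetric_self_nonneg _ _ _
  · positivity

lemma radialSq_le (φ : Euc n → M) (a : ℝ) (y : M) : radialSq φ a y ≤ a ^ 2 := by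
  rw [radialSq]
  split_ifs with h
  · exact le_of_lt (Function.invFunOn_mem h)
  · exact le_rfl

lemma radialSq_of_notMem {φ : Euc n → M} {a : ℝ} {y : M}
    (h : y ∉ φ '' {w | paramMetric φ 0 w w < a ^ 2}) : radialSq φ a y = a ^ 2 := if_neg h

namespace NormalChart

variable {p : M} {φ : Euc n → M} {δ a : ℝ}

lemma radialSq_apply (h : NormalChart p φ δ a) {w : Euc n} (hw : paramMetric φ 0 w w < a ^ 2) :
    radialSq φ a (φ w) = paramMetric φ 0 w w := by
  have hm : φ w ∈ φ '' {w | paramMetric φ 0 w w < a ^ 2} := ⟨w, hw, rfl⟩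
  rw [radialSq, if_pos hm]
  have h1 := Function.invFunOn_mem hm
  have h2 := Function.invFunOn_eq hm
  rw [h.injOn (h.mem_ball _ (le_of_lt h1)) (h.mem_ball w hw.le) h2]
  rfl

lemma isCompact_sublevel (h : NormalChart p φ δ a) {s : ℝ} (hs : s ≤ a ^ 2) :
    IsCompact (φ '' {w | paramMetric φ 0 w w ≤ s}) := by
  have hcl : IsClosed {w : Euc n | paramMetric φ 0 w w ≤ s} :=
    isClosed_le (contDiff_sqNorm (paramMetric φ 0)).continuous continuous_const
  have hsub : {w : Euc n | paramMetric φ 0 w w ≤ s} ⊆ ball 0 δ :=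
    fun w hw ↦ h.mem_ball w (le_trans hw hs)
  have hK : IsCompact {w : Euc n | paramMetric φ 0 w w ≤ s} :=
    (isCompact_closedBall (0 : Euc n) δ).of_isClosed_subset hcl
      (hsub.trans ball_subset_closedBall)
  refine hK.image_of_continuousOn fun w hw ↦ ?_
  exact (h.param w (hsub hw)).smooth.self_of_nhds.continuousAt.continuousWithinAt

variable [IsManifold (𝓡 n) ∞ M]
  [IsContMDiffRiemannianBundle (𝓡 n) ∞ (Euc n) (fun x : M ↦ TangentSpace (𝓡 n) x)]

/-- Near a point of the normal ball, the radial coordinate is given by a smooth local inverse. -/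
lemma exists_inverse (h : NormalChart p φ δ a) {w : Euc n} (hw : paramMetric φ 0 w w < a ^ 2) :
    ∃ ψ : M → Euc n, ψ (φ w) = w ∧ ContMDiffAt (𝓡 n) (𝓡 n) ∞ ψ (φ w) ∧
      (∀ᶠ y in 𝓝 (φ w), φ (ψ y) = y) ∧
      radialSq φ a =ᶠ[𝓝 (φ w)] sqNorm (paramMetric φ 0) ∘ ψ := by
  obtain ⟨ψ, h1, h2, h3⟩ := (h.param w (h.mem_ball w hw.le)).exists_inverse
  refine ⟨ψ, h1, h2, h3, ?_⟩
  have hcont : ContinuousAt (sqNorm (paramMetric φ 0) ∘ ψ) (φ w) :=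
    (contDiff_sqNorm (paramMetric φ 0)).continuous.continuousAt.comp h2.continuousAt
  have h4 : ∀ᶠ y in 𝓝 (φ w), (sqNorm (paramMetric φ 0) ∘ ψ) y < a ^ 2 := by
    refine hcont.eventually_lt continuousAt_const ?_
    rw [Function.comp_apply, h1]
    exact hw
  filter_upwards [h3, h4] with y hy3 hy4
  conv_lhs => rw [← hy3]
  exact h.radialSq_apply hy4

lemma contMDiffAt_radialSq (h : NormalChart p φ δ a) {w : Euc n}
    (hw : paramMetric φ 0 w w < a ^ 2) :
    ContMDiffAt (𝓡 n) 𝓘(ℝ, ℝ) ∞ (radialSq φ a) (φ w) := by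
  obtain ⟨ψ, -, h2, -, h4⟩ := h.exists_inverse hw
  exact ((contDiff_sqNorm (paramMetric φ 0)).contMDiff.contMDiffAt.comp _ h2).congr_of_eventuallyEq
    h4

lemma continuous_radialSq (h : NormalChart p φ δ a) : Continuous (radialSq φ a) := by
  refine continuous_iff_continuousAt.2 fun x ↦ ?_
  by_cases hx : x ∈ φ '' {w | paramMetric φ 0 w w < a ^ 2}
  · obtain ⟨w, hw, rfl⟩ := hx
    exact (h.contMDiffAt_radialSq hw).continuousAt
  · rw [ContinuousAt, radialSq_of_notMem hx]
    refine tendsto_order.2 ⟨fun s hs ↦ ?_, fun s hs ↦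
      Eventually.of_forall fun y ↦ (radialSq_le φ a y).trans_lt hs⟩
    have hcl := (h.isCompact_sublevel hs.le).isClosed
    have hx' : x ∉ φ '' {w | paramMetric φ 0 w w ≤ s} := by
      rintro ⟨w, hw, rfl⟩
      exact hx ⟨w, lt_of_le_of_lt hw hs, rfl⟩
    filter_upwards [hcl.isOpen_compl.mem_nhds hx'] with y hy
    by_cases hy' : y ∈ φ '' {w | paramMetric φ 0 w w < a ^ 2}
    · obtain ⟨w, hw, rfl⟩ := hy'
      rw [h.radialSq_apply hw]
      by_contra hcon
      exact hy ⟨w, not_lt.1 hcon, rfl⟩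
    · rwa [radialSq_of_notMem hy']

/-- Along a curve, the radial coordinate grows at most with the speed of the curve. -/
lemma hasDerivAt_radialSq_comp (h : NormalChart p φ δ a) {γ : ℝ → M} {t : ℝ}
    (hγ : MDifferentiableAt 𝓘(ℝ, ℝ) (𝓡 n) γ t)
    (ht : γ t ∈ φ '' {w | paramMetric φ 0 w w < a ^ 2}) :
    ∃ d : ℝ, HasDerivAt (radialSq φ a ∘ γ) (2 * d) t ∧
      d ^ 2 ≤ radialSq φ a (γ t) * ‖mfderiv 𝓘(ℝ, ℝ) (𝓡 n) γ t (1 : ℝ)‖ ^ 2 := by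
  obtain ⟨w, hw, hwt⟩ := ht
  obtain ⟨ψ, h1, h2, h3, h4⟩ := h.exists_inverse hw
  rw [hwt] at h1 h2 h3 h4
  have hwb := h.mem_ball w (le_of_lt hw)
  let c : ℝ → Euc n := ψ ∘ γ
  have hct : c t = w := h1
  have hc : DifferentiableAt ℝ c t :=
    ((h2.mdifferentiableAt (by simp)).comp t hγ).differentiableAt
  have hφc : γ =ᶠ[𝓝 t] φ ∘ c := by
    filter_upwards [hγ.continuousAt.eventually h3] with s hs using hs.symm
  have hφd : MDifferentiableAt (𝓡 n) (𝓡 n) φ (c t) := by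
    rw [hct]
    exact (h.param w hwb).smooth.self_of_nhds.mdifferentiableAt (by simp)
  refine ⟨paramMetric φ 0 w (deriv c t), ?_, ?_⟩
  · have h5 : radialSq φ a ∘ γ =ᶠ[𝓝 t] sqNorm (paramMetric φ 0) ∘ c :=
      hγ.continuousAt.eventually h4
    refine HasDerivAt.congr_of_eventuallyEq ?_ h5
    have h6 := (hasFDerivAt_sqNorm (paramMetric φ 0) (c t)).comp_hasDerivAt t hc.hasDerivAt
    refine h6.congr_deriv ?_
    simp only [add_apply, ContinuousLinearMap.flip_apply, hct]
    rw [h.normal.metricAt_zero.symm_apply (deriv c t) w]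
    ring
  · rw [norm_velocity_sq hφd hc hφc, hct, ← hwt, h.radialSq_apply hw, ← h.normal.gauss_self hwb,
      ← h.normal.gauss hwb]
    exact paramMetric_cauchy_schwarz _ _ _ _

end NormalChart

end

section

open Set Filter Topology Metric MeasureTheory

variable {n : ℕ} {M : Type*} [MetricSpace M] [ChartedSpace (Euc n) M]
  [RiemannianBundle (fun x : M ↦ TangentSpace (𝓡 n) x)]

section Speed

variable [IsManifold (𝓡 n) ∞ M]
  [IsContMDiffRiemannianBundle (𝓡 n) ∞ (Euc n) (fun x : M ↦ TangentSpace (𝓡 n) x)]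

lemma continuous_speed {γ : ℝ → M} (hγ : ContMDiff 𝓘(ℝ, ℝ) (𝓡 n) 1 γ) :
    Continuous fun t ↦ ‖mfderiv 𝓘(ℝ, ℝ) (𝓡 n) γ t (1 : ℝ)‖ := by
  have h1 : Continuous (tangentMap 𝓘(ℝ, ℝ) (𝓡 n) γ) := hγ.continuous_tangentMap le_rfl
  have h2 : Continuous (fun t : ℝ ↦ (⟨t, (1 : ℝ)⟩ : TangentBundle 𝓘(ℝ, ℝ) ℝ)) :=
    (contMDiff_vectorSpace_iff_contDiff.2 (contDiff_const (n := 1) (c := (1 : ℝ)))).continuous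
  have h3 : Continuous (fun t ↦
    (⟨γ t, mfderiv 𝓘(ℝ, ℝ) (𝓡 n) γ t (1 : ℝ)⟩ : TotalSpace (Euc n) (TangentSpace (𝓡 n) (M := M)))) :=
    h1.comp h2
  have h4 : ContMDiff 𝓘(ℝ, ℝ) ((𝓡 n).prod 𝓘(ℝ, Euc n)) 0 (fun t ↦
    (⟨γ t, mfderiv 𝓘(ℝ, ℝ) (𝓡 n) γ t (1 : ℝ)⟩ : TotalSpace (Euc n) (TangentSpace (𝓡 n) (M := M)))) :=
    contMDiff_zero_iff.2 h3
  have : IsContMDiffRiemannianBundle (𝓡 n) 0 (Euc n) (fun x : M ↦ TangentSpace (𝓡 n) x) :=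
    IsContMDiffRiemannianBundle.of_le (n := ∞) (by simp)
  have h5 := Real.continuous_sqrt.comp (h4.inner_bundle h4).continuous
  refine h5.congr fun t ↦ ?_
  simp only [Function.comp_apply]
  rw [real_inner_self_eq_norm_sq, Real.sqrt_sq (norm_nonneg _)]

/-- The length of a `C^1` curve as an integral of its speed. -/
lemma pathELength_eq_ofReal {γ : ℝ → M} (hγ : ContMDiff 𝓘(ℝ, ℝ) (𝓡 n) 1 γ) :
    Manifold.pathELength (𝓡 n) γ 0 1 =
      ENNReal.ofReal (∫ t in (0 : ℝ)..1, ‖mfderiv 𝓘(ℝ, ℝ) (𝓡 n) γ t (1 : ℝ)‖) := by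
  have hc := continuous_speed hγ
  rw [Manifold.pathELength_eq_lintegral_mfderiv_Icc, intervalIntegral.integral_of_le zero_le_one,
    ← integral_Icc_eq_integral_Ioc, ofReal_integral_eq_lintegral_ofReal
      (hc.continuousOn.integrableOn_Icc) (Eventually.of_forall fun _ ↦ norm_nonneg _)]
  simp only [ofReal_norm]
  rfl

end Speed

namespace NormalChart

variable {p : M} {φ : Euc n → M} {δ a : ℝ}

lemma slope_radial_lt [IsManifold (𝓡 n) ∞ M]
    [IsContMDiffRiemannianBundle (𝓡 n) ∞ (Euc n) (fun x : M ↦ TangentSpace (𝓡 n) x)]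
    (h : NormalChart p φ δ a) {γ : ℝ → M} {t : ℝ}
    (hγ : MDifferentiableAt 𝓘(ℝ, ℝ) (𝓡 n) γ t) {ε : ℝ} (hε : 0 < ε) {r : ℝ}
    (hr : ‖mfderiv 𝓘(ℝ, ℝ) (𝓡 n) γ t (1 : ℝ)‖ < r) :
    ∃ᶠ z in 𝓝[>] t, slope (fun s ↦ √(radialSq φ a (γ s) + ε ^ 2)) t z < r := by
  refine Eventually.frequently ?_
  have hr0 : 0 < r := (norm_nonneg _).trans_lt hr
  by_cases ht : γ t ∈ φ '' {w | paramMetric φ 0 w w < a ^ 2}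
  · obtain ⟨d, hd, hle⟩ := h.hasDerivAt_radialSq_comp hγ ht
    have hR := radialSq_nonneg φ a (γ t)
    have hpos : 0 < radialSq φ a (γ t) + ε ^ 2 := by positivity
    have h1 : HasDerivAt (fun s ↦ √(radialSq φ a (γ s) + ε ^ 2))
        (2 * d / (2 * √(radialSq φ a (γ t) + ε ^ 2))) t :=
      (hd.add_const (ε ^ 2)).sqrt hpos.ne'
    have h2 : 2 * d / (2 * √(radialSq φ a (γ t) + ε ^ 2)) < r := by
      rw [mul_div_mul_left _ _ two_ne_zero, div_lt_iff₀ (Real.sqrt_pos.2 hpos)]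
      refine lt_of_le_of_lt ?_ (mul_lt_mul_of_pos_right hr (Real.sqrt_pos.2 hpos))
      refine le_of_sq_le_sq ?_ (by positivity)
      rw [mul_pow, Real.sq_sqrt hpos.le]
      nlinarith [sq_nonneg (ε * ‖mfderiv 𝓘(ℝ, ℝ) (𝓡 n) γ t (1 : ℝ)‖)]
    have h3 := (hasDerivAt_iff_tendsto_slope.1 h1).mono_left
      (nhdsWithin_mono t (s := Ioi t) fun z hz ↦ ne_of_gt hz)
    exact h3.eventually_lt_const h2
  · filter_upwards [self_mem_nhdsWithin] with z hz
    refine lt_of_le_of_lt ?_ hr0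
    rw [slope_def_field]
    refine div_nonpos_of_nonpos_of_nonneg ?_ (sub_nonneg.2 (le_of_lt hz))
    rw [sub_nonpos, radialSq_of_notMem ht]
    exact Real.sqrt_le_sqrt (by linarith [radialSq_le φ a (γ z)])

variable [IsManifold (𝓡 n) ∞ M]
  [IsContMDiffRiemannianBundle (𝓡 n) ∞ (Euc n) (fun x : M ↦ TangentSpace (𝓡 n) x)]

omit [IsManifold (𝓡 n) ∞ M]
  [IsContMDiffRiemannianBundle (𝓡 n) ∞ (Euc n) (fun x : M ↦ TangentSpace (𝓡 n) x)] in
lemma radialSq_center (h : NormalChart p φ δ a) : radialSq φ a p = 0 := by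
  have h0 : paramMetric φ 0 0 0 = 0 := by simp
  have := h.radialSq_apply (w := 0) (by rw [h0]; exact pow_pos h.a_pos 2)
  rwa [h.zero, h0] at this

lemma sqrt_radialSq_le_length (h : NormalChart p φ δ a) {γ : ℝ → M}
    (hγ : ContMDiff 𝓘(ℝ, ℝ) (𝓡 n) 1 γ) (h0 : γ 0 = p) :
    √(radialSq φ a (γ 1)) ≤ ∫ t in (0 : ℝ)..1, ‖mfderiv 𝓘(ℝ, ℝ) (𝓡 n) γ t (1 : ℝ)‖ := by
  have hc := continuous_speed hγ
  refine le_of_forall_pos_le_add fun ε hε ↦ ?_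
  have key := image_le_of_liminf_slope_right_le_deriv_boundary (a := 0) (b := 1)
    (f := fun s ↦ √(radialSq φ a (γ s) + ε ^ 2))
    (B := fun s ↦ ε + ∫ t in (0 : ℝ)..s, ‖mfderiv 𝓘(ℝ, ℝ) (𝓡 n) γ t (1 : ℝ)‖)
    (B' := fun s ↦ ‖mfderiv 𝓘(ℝ, ℝ) (𝓡 n) γ s (1 : ℝ)‖)
    (((h.continuous_radialSq.comp hγ.continuous).add continuous_const).sqrt.continuousOn)
    (by simp [h0, h.radialSq_center, Real.sqrt_sq hε.le])
    (fun s _ ↦ ((hc.integral_hasStrictDerivAt 0 s).hasDerivAt.const_add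
      ε).continuousAt.continuousWithinAt)
    (fun s _ ↦ ((hc.integral_hasStrictDerivAt 0 s).hasDerivAt.const_add ε).hasDerivWithinAt)
    (fun s _ r hr ↦ h.slope_radial_lt (hγ.mdifferentiableAt (by simp)) hε hr)
    (right_mem_Icc.2 zero_le_one)
  have h1 : √(radialSq φ a (γ 1)) ≤ √(radialSq φ a (γ 1) + ε ^ 2) :=
    Real.sqrt_le_sqrt (by linarith [sq_nonneg ε])
  exact h1.trans (key.trans_eq (add_comm _ _))

omit [IsManifold (𝓡 n) ∞ M]
  [IsContMDiffRiemannianBundle (𝓡 n) ∞ (Euc n) (fun x : M ↦ TangentSpace (𝓡 n) x)] in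
/-- The segment from the origin in a normal chart bounds the distance from above. -/
lemma edist_le (h : NormalChart p φ δ a) {w : Euc n} (hw : w ∈ ball (0 : Euc n) δ) :
    Manifold.riemannianEDist (𝓡 n) p (φ w) ≤ ENNReal.ofReal (√(paramMetric φ 0 w w)) := by
  have hmem : ∀ t ∈ Icc (0 : ℝ) 1, t • w ∈ ball (0 : Euc n) δ := fun t ht ↦ smul_mem_ball hw ht
  have hline : ContDiff ℝ ∞ (fun t : ℝ ↦ t • w) := contDiff_id.smul contDiff_const
  have hγ : ContMDiffOn 𝓘(ℝ, ℝ) (𝓡 n) 1 (φ ∘ fun t : ℝ ↦ t • w) (Icc 0 1) := fun t ht ↦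
    ((((h.param _ (hmem t ht)).smooth.self_of_nhds).comp t
      hline.contMDiff.contMDiffAt).of_le (by simp)).contMDiffWithinAt
  refine (Manifold.riemannianEDist_le_pathELength hγ (by simp [h.zero]) (by simp)
    zero_le_one).trans ?_
  rw [Manifold.pathELength_eq_lintegral_mfderiv_Icc]
  refine (setLIntegral_congr_fun measurableSet_Icc (g := fun _ ↦
    ENNReal.ofReal (√(paramMetric φ 0 w w))) fun t ht ↦ ?_).trans_le (by simp)
  have hd : HasDerivAt (fun s : ℝ ↦ s • w) w t := by
    simpa using (hasDerivAt_id t).smul_const w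
  have h1 := norm_velocity_sq (γ := φ ∘ fun t : ℝ ↦ t • w)
    ((h.param _ (hmem t ht)).smooth.self_of_nhds.mdifferentiableAt (by simp)) hd.differentiableAt
    EventuallyEq.rfl
  rw [hd.deriv, h.normal.gauss_ray (hmem t ht)] at h1
  simp only
  rw [← ofReal_norm, ← h1, Real.sqrt_sq (norm_nonneg _)]
  rfl

variable [IsRiemannianManifold (𝓡 n) M]

/-- The radial coordinate bounds the distance to the center from below. -/
lemma sqrt_radialSq_le_dist (h : NormalChart p φ δ a) (q : M) :
    √(radialSq φ a q) ≤ dist p q := by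
  refine le_of_forall_gt fun L hL ↦ ?_
  have h1 : Manifold.riemannianEDist (𝓡 n) p q < ENNReal.ofReal L := by
    rw [← IsRiemannianManifold.out (I := 𝓡 n) p q, edist_dist]
    exact (ENNReal.ofReal_lt_ofReal_iff (dist_nonneg.trans_lt hL)).2 hL
  obtain ⟨γ, h0, rfl, hγ, hlen, -⟩ :=
    Manifold.exists_lt_locally_constant_of_riemannianEDist_lt h1 zero_lt_one
  rw [pathELength_eq_ofReal hγ, ENNReal.ofReal_lt_ofReal_iff (dist_nonneg.trans_lt hL)] at hlen
  exact (h.sqrt_radialSq_le_length hγ h0).trans_lt hlen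

theorem dist_eq (h : NormalChart p φ δ a) {w : Euc n} (hw : paramMetric φ 0 w w < a ^ 2) :
    dist p (φ w) = √(paramMetric φ 0 w w) := by
  refine le_antisymm ?_ ?_
  · have := h.edist_le (h.mem_ball w hw.le)
    rw [← IsRiemannianManifold.out (I := 𝓡 n) p (φ w), edist_dist] at this
    exact (ENNReal.ofReal_le_ofReal_iff (Real.sqrt_nonneg _)).1 this
  · rw [← h.radialSq_apply hw]
    exact h.sqrt_radialSq_le_dist _

theorem exists_eq_of_dist_lt (h : NormalChart p φ δ a) {q : M} (hq : dist p q < a) :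
    ∃ w, paramMetric φ 0 w w < a ^ 2 ∧ φ w = q := by
  by_contra hcon
  have h1 : q ∉ φ '' {w | paramMetric φ 0 w w < a ^ 2} := hcon
  have h2 := h.sqrt_radialSq_le_dist q
  rw [radialSq_of_notMem h1, Real.sqrt_sq h.a_pos.le] at h2
  exact absurd hq (not_lt.2 h2)

lemma dist_sq_eq_radialSq (h : NormalChart p φ δ a) {q : M} (hq : dist p q < a) :
    dist p q ^ 2 = radialSq φ a q := by
  obtain ⟨w, hw, rfl⟩ := h.exists_eq_of_dist_lt hq
  rw [h.dist_eq hw, h.radialSq_apply hw, Real.sq_sqrt (paramMetric_self_nonneg _ _ _)]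

lemma contMDiffAt_dist_sq (h : NormalChart p φ δ a) {q : M} (hq : dist p q < a) :
    ContMDiffAt (𝓡 n) 𝓘(ℝ, ℝ) ∞ (fun y ↦ dist p y ^ 2) q := by
  have h1 : (fun y ↦ dist p y ^ 2) =ᶠ[𝓝 q] radialSq φ a := by
    have hc : Continuous fun y ↦ dist p y := by fun_prop
    filter_upwards [hc.continuousAt.eventually_lt continuousAt_const hq] with y hy
    exact h.dist_sq_eq_radialSq hy
  obtain ⟨w, hw, rfl⟩ := h.exists_eq_of_dist_lt hq
  exact (h.contMDiffAt_radialSq hw).congr_of_eventuallyEq h1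

/-- The Laplacian of the squared distance in a normal chart. -/
theorem laplaceBeltrami_dist_sq (h : NormalChart p φ δ a) {w : Euc n}
    (hw : paramMetric φ 0 w w < a ^ 2) :
    laplaceBeltrami (n := n) (fun y ↦ dist p y ^ 2) (φ w) = normalLap (paramMetric φ) w := by
  have hd : dist p (φ w) < a := by
    rw [h.dist_eq hw, Real.sqrt_lt' h.a_pos]
    exact hw
  have hwb := h.mem_ball w hw.le
  rw [(h.param w hwb).laplaceBeltrami_eq (h.contMDiffAt_dist_sq hd), ← h.normal.lap_sqNorm hwb]
  have h1 : (fun y ↦ dist p y ^ 2) ∘ φ =ᶠ[𝓝 w] sqNorm (paramMetric φ 0) := by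
    have hc := (contDiff_sqNorm (paramMetric φ 0)).continuous.continuousAt (x := w)
    filter_upwards [hc.eventually_lt continuousAt_const hw] with y hy
    rw [Function.comp_apply, h.dist_eq hy, Real.sq_sqrt (paramMetric_self_nonneg _ _ _)]
    rfl
  simp only [lap, hess, h1.fderiv_eq, h1.fderiv.fderiv_eq]

end NormalChart

end

section

open Set Filter Topology Metric

section Uniqueness

variable {E : Type*} [NormedAddCommGroup E] [NormedSpace ℝ E]

/-- Local uniqueness for the geodesic equation. -/
lemma eventuallyEq_of_secondOrder {Γ : E → E →L[ℝ] E →L[ℝ] E} {c₁ c₂ c₁' c₂' : ℝ → E} {t : ℝ}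
    (hΓ : ContDiffAt ℝ 1 Γ (c₁ t))
    (h₁ : ∀ᶠ s in 𝓝 t, HasDerivAt c₁ (c₁' s) s ∧ HasDerivAt c₁' (- Γ (c₁ s) (c₁' s) (c₁' s)) s)
    (h₂ : ∀ᶠ s in 𝓝 t, HasDerivAt c₂ (c₂' s) s ∧ HasDerivAt c₂' (- Γ (c₂ s) (c₂' s) (c₂' s)) s)
    (h : c₁ t = c₂ t) (h' : c₁' t = c₂' t) : c₁ =ᶠ[𝓝 t] c₂ := by
  let F : E × E → E × E := fun x ↦ (x.2, - Γ x.1 x.2 x.2)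
  have hF : ContDiffAt ℝ 1 F (c₁ t, c₁' t) := by
    have h1 : ContDiffAt ℝ 1 (fun x : E × E ↦ Γ x.1) (c₁ t, c₁' t) :=
      ContDiffAt.comp (c₁ t, c₁' t) (g := Γ) hΓ contDiffAt_fst
    exact contDiffAt_snd.prodMk ((h1.clm_apply contDiffAt_snd).clm_apply contDiffAt_snd).neg
  obtain ⟨K, U, hU, hK⟩ := hF.exists_lipschitzOnWith
  have hcont : ∀ {c c' : ℝ → E},
      (∀ᶠ s in 𝓝 t, HasDerivAt c (c' s) s ∧ HasDerivAt c' (- Γ (c s) (c' s) (c' s)) s) →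
      (c t, c' t) = (c₁ t, c₁' t) → ∀ᶠ s in 𝓝 t,
      HasDerivAt (fun s ↦ (c s, c' s)) (F (c s, c' s)) s ∧ (c s, c' s) ∈ U := by
    intro c c' hc heq
    have h0 := hc.self_of_nhds
    have hcc : ContinuousAt (fun s ↦ (c s, c' s)) t :=
      h0.1.continuousAt.prodMk h0.2.continuousAt
    have hU' : U ∈ 𝓝 (c t, c' t) := by rwa [heq]
    filter_upwards [hc, hcc.eventually hU'] with s hs hsU
    exact ⟨hs.1.prodMk hs.2, hsU⟩
  have key := ODE_solution_unique_of_eventually (v := fun _ ↦ F) (s := fun _ ↦ U) (K := K)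
    (Eventually.of_forall fun _ ↦ hK) (hcont h₁ rfl) (hcont h₂ (by rw [h, h'])) (by rw [h, h'])
  filter_upwards [key] with s hs
  exact congrArg Prod.fst hs

end Uniqueness

section Totals

variable {n : ℕ} {M : Type*} [TopologicalSpace M] [ChartedSpace (Euc n) M]

lemma tangentBundle_mk_eq_iff {x y : M} {u : TangentSpace (𝓡 n) x} {v : TangentSpace (𝓡 n) y} :
    (⟨x, u⟩ : TangentBundle (𝓡 n) M) = ⟨y, v⟩ ↔ x = y ∧ (u : Euc n) = (v : Euc n) := by
  constructor
  · intro h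
    cases h
    exact ⟨rfl, rfl⟩
  · rintro ⟨rfl, h⟩
    exact congrArg (fun z : TangentSpace (𝓡 n) x ↦ (⟨x, z⟩ : TangentBundle (𝓡 n) M)) h

end Totals

variable {n : ℕ} {M : Type*} [MetricSpace M] [ChartedSpace (Euc n) M] [IsManifold (𝓡 n) ∞ M]
  [RiemannianBundle (fun x : M ↦ TangentSpace (𝓡 n) x)]
  [IsContMDiffRiemannianBundle (𝓡 n) ∞ (Euc n) (fun x : M ↦ TangentSpace (𝓡 n) x)]

lemma hasDerivAt_smul_const (v : Euc n) (t : ℝ) : HasDerivAt (fun s : ℝ ↦ s • v) v t := by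
  simpa using (hasDerivAt_id t).smul_const v

namespace NormalChart

variable {p : M} {φ : Euc n → M} {δ a : ℝ}

/-- The local expression of a geodesic in a normal chart, near a time at which it meets a ray. -/
lemma exists_local_lift (h : NormalChart p φ δ a) {γ : ℝ → M} {s : Set ℝ} (hs : IsOpen s)
    (hγ : IsGeodesicOn (n := n) γ s) {t : ℝ} (ht : t ∈ s) {v : Euc n}
    (hv : t • v ∈ ball (0 : Euc n) δ) (hγt : γ t = φ (t • v)) :
    ∃ c : ℝ → Euc n, ContDiffAt ℝ 2 c t ∧ c t = t • v ∧ γ =ᶠ[𝓝 t] φ ∘ c ∧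
      (deriv c t = v → γ =ᶠ[𝓝 t] fun τ ↦ φ (τ • v)) := by
  obtain ⟨ψ, h1, h2, h3⟩ := (h.param _ hv).exists_inverse
  rw [← hγt] at h1 h2 h3
  have hγs : ContMDiffAt 𝓘(ℝ, ℝ) (𝓡 n) ∞ γ t := hγ.1.contMDiffAt (hs.mem_nhds ht)
  have hc : ContDiffAt ℝ 2 (ψ ∘ γ) t := (h2.comp t hγs).contDiffAt.of_le two_le_infty
  have hφc : γ =ᶠ[𝓝 t] φ ∘ (ψ ∘ γ) := by
    filter_upwards [hγs.continuousAt.eventually h3] with τ hτ using hτ.symm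
  refine ⟨ψ ∘ γ, hc, h1, hφc, fun hd ↦ ?_⟩
  set c := ψ ∘ γ with hcdef
  have hct : c t = t • v := h1
  have hcb : ∀ᶠ τ in 𝓝 t, c τ ∈ ball (0 : Euc n) δ :=
    hc.continuousAt.eventually (isOpen_ball.mem_nhds (by rwa [hct]))
  have hlb : ∀ᶠ τ in 𝓝 t, τ • v ∈ ball (0 : Euc n) δ :=
    (hasDerivAt_smul_const v t).continuousAt.eventually (isOpen_ball.mem_nhds hv)
  have hchr : ContDiffAt ℝ 1 (chrMap (paramMetric φ)) (c t) := by
    rw [hct]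
    exact (h.normal.metricAt _ hv).contDiffAt_chrMap.of_le (by simp)
  have key : c =ᶠ[𝓝 t] fun τ ↦ τ • v := by
    refine eventuallyEq_of_secondOrder (Γ := chrMap (paramMetric φ)) (c₁' := deriv c)
      (c₂' := fun _ ↦ v) hchr ?_ ?_ hct hd
    · filter_upwards [hcb, hs.mem_nhds ht, hc.eventually (by simp), hφc.eventually_nhds]
        with τ hτ1 hτ2 hτ3 hτ4
      refine ⟨(hτ3.differentiableAt (by simp)).hasDerivAt, ?_⟩
      have hgeo := ((h.param _ hτ1).geodesic_iff hτ3 hτ4).1 (hγ.2 τ hτ2)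
      have hdd : DifferentiableAt ℝ (deriv c) τ := by
        have := (hτ3.fderiv_right (m := 1) (by norm_num [one_add_one_eq_two])).clm_apply
          (contDiffAt_const (c := (1 : ℝ)))
        have h5 : ContDiffAt ℝ 1 (deriv c) τ := by simpa using this
        exact h5.differentiableAt (by simp)
      rw [← eq_neg_of_add_eq_zero_left hgeo]
      exact hdd.hasDerivAt
    · filter_upwards [hlb] with τ hτ
      refine ⟨hasDerivAt_smul_const v τ, ?_⟩
      rw [h.normal.chrMap_ray hτ, neg_zero]
      exact hasDerivAt_const τ v
  filter_upwards [hφc, key] with τ hτ1 hτ2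
  rw [hτ1, Function.comp_apply, hτ2]

/-- A geodesic which starts at the center of a normal chart is a ray. -/
theorem eqOn_ray (h : NormalChart p φ δ a) {γ : ℝ → M} {l r : ℝ} (hl : l < 0) (hr : 0 < r)
    (hγ : IsGeodesicOn (n := n) γ (Ioo l r)) {v : Euc n}
    (hv : ∀ t ∈ Ioo l r, t • v ∈ ball (0 : Euc n) δ) (h0 : γ 0 = φ 0)
    (h0' : (mfderiv 𝓘(ℝ, ℝ) (𝓡 n) γ 0 (1 : ℝ) : Euc n) = dparam φ 0 v) :
    ∀ t ∈ Ioo l r, γ t = φ (t • v) := by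
  let S : Set ℝ := {t | γ =ᶠ[𝓝 t] fun τ ↦ φ (τ • v)}
  have hSo : IsOpen S := isOpen_iff_eventually.2 fun t ht ↦ ht.eventually_nhds
  have hzero : (0 : ℝ) ∈ Ioo l r := ⟨hl, hr⟩
  have hS0 : (0 : ℝ) ∈ S := by
    obtain ⟨c, hc, hc0, hφc, himp⟩ := h.exists_local_lift isOpen_Ioo hγ hzero (hv 0 hzero)
      (by rw [h0, zero_smul])
    refine himp ?_
    have hpar := h.param _ (hv 0 hzero)
    rw [← hc0] at hpar
    have h1 := velocity_eq (hpar.smooth.self_of_nhds.mdifferentiableAt (by simp))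
      (hc.differentiableAt (by simp)) hφc
    refine hpar.injective.self_of_nhds ?_
    rw [← h1, h0', hc0, zero_smul]
  have hsub : Ioo l r ⊆ S := by
    refine isPreconnected_Ioo.subset_of_closure_inter_subset hSo ⟨0, hzero, hS0⟩ ?_
    rintro t ⟨htS, ht⟩
    have hfreq : ∃ᶠ s in 𝓝 t, s ∈ S := mem_closure_iff_frequently.1 htS
    have hγc : ContinuousAt γ t :=
      (hγ.1.contMDiffAt (isOpen_Ioo.mem_nhds ht)).continuousAt
    have hσc : ContinuousAt (fun τ : ℝ ↦ φ (τ • v)) t :=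
      ContinuousAt.comp (g := φ) (h.param _ (hv t ht)).smooth.self_of_nhds.continuousAt
        (hasDerivAt_smul_const v t).continuousAt
    have hγt : γ t = φ (t • v) := by
      by_contra hne
      have hev : ∀ᶠ s in 𝓝 t, γ s ≠ φ (s • v) := hγc.ne_iff_eventually_ne hσc |>.1 hne
      obtain ⟨s, hs1, hs2⟩ := (hfreq.and_eventually hev).exists
      exact hs2 hs1.self_of_nhds
    obtain ⟨c, hc, hct, hφc, himp⟩ := h.exists_local_lift isOpen_Ioo hγ ht (hv t ht) hγt
    refine himp ?_
    have hcb : ∀ᶠ τ in 𝓝 t, c τ ∈ ball (0 : Euc n) δ :=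
      hc.continuousAt.eventually (isOpen_ball.mem_nhds (by rw [hct]; exact hv t ht))
    have hdc : ContinuousAt (deriv c) t := by
      have := (hc.fderiv_right (m := 1) (by norm_num [one_add_one_eq_two])).clm_apply
        (contDiffAt_const (c := (1 : ℝ)))
      have h5 : ContDiffAt ℝ 1 (deriv c) t := by simpa using this
      exact h5.continuousAt
    by_contra hne
    have hev : ∀ᶠ s in 𝓝 t, deriv c s ≠ v := hdc.eventually_ne hne
    obtain ⟨s, hsS, hs1, hs2, hs3, hs4⟩ := (hfreq.and_eventually
      (hev.and (hcb.eventually_nhds.and (hφc.eventually_nhds.and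
        (eventually_mem_nhds_iff.2 (isOpen_Ioo.mem_nhds ht)))))).exists
    refine hs1 ?_
    have heq : c =ᶠ[𝓝 s] fun τ ↦ τ • v := by
      filter_upwards [hs2, hs3, hs4, hsS] with τ h1 h2 h3 h4
      exact h.injOn h1 (hv τ h3) (by rw [← h4, h2]; rfl)
    rw [heq.deriv_eq, (hasDerivAt_smul_const v s).deriv]
  exact fun t ht ↦ (hsub ht).self_of_nhds

end NormalChart

end

section

open Set Filter Topology Metric

variable {n : ℕ} {M : Type*} [MetricSpace M] [ChartedSpace (Euc n) M] [IsManifold (𝓡 n) ∞ M]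
  [RiemannianBundle (fun x : M ↦ TangentSpace (𝓡 n) x)]
  [IsContMDiffRiemannianBundle (𝓡 n) ∞ (Euc n) (fun x : M ↦ TangentSpace (𝓡 n) x)]

namespace NormalChart

variable {p q : M} {φ : Euc n → M} {δ a : ℝ}

omit [IsManifold (𝓡 n) ∞ M]
  [IsContMDiffRiemannianBundle (𝓡 n) ∞ (Euc n) (fun x : M ↦ TangentSpace (𝓡 n) x)] in
lemma smul_mem (h : NormalChart p φ δ a) {v : Euc n} (hv : paramMetric φ 0 v v = 1) {t : ℝ}
    (ht : |t| ≤ a) : t • v ∈ ball (0 : Euc n) δ := by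
  refine h.mem_ball _ ?_
  simp only [map_smul, smul_apply, smul_eq_mul, hv, mul_one]
  rw [← sq]
  exact sq_le_sq.2 (by rwa [abs_of_pos h.a_pos])

/-- In a normal chart, a direction of the geodesic flow to `q` is the direction of the ray
through `q`. -/
theorem exists_of_isDirection (h : NormalChart (φ 0) φ δ a) (hq : dist (φ 0) q < a)
    {v : TangentSpace (𝓡 n) (φ 0)} (hv : IsDirection (φ 0) q v) :
    ∃ u : Euc n, v = mfderiv (𝓡 n) (𝓡 n) φ 0 u ∧ paramMetric φ 0 u u = 1 ∧
      φ (dist (φ 0) q • u) = q := by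
  obtain ⟨hv1, γ, ε, hε, hγ, hγ0, hγq⟩ := hv
  have h0 : (0 : Euc n) ∈ ball (0 : Euc n) δ := mem_ball_self h.normal.pos
  obtain ⟨u, hu⟩ := (LinearMap.injective_iff_surjective (f := (dparam φ 0).toLinearMap)).1
    (h.param 0 h0).injective.self_of_nhds v
  have hu : dparam φ 0 u = v := hu
  have hu1 : paramMetric φ 0 u u = 1 := by
    rw [paramMetric_apply, hu, ← norm_sq_eq_ip, hv1, one_pow]
  refine ⟨u, hu.symm, hu1, ?_⟩
  obtain ⟨hγ00, hγ0'⟩ := tangentBundle_mk_eq_iff.1 hγ0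
  have hd : 0 ≤ dist (φ 0) q := dist_nonneg
  set d := dist (φ 0) q with hdef
  have hη : 0 < min ε (a - d) := lt_min hε (by linarith)
  have hηε : min ε (a - d) ≤ ε := min_le_left _ _
  have hηa : min ε (a - d) ≤ a - d := min_le_right _ _
  have hsub : Ioo (- min ε (a - d)) (d + min ε (a - d)) ⊆ Ioo (-ε) (d + ε) :=
    Ioo_subset_Ioo (by linarith) (by linarith)
  have key := h.eqOn_ray (γ := γ) (l := - min ε (a - d)) (r := d + min ε (a - d)) (v := u)
    (by linarith) (by linarith) ⟨hγ.1.mono hsub, fun t ht ↦ hγ.2 t (hsub ht)⟩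
    (fun t ht ↦ h.smul_mem hu1 (abs_le.2 ⟨by linarith [ht.1], by linarith [ht.2]⟩)) hγ00
    (by rw [hu, hγ0'])
  rw [← key d ⟨by linarith, by linarith⟩, hγq]

/-- Rays in a normal chart are geodesics. -/
theorem isGeodesicOn_ray (h : NormalChart p φ δ a) {u : Euc n} (hu : paramMetric φ 0 u u = 1)
    {s : Set ℝ} (hs : ∀ t ∈ s, |t| ≤ a) :
    IsGeodesicOn (n := n) (fun t : ℝ ↦ φ (t • u)) s := by
  have hc : ContDiff ℝ ∞ (fun t : ℝ ↦ t • u) := contDiff_id.smul contDiff_const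
  refine ⟨fun t ht ↦ ?_, fun t ht ↦ ?_⟩
  · exact (ContMDiffAt.comp (g := φ) t
      (h.param _ (h.smul_mem hu (hs t ht))).smooth.self_of_nhds
      hc.contMDiff.contMDiffAt).contMDiffWithinAt
  · have hb := h.smul_mem hu (hs t ht)
    refine ((h.param _ hb).geodesic_iff (γ := fun t : ℝ ↦ φ (t • u)) (c := fun t : ℝ ↦ t • u)
      (hc.contDiffAt.of_le two_le_infty) EventuallyEq.rfl).2 ?_
    have h1 : deriv (fun t : ℝ ↦ t • u) = fun _ ↦ u :=
      funext fun t ↦ (hasDerivAt_smul_const u t).deriv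
    rw [h1, h.normal.chrMap_ray hb]
    simp

variable [IsRiemannianManifold (𝓡 n) M]

theorem existsUnique_isDirection (h : NormalChart p φ δ a) (hq : dist p q < a) (hne : q ≠ p) :
    ∃! v : TangentSpace (𝓡 n) p, IsDirection p q v := by
  obtain rfl := h.zero
  obtain ⟨w, hw, rfl⟩ := h.exists_eq_of_dist_lt hq
  have hd : 0 < dist (φ 0) (φ w) := dist_pos.2 (Ne.symm hne)
  have hdw : dist (φ 0) (φ w) ^ 2 = paramMetric φ 0 w w := by
    rw [h.dist_eq hw, Real.sq_sqrt (paramMetric_self_nonneg _ _ _)]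
  set d := dist (φ 0) (φ w) with hdef
  let u : Euc n := d⁻¹ • w
  have hu : paramMetric φ 0 u u = 1 := by
    simp only [u, map_smul, smul_apply, smul_eq_mul, ← hdw]
    field_simp
  have hduw : d • u = w := by simp [u, smul_smul, hd.ne']
  have hpar : ParamAt φ ((0 : ℝ) • u) := by
    rw [zero_smul]
    exact h.param 0 (mem_ball_self h.normal.pos)
  refine ⟨mfderiv (𝓡 n) (𝓡 n) φ 0 u, ⟨?_, fun t ↦ φ (t • u), a - d, by linarith,
    h.isGeodesicOn_ray hu fun t ht ↦ ?_, ?_, ?_⟩, fun v hv ↦ ?_⟩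
  · have h1 := norm_sq_eq_ip (φ 0) (mfderiv (𝓡 n) (𝓡 n) φ 0 u)
    have h2 := paramMetric_apply φ 0 u u
    rw [hu] at h2
    have h3 : ‖mfderiv (𝓡 n) (𝓡 n) φ 0 u‖ ^ 2 = 1 := h1.trans h2.symm
    exact (pow_eq_one_iff_of_nonneg (norm_nonneg _) two_ne_zero).1 h3
  · rw [← hdef] at ht
    exact abs_le.2 ⟨by linarith [ht.1], by linarith [ht.2]⟩
  · refine tangentBundle_mk_eq_iff.2 ⟨congrArg φ (zero_smul ℝ u), ?_⟩
    have h1 := velocity_eq (γ := fun t : ℝ ↦ φ (t • u)) (c := fun t : ℝ ↦ t • u) (t := 0)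
      (hpar.smooth.self_of_nhds.mdifferentiableAt (by simp))
      (hasDerivAt_smul_const u 0).differentiableAt EventuallyEq.rfl
    rw [(hasDerivAt_smul_const u 0).deriv, zero_smul] at h1
    exact h1
  · exact congrArg φ hduw
  · obtain ⟨u', rfl, hu', heq⟩ := h.exists_of_isDirection hq hv
    have hda : |d| ≤ a := by
      rw [abs_of_pos hd]
      exact hq.le
    have h1 := h.injOn (h.smul_mem hu' hda) (h.mem_ball w hw.le) heq
    have h2 : u' = u := by
      simp only [u, ← h1, smul_smul]
      rw [inv_mul_cancel₀ hd.ne', one_smul]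
    rw [h2]

/-- The Ricci curvature in the direction of a ray. -/
theorem ricci_direction (h : NormalChart p φ δ a) {w : Euc n} (hw : paramMetric φ 0 w w < a ^ 2)
    {v : TangentSpace (𝓡 n) p} (hv : IsDirection p (φ w) v) :
    ricci p v v * dist p (φ w) ^ 2 = ric (paramMetric φ) 0 w w := by
  obtain rfl := h.zero
  have hq : dist (φ 0) (φ w) < a := by
    rw [h.dist_eq hw, Real.sqrt_lt' h.a_pos]
    exact hw
  obtain ⟨u, rfl, hu, heq⟩ := h.exists_of_isDirection hq hv
  have h1 := h.injOn (h.smul_mem hu (by rw [abs_of_nonneg dist_nonneg]; exact hq.le))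
    (h.mem_ball w hw.le) heq
  rw [(h.param 0 (mem_ball_self h.normal.pos)).ricci_eq, ← ric_smul_smul, h1]

end NormalChart

end

section

open Set Filter Topology Metric

section Congr

variable {n : ℕ}

lemma MetricAt.congr {g g' : Euc n → Bilin n} {a : Euc n} (h : MetricAt g a) (heq : g' =ᶠ[𝓝 a] g) :
    MetricAt g' a := by
  refine ⟨?_, ?_, ?_⟩
  · filter_upwards [h.smooth, heq.eventually_nhds] with y h1 h2
    exact h1.congr_of_eventuallyEq h2
  · filter_upwards [h.symm, heq] with y h1 h2
    rwa [h2]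
  · filter_upwards [h.pos, heq] with y h1 h2
    rwa [h2]

lemma NormalMetric.congr {g g' : Euc n → Bilin n} {δ : ℝ} (h : NormalMetric g δ)
    (heq : EqOn g' g (ball 0 δ)) : NormalMetric g' δ := by
  have hev : ∀ w ∈ ball (0 : Euc n) δ, g' =ᶠ[𝓝 w] g := fun w hw ↦
    heq.eventuallyEq_of_mem (isOpen_ball.mem_nhds hw)
  refine ⟨h.pos, fun w hw ↦ (h.metricAt w hw).congr (hev w hw), fun w hw u ↦ ?_⟩
  rw [(hev w hw).fderiv_eq]
  exact h.radial w hw u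

lemma normalLap_congr {g g' : Euc n → Bilin n} {w : Euc n} (heq : g' =ᶠ[𝓝 w] g) :
    normalLap g' w = normalLap g w := by
  have h1 : gram g' w = gram g w := by
    ext i j
    rw [gram_apply, gram_apply, heq.self_of_nhds]
  rw [normalLap, normalLap, heq.fderiv_eq, h1]

lemma ric_congr {g g' : Euc n → Bilin n} {a : Euc n} (h : MetricAt g a) (heq : g' =ᶠ[𝓝 a] g)
    (v w : Euc n) : ric g' a v w = ric g a v w := by
  have hI : IsometryAt g' g id a := by
    refine ⟨h.congr heq, h, Eventually.of_forall fun y ↦ contDiffAt_id, ?_⟩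
    filter_upwards [heq] with y hy u v
    simp [hy]
  simpa using hI.ric_law v w

end Congr

section LocalEstimate

variable {n : ℕ} {M : Type*} [MetricSpace M] [ChartedSpace (Euc n) M] [IsManifold (𝓡 n) ∞ M]
  [RiemannianBundle (fun x : M ↦ TangentSpace (𝓡 n) x)]
  [IsContMDiffRiemannianBundle (𝓡 n) ∞ (Euc n) (fun x : M ↦ TangentSpace (𝓡 n) x)]

/-- The normal coordinates of a good family, as a parametrization of the manifold. -/
def familyParam (c : M) (e : Euc n × Euc n → Euc n) (p : M) (w : Euc n) : M :=
  (extChartAt (𝓡 n) c).symm (e (extChartAt (𝓡 n) c p, w))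

section Family

variable {c p : M} {δ m C : ℝ} {e : Euc n × Euc n → Euc n}
  (h : GoodFamily (chartMetric c) (extChartAt (𝓡 n) c c) δ e m C)
  (he : ∀ y ∈ ball (extChartAt (𝓡 n) c c) δ, ∀ w ∈ ball (0 : Euc n) δ,
    e (y, w) ∈ (extChartAt (𝓡 n) c).target)
  (hps : p ∈ (extChartAt (𝓡 n) c).source)
  (hp : extChartAt (𝓡 n) c p ∈ ball (extChartAt (𝓡 n) c c) δ)

include h he hp

omit [IsContMDiffRiemannianBundle (𝓡 n) ∞ (Euc n) (fun x : M ↦ TangentSpace (𝓡 n) x)] in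
lemma eqOn_paramMetric_familyParam :
    EqOn (paramMetric (familyParam c e p))
      (pullMetric (chartMetric c) fun w ↦ e (extChartAt (𝓡 n) c p, w)) (ball 0 δ) := by
  intro w hw
  have hI := h.isometryAt _ hp w hw
  have hs := (eventually_contMDiffAt_symm (he _ hp w hw)).self_of_nhds
  exact paramMetric_comp (φ := (extChartAt (𝓡 n) c).symm)
    (ψ := fun w ↦ e (extChartAt (𝓡 n) c p, w)) (hs.mdifferentiableAt (by simp)) hI.differentiableAt

omit [IsContMDiffRiemannianBundle (𝓡 n) ∞ (Euc n) (fun x : M ↦ TangentSpace (𝓡 n) x)] in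
lemma paramAt_familyParam {w : Euc n} (hw : w ∈ ball (0 : Euc n) δ) :
    ParamAt (familyParam c e p) w := by
  constructor
  · filter_upwards [isOpen_ball.mem_nhds hw] with y hy
    exact ContMDiffAt.comp (g := (extChartAt (𝓡 n) c).symm) y
      (eventually_contMDiffAt_symm (he _ hp y hy)).self_of_nhds
      (h.isometryAt _ hp y hy).smooth.self_of_nhds.contMDiffAt
  · filter_upwards [isOpen_ball.mem_nhds hw] with y hy
    have hI := h.isometryAt _ hp y hy
    have hs := (eventually_contMDiffAt_symm (he _ hp y hy)).self_of_nhds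
    have h1 : dparam (familyParam c e p) y = _ :=
      dparam_comp (φ := (extChartAt (𝓡 n) c).symm)
        (ψ := fun w ↦ e (extChartAt (𝓡 n) c p, w)) (hs.mdifferentiableAt (by simp))
        hI.differentiableAt
    rw [h1]
    exact (injective_dparam_symm (he _ hp y hy)).comp hI.fderiv_injective

omit [IsContMDiffRiemannianBundle (𝓡 n) ∞ (Euc n) (fun x : M ↦ TangentSpace (𝓡 n) x)] in
lemma paramMetric_familyParam_zero : paramMetric (familyParam c e p) 0
    = chartMetric c (extChartAt (𝓡 n) c p) := by
  rw [eqOn_paramMetric_familyParam h he hp (mem_ball_self h.pos), h.pullMetric_zero hp]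

include hps

omit [IsContMDiffRiemannianBundle (𝓡 n) ∞ (Euc n) (fun x : M ↦ TangentSpace (𝓡 n) x)] in
theorem normalChart_familyParam :
    NormalChart p (familyParam c e p) δ (√m * (δ / 2)) where
  a_pos := mul_pos (Real.sqrt_pos.2 h.m_pos) (half_pos h.pos)
  zero := by
    rw [familyParam, h.zero _ hp]
    exact (extChartAt (𝓡 n) c).left_inv hps
  param w hw := paramAt_familyParam h he hp hw
  injOn w hw w' hw' heq := h.injOn _ hp hw hw'
    ((extChartAt (𝓡 n) c).symm.injOn (he _ hp w hw) (he _ hp w' hw') heq)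
  normal := (h.normal _ hp).congr (eqOn_paramMetric_familyParam h he hp)
  mem_ball w hw := by
    rw [paramMetric_familyParam_zero h he hp, mul_pow, Real.sq_sqrt h.m_pos.le] at hw
    have h1 := (h.lower _ hp w).trans hw
    have h2 : ‖w‖ ^ 2 ≤ (δ / 2) ^ 2 := le_of_mul_le_mul_left h1 h.m_pos
    have h3 : ‖w‖ ≤ δ / 2 := le_of_sq_le_sq h2 (half_pos h.pos).le
    rw [mem_ball_zero_iff]
    linarith [h.pos]

end Family

/-- The estimate at the point `p`, with given constants. -/
def EstimateAt (p : M) (r₀ C₁ C₂ : ℝ) : Prop :=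
  ∀ r : ℝ, 0 < r → r < r₀ →
    ContMDiffOn (𝓡 n) 𝓘(ℝ, ℝ) ∞ (fun y : M ↦ dist p y ^ 2) (ball p r) ∧
    ∀ x ∈ ball p r,
      (x ≠ p → ∃! v : TangentSpace (𝓡 n) p, IsDirection p x v) ∧
      (∀ v : TangentSpace (𝓡 n) p, IsDirection p x v →
        |laplaceBeltrami (n := n) (fun y : M ↦ dist p y ^ 2) x - 2 * n
          + 2 / 3 * ricci p v v * dist p x ^ 2| ≤ C₁ * r ^ 3) ∧
      |laplaceBeltrami (n := n) (fun y : M ↦ dist p y ^ 2) x - 2 * n| ≤ C₂ * r ^ 2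

omit [IsManifold (𝓡 n) ∞ M]
  [IsContMDiffRiemannianBundle (𝓡 n) ∞ (Euc n) (fun x : M ↦ TangentSpace (𝓡 n) x)] in
lemma EstimateAt.mono {p : M} {r₀ C₁ C₂ r₀' C₁' C₂' : ℝ}
    (h : EstimateAt (n := n) p r₀ C₁ C₂) (hr : r₀' ≤ r₀) (h₁ : C₁ ≤ C₁') (h₂ : C₂ ≤ C₂') :
    EstimateAt (n := n) p r₀' C₁' C₂' := by
  intro r hr0 hrr
  obtain ⟨h3, h4⟩ := h r hr0 (hrr.trans_le hr)
  refine ⟨h3, fun x hx ↦ ?_⟩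
  obtain ⟨h5, h6, h7⟩ := h4 x hx
  exact ⟨h5, fun v hv ↦ (h6 v hv).trans (by gcongr), h7.trans (by gcongr)⟩

variable [IsRiemannianManifold (𝓡 n) M]

theorem NormalChart.estimateAt {p : M} {φ : Euc n → M} {δ a m C : ℝ} (h : NormalChart p φ δ a)
    (hm : 0 < m) (hC : 0 < C) (hlow : ∀ w, m * ‖w‖ ^ 2 ≤ paramMetric φ 0 w w)
    (hcub : ∀ w ∈ ball (0 : Euc n) δ, |normalLap (paramMetric φ) w - 2 * n
      + 2 / 3 * ric (paramMetric φ) 0 w w| ≤ C * ‖w‖ ^ 3)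
    (hquad : ∀ w ∈ ball (0 : Euc n) δ, |normalLap (paramMetric φ) w - 2 * n| ≤ C * ‖w‖ ^ 2) :
    EstimateAt (n := n) p a (C / √m ^ 3) (C / √m ^ 2) := by
  intro r hr0 hra
  have hlt : ∀ x ∈ ball p r, dist p x < a := fun x hx ↦ by
    rw [Metric.mem_ball, dist_comm] at hx
    exact hx.trans hra
  refine ⟨fun x hx ↦ (h.contMDiffAt_dist_sq (hlt x hx)).contMDiffWithinAt, fun x hx ↦
    ⟨fun hne ↦ h.existsUnique_isDirection (hlt x hx) hne, ?_⟩⟩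
  obtain ⟨w, hw, rfl⟩ := h.exists_eq_of_dist_lt (hlt x hx)
  have hwb := h.mem_ball w hw.le
  have hsm : 0 < √m := Real.sqrt_pos.2 hm
  have hnorm : ‖w‖ ≤ r / √m := by
    rw [le_div_iff₀ hsm]
    have h1 : (‖w‖ * √m) ^ 2 ≤ paramMetric φ 0 w w := by
      rw [mul_pow, Real.sq_sqrt hm.le, mul_comm]
      exact hlow w
    have h2 : √(paramMetric φ 0 w w) < r := by
      rw [← h.dist_eq hw, dist_comm]
      exact hx
    exact (Real.le_sqrt_of_sq_le h1).trans h2.le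
  rw [h.laplaceBeltrami_dist_sq hw]
  constructor
  · intro v hv
    rw [mul_assoc, h.ricci_direction hw hv]
    calc _ ≤ C * ‖w‖ ^ 3 := hcub w hwb
      _ ≤ C * (r / √m) ^ 3 := by gcongr
      _ = C / √m ^ 3 * r ^ 3 := by rw [div_pow]; ring
  · calc _ ≤ C * ‖w‖ ^ 2 := hquad w hwb
      _ ≤ C * (r / √m) ^ 2 := by gcongr
      _ = C / √m ^ 2 * r ^ 2 := by rw [div_pow]; ring

theorem exists_estimateAt (c : M) : ∃ U ∈ 𝓝 c, ∃ r₀ > 0, ∃ C₁ > 0, ∃ C₂ > 0,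
    ∀ p ∈ U, EstimateAt (n := n) p r₀ C₁ C₂ := by
  have hc : extChartAt (𝓡 n) c c ∈ (extChartAt (𝓡 n) c).target := mem_extChartAt_target c
  obtain ⟨δ, e, m, C, h, he⟩ := exists_goodFamily (metricAt_chartMetric hc)
    ((isOpen_extChartAt_target (I := 𝓡 n) c).mem_nhds hc)
  have hm := Real.sqrt_pos.2 h.m_pos
  have hC := h.C_pos
  refine ⟨(extChartAt (𝓡 n) c).source ∩ extChartAt (𝓡 n) c ⁻¹' ball (extChartAt (𝓡 n) c c) δ,
    inter_mem (extChartAt_source_mem_nhds c)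
      ((continuousAt_extChartAt c).preimage_mem_nhds (ball_mem_nhds _ h.pos)),
    √m * (δ / 2), mul_pos hm (half_pos h.pos), C / √m ^ 3, by positivity, C / √m ^ 2,
    by positivity, fun p hp ↦ ?_⟩
  have hN := normalChart_familyParam h he hp.1 hp.2
  have heq := eqOn_paramMetric_familyParam h he hp.2
  have hev : ∀ w ∈ ball (0 : Euc n) δ, paramMetric (familyParam c e p) =ᶠ[𝓝 w]
      (pullMetric (chartMetric c) fun w ↦ e (extChartAt (𝓡 n) c p, w)) := fun w hw ↦
    heq.eventuallyEq_of_mem (isOpen_ball.mem_nhds hw)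
  refine hN.estimateAt h.m_pos h.C_pos (fun w ↦ ?_) (fun w hw ↦ ?_) (fun w hw ↦ ?_)
  · rw [paramMetric_familyParam_zero h he hp.2]
    exact h.lower _ hp.2 w
  · rw [normalLap_congr (hev w hw), ric_congr ((h.normal _ hp.2).metricAt_zero)
      (hev 0 (mem_ball_self h.pos))]
    exact h.cubic _ hp.2 w hw
  · rw [normalLap_congr (hev w hw)]
    exact h.quadratic _ hp.2 w hw

/-- The estimate holds with uniform constants on compact sets. -/
theorem exists_estimateAt_of_isCompact {K : Set M} (hK : IsCompact K) :
    ∃ r₀ > 0, ∃ C₁ > 0, ∃ C₂ > 0, ∀ p ∈ K, EstimateAt (n := n) p r₀ C₁ C₂ := by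
  refine hK.induction_on (p := fun s ↦ ∃ r₀ > 0, ∃ C₁ > 0, ∃ C₂ > 0, ∀ p ∈ s,
    EstimateAt (n := n) p r₀ C₁ C₂) ⟨1, one_pos, 1, one_pos, 1, one_pos, by simp⟩ ?_ ?_ ?_
  · rintro s t hst ⟨r₀, hr, C₁, h₁, C₂, h₂, H⟩
    exact ⟨r₀, hr, C₁, h₁, C₂, h₂, fun p hp ↦ H p (hst hp)⟩
  · rintro s t ⟨r₀, hr, C₁, h₁, C₂, h₂, H⟩ ⟨r₀', hr', C₁', h₁', C₂', h₂', H'⟩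
    refine ⟨min r₀ r₀', lt_min hr hr', max C₁ C₁', lt_max_of_lt_left h₁, max C₂ C₂',
      lt_max_of_lt_left h₂, fun p hp ↦ ?_⟩
    rcases hp with hp | hp
    · exact (H p hp).mono (min_le_left _ _) (le_max_left _ _) (le_max_left _ _)
    · exact (H' p hp).mono (min_le_right _ _) (le_max_right _ _) (le_max_right _ _)
  · intro c _
    obtain ⟨U, hU, H⟩ := exists_estimateAt (n := n) c
    exact ⟨U, mem_nhdsWithin_of_mem_nhds hU, H⟩

end LocalEstimate

end

end KeyEstimate

end

theorem theorem2p2 {n : ℕ} {M : Type*} [MetricSpace M] [ConnectedSpace M]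
    [ChartedSpace (EuclideanSpace ℝ (Fin n)) M] [IsManifold (𝓡 n) ∞ M]
    [RiemannianBundle (fun x : M ↦ TangentSpace (𝓡 n) x)]
    [IsContMDiffRiemannianBundle (𝓡 n) ∞ (EuclideanSpace ℝ (Fin n))
      (fun x : M ↦ TangentSpace (𝓡 n) x)]
    [IsRiemannianManifold (𝓡 n) M]
    (K : Set M) (hK : IsCompact K) :
    ∃ r₀ > (0 : ℝ), ∃ C₁ > (0 : ℝ), ∃ C₂ > (0 : ℝ),
      ∀ p ∈ K, ∀ r : ℝ, 0 < r → r < r₀ →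
        ContMDiffOn (𝓡 n) 𝓘(ℝ, ℝ) ∞ (fun y : M ↦ dist p y ^ 2) (Metric.ball p r) ∧
        ∀ x ∈ Metric.ball p r,
          (x ≠ p → ∃! v : TangentSpace (𝓡 n) p, KeyEstimate.IsDirection p x v) ∧
          (∀ v : TangentSpace (𝓡 n) p, KeyEstimate.IsDirection p x v →
            |KeyEstimate.laplaceBeltrami (n := n) (fun y : M ↦ dist p y ^ 2) x - 2 * n
              + 2 / 3 * KeyEstimate.ricci p v v * dist p x ^ 2| ≤ C₁ * r ^ 3) ∧
          |KeyEstimate.laplaceBeltrami (n := n) (fun y : M ↦ dist p y ^ 2) x - 2 * n| ≤ C₂ * r ^ 2 := by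
  exact KeyEstimate.exists_estimateAt_of_isCompact hK
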